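/- Let $p\in\mathbb N$ and write $\mathbb X_{t-1}=(X_{t-1},\dots,X_{t-p})'$. Let $X=(X_t)_{t\in\mathbb Z}$ be a real-valued, strictly stationary process obeying $X_t=G(\mathbb X_{t-1},\theta,\varepsilon_t)$ for all $t$, with some $\theta\in\Theta$ and i.i.d. innovations $(\varepsilon_t)_{t\in\mathbb Z}$, where one of the following holds. (AR) $G(x,\theta,e)=\theta'x+e$, $w(x,y,\theta)=y-\theta'x$, $\Theta=\{\theta\in\mathbb R^p: 1-\theta_1z-\dots-\theta_pz^p\ne0 \text{ for all } z\in\mathbb C,\ |z|\le1\}$, $E\varepsilon_t=0$, $E\varepsilon_t^2>0$, $E\varepsilon_t^4<\infty$. (ARCH) $G(x,\theta,e)=\sigma_\theta(x)\,e$, $w(x,y,\theta)=y/\sigma_\theta(x)$ with $\sigma_\theta(x)=\sqrt{\theta_0+\theta_1x_1^2+\dots+\theta_px_p^2}$, $\Theta=\{\theta\in\mathbb R^{p+1}:\theta_0>0,\ \theta_1,\dots,\theta_p\ge0,\ \theta_1+\dots+\theta_p<1\}$, $E\varepsilon_t=0$, $E\varepsilon_t^2=1$, $E\varepsilon_t^8<\infty$.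 Let $\hat\theta=\hat\theta_n$ be a measurable function of $(X_{1-p},\dots,X_n)$ that lies in $\Theta$ with probability tending to one, and suppose that $\hat\theta\to\bar\theta$ in probability for some $\bar\theta\in\Theta$. Let $F_e$ be the law of $e_t=w(\mathbb X_{t-1},X_t,\bar\theta)$; suppose that $F_e$ has a bounded Lebesgue density and, in the case (ARCH), that $Ee_t^2=1$ (which holds automatically if $\bar\theta=\theta$). Let $\tilde\varepsilon_t=w(\mathbb X_{t-1},X_t,\hat\theta)$ and $\check\varepsilon_t=\tilde\varepsilon_t-n^{-1}\sum_{s=1}^n\tilde\varepsilon_s$ for $t=1,\dots,n$, and put $\hat\varepsilon_t=\check\varepsilon_t$ in the case (AR) and $\hat\varepsilon_t=\check\varepsilon_t/\sqrt{n^{-1}\sum_{s=1}^n\check\varepsilon_s^2}$ in the case (ARCH). Given $(X_{1-p},\dots,X_n)$, let $(X_t^*)_{t\in\mathbb Z}$ be the stationary process obeying $X_t^*=G((X^*_{t-1},\dots,X^*_{t-p})',\hat\theta,\varepsilon_t^*)$ with i.i.d. $\varepsilon_t^*$ distributed according to the empirical distribution of $\hat\varepsilon_1,\dots,\hat\varepsilon_n$.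 For probability measures $P,Q$ on $\mathbb R^m$ and a norm $\|\cdot\|$ on $\mathbb R^m$ let $d(P,Q)=\inf E[\|U-V\|\wedge1]$, the infimum being over all couplings $U\sim P$, $V\sim Q$. Then there is exactly one law of a stationary process obeying $X_t=G(\mathbb X_{t-1},\bar\theta,e_t)$ with i.i.d. innovations $e_t\sim F_e$, and it is the law of a Markov process generated by this recursion (with $e_t$ independent of the past); with probability tending to one the same holds for the recursion defining $(X_t^*)$; and, denoting by $P_{\bar\theta}$ the former law, for all $k\in\mathbb N$, all $t\in\mathbb Z$ and every norm on $\mathbb R^{k+1}$, $$d\bigl(P^{X_t^*,\dots,X_{t+k}^*},\,P_{\bar\theta}^{X_t,\dots,X_{t+k}}\bigr)\longrightarrow0\quad\text{in probability as } n\to\infty,$$ where $P^{X_t^*,\dots,X_{t+k}^*}$ is the conditional law given $(X_{1-p},\dots,X_n)$. -/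

import Mathlib

open MeasureTheory ProbabilityTheory Filter Topology
open scoped ENNReal NNReal

noncomputable section

namespace MarkovBootstrap

/-! ### Stationary solutions of `X_t = g(X_{t-1}, …, X_{t-p}; e_t)` -/

/-- The vector of lagged values `(X_{t-1}, …, X_{t-p})`. -/
def lags {Ω : Type*} (p : ℕ) (X : ℤ → Ω → ℝ) (t : ℤ) (ω : Ω) : Fin p → ℝ :=
  fun i => X (t - 1 - (i : ℤ)) ω

/-- Strict stationarity of a real-valued process indexed by `ℤ`. -/
def IsStationary {Ω : Type*} [MeasurableSpace Ω] (P : Measure Ω) (X : ℤ → Ω → ℝ) : Prop :=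
  ∀ h : ℤ, P.map (fun ω (t : ℤ) => X (t + h) ω) = P.map (fun ω (t : ℤ) => X t ω)

/-- `X` is a strictly stationary process obeying `X_t = g(X_{t-1}, …, X_{t-p}; e_t)` for all `t`,
where `(e_t)` is an i.i.d. sequence with common law `F`. -/
structure IsStationarySolution {Ω : Type*} [MeasurableSpace Ω] (P : Measure Ω) (p : ℕ)
    (g : (Fin p → ℝ) → ℝ → ℝ) (F : Measure ℝ) (X e : ℤ → Ω → ℝ) : Prop where
  measurable_process : ∀ t, Measurable (X t)
  measurable_innov : ∀ t, Measurable (e t)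
  indep_innov : iIndepFun e P
  law_innov : ∀ t, P.map (e t) = F
  stationary : IsStationary P X
  equation : ∀ t, ∀ᵐ ω ∂P, X t ω = g (lags p X t ω) (e t ω)

/-- `Q` is the law, on the path space `ℤ → ℝ`, of a strictly stationary process obeying
`X_t = g(X_{t-1}, …, X_{t-p}; e_t)` with i.i.d. innovations of law `F`.  The process and its
innovations are realised on the space of paths of pairs `(X_t, e_t)`. -/
def IsSolutionLaw (p : ℕ) (g : (Fin p → ℝ) → ℝ → ℝ) (F : Measure ℝ)
    (Q : Measure (ℤ → ℝ)) : Prop :=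
  ∃ R : Measure (ℤ → ℝ × ℝ), IsProbabilityMeasure R ∧
    IsStationarySolution R p g F (fun t ω => (ω t).1) (fun t ω => (ω t).2) ∧
    R.map (fun ω t => (ω t).1) = Q

/-- As `IsSolutionLaw`, where in addition every innovation `e_t` is independent of the past
`(X_s)_{s < t}`, so that `X` is the Markov process (of order `p`) generated by the recursion. -/
def IsMarkovSolutionLaw (p : ℕ) (g : (Fin p → ℝ) → ℝ → ℝ) (F : Measure ℝ)
    (Q : Measure (ℤ → ℝ)) : Prop :=
  ∃ R : Measure (ℤ → ℝ × ℝ), IsProbabilityMeasure R ∧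
    IsStationarySolution R p g F (fun t ω => (ω t).1) (fun t ω => (ω t).2) ∧
    (∀ t : ℤ, IndepFun (fun (ω : ℤ → ℝ × ℝ) (s : Set.Iio t) => (ω s).1)
      (fun ω => (ω t).2) R) ∧
    R.map (fun ω t => (ω t).1) = Q

/-- `Q` is *the* stationary law generated by `X_t = g(X_{t-1}, …, X_{t-p}; e_t)`, `e_t ∼ F` i.i.d.:
it is the law of a stationary Markov process generated by the recursion, and no other law is the
law of a stationary process obeying the recursion. -/
def IsTheStationaryLaw (p : ℕ) (g : (Fin p → ℝ) → ℝ → ℝ) (F : Measure ℝ)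
    (Q : Measure (ℤ → ℝ)) : Prop :=
  IsMarkovSolutionLaw p g F Q ∧ ∀ Q' : Measure (ℤ → ℝ), IsSolutionLaw p g F Q' → Q' = Q

/-- The law of `(X_t, …, X_{t+k})` when the path `X` has law `Q`. -/
def fdd (Q : Measure (ℤ → ℝ)) (t : ℤ) (k : ℕ) : Measure (Fin (k + 1) → ℝ) :=
  Q.map (fun x i => x (t + (i : ℤ)))

/-- The metric `d(P, Q) = inf E[N(X - Y) ∧ 1]`, the infimum being over all couplings `(X, Y)` of
`P` and `Q`, for a norm `N` on `ℝ^m`. -/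
def couplingDist {m : ℕ} (N : (Fin m → ℝ) → ℝ) (P Q : Measure (Fin m → ℝ)) : ℝ≥0∞ :=
  ⨅ (π : Measure ((Fin m → ℝ) × (Fin m → ℝ))) (_ : π.map Prod.fst = P) (_ : π.map Prod.snd = Q),
    ∫⁻ z, ENNReal.ofReal (min (N (z.1 - z.2)) 1) ∂π

/-! ### The autoregressive and the ARCH model classes -/

/-- The two model classes: `AR(p)` and `ARCH(p)`. -/
inductive ModelClass
  | ar
  | arch

namespace ModelClass

/-- Number of parameters: `θ = (θ_1, …, θ_p)` for `AR(p)`, `θ = (θ_0, …, θ_p)` for `ARCH(p)`. -/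
def dim (p : ℕ) : ModelClass → ℕ
  | ar => p
  | arch => p + 1

/-- The conditional standard deviation `√(θ_0 + θ_1 x_1² + … + θ_p x_p²)` of the ARCH model. -/
def archScale {p : ℕ} (x : Fin p → ℝ) (θ : Fin (p + 1) → ℝ) : ℝ :=
  √(θ 0 + ∑ i : Fin p, θ i.succ * x i ^ 2)

/-- The function `G(x, θ, e)` generating the process. -/
def G (p : ℕ) : (M : ModelClass) → (Fin p → ℝ) → (Fin (M.dim p) → ℝ) → ℝ → ℝ
  | ar => fun x (θ : Fin p → ℝ) e => ∑ i, θ i * x i + e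
  | arch => fun x (θ : Fin (p + 1) → ℝ) e => archScale x θ * e

/-- The function `w(x, y, θ)` recovering the innovation. -/
def w (p : ℕ) : (M : ModelClass) → (Fin p → ℝ) → ℝ → (Fin (M.dim p) → ℝ) → ℝ
  | ar => fun x y (θ : Fin p → ℝ) => y - ∑ i, θ i * x i
  | arch => fun x y (θ : Fin (p + 1) → ℝ) => y / archScale x θ

/-- The parameter set `Θ`. -/
def Θ (p : ℕ) : (M : ModelClass) → Set (Fin (M.dim p) → ℝ)
  | ar => {θ : Fin p → ℝ |
      ∀ z : ℂ, ‖z‖ ≤ 1 → 1 - ∑ i : Fin p, (θ i : ℂ) * z ^ ((i : ℕ) + 1) ≠ 0}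
  | arch => {θ : Fin (p + 1) → ℝ |
      0 < θ 0 ∧ (∀ i : Fin p, 0 ≤ θ i.succ) ∧ ∑ i : Fin p, θ i.succ < 1}

/-- The moment conditions on the law of the innovations `ε_t`: `E ε = 0`, `E ε² > 0`,
`E ε⁴ < ∞` for AR and `E ε = 0`, `E ε² = 1`, `E ε⁸ < ∞` for ARCH. -/
def InnovationMoments : ModelClass → Measure ℝ → Prop
  | ar => fun F => ∫ x, x ∂F = 0 ∧ 0 < ∫ x, x ^ 2 ∂F ∧ Integrable (fun x : ℝ => x ^ 4) F
  | arch => fun F => ∫ x, x ∂F = 0 ∧ ∫ x, x ^ 2 ∂F = 1 ∧ Integrable (fun x : ℝ => x ^ 8) F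

end ModelClass

/-! ### The residual bootstrap -/

/-- The sample `(X_{1-p}, …, X_n)`. -/
def sample {Ω : Type*} (p : ℕ) (X : ℤ → Ω → ℝ) (n : ℕ) (ω : Ω) : Fin (p + n) → ℝ :=
  fun i => X (1 - (p : ℤ) + (i : ℤ)) ω

/-- Centering of `n` numbers: `a_t - n⁻¹ ∑_s a_s`. -/
def center {n : ℕ} (a : Fin n → ℝ) : Fin n → ℝ :=
  fun t => a t - (n : ℝ)⁻¹ * ∑ s, a s

/-- Rescaling of `n` numbers to unit empirical second moment: `a_t / √(n⁻¹ ∑_s a_s²)`. -/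
def rescale {n : ℕ} (a : Fin n → ℝ) : Fin n → ℝ :=
  fun t => a t / √((n : ℝ)⁻¹ * ∑ s, a s ^ 2)

/-- The adjustment of the estimated residuals: they are centered in the AR case, and centered and
then rescaled in the ARCH case. -/
def ModelClass.adjust {n : ℕ} : ModelClass → (Fin n → ℝ) → Fin n → ℝ
  | .ar => fun a => center a
  | .arch => fun a => rescale (center a)

/-- The estimated residuals `w(X_{t-1}, …, X_{t-p}; X_t, θ)`, `t = 1, …, n`. -/
def residuals {Ω : Type*} (p : ℕ) (M : ModelClass) (X : ℤ → Ω → ℝ) (n : ℕ)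
    (θ : Fin (M.dim p) → ℝ) (ω : Ω) : Fin n → ℝ :=
  fun i => M.w p (lags p X ((i : ℤ) + 1) ω) (X ((i : ℤ) + 1) ω) θ

/-- The empirical distribution of `n` real numbers. -/
def empirical {n : ℕ} (a : Fin n → ℝ) : Measure ℝ :=
  (n : ℝ≥0∞)⁻¹ • ∑ i, Measure.dirac (a i)

/-- The law of the bootstrap innovations: the empirical distribution of the adjusted residuals
belonging to the estimated parameter `θ`. -/
def bootstrapInnovationLaw {Ω : Type*} (p : ℕ) (M : ModelClass) (X : ℤ → Ω → ℝ) (n : ℕ)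
    (θ : Fin (M.dim p) → ℝ) (ω : Ω) : Measure ℝ :=
  empirical (M.adjust (residuals p M X n θ ω))

/-- `Q` is the law, given the sample, of the stationary bootstrap process
`X*_t = G(X*_{t-1}, …, X*_{t-p}; θ̂, ε*_t)`, where `θ̂ = est n (X_{1-p}, …, X_n)` and the
`ε*_t` are i.i.d. with the empirical distribution of the adjusted residuals. -/
def IsBootstrapLaw {Ω : Type*} (p : ℕ) (M : ModelClass) (X : ℤ → Ω → ℝ)
    (est : (n : ℕ) → (Fin (p + n) → ℝ) → Fin (M.dim p) → ℝ) (n : ℕ) (ω : Ω)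
    (Q : Measure (ℤ → ℝ)) : Prop :=
  IsTheStationaryLaw p (fun x e => M.G p x (est n (sample p X n ω)) e)
    (bootstrapInnovationLaw p M X n (est n (sample p X n ω)) ω) Q

/-- The law `F_e` of `e_t = w(X_{t-1}, …, X_{t-p}; X_t, θ)`; for stationary `X` it does not depend
on `t`, so it is defined through `t = 0`. -/
def residualLaw {Ω : Type*} [MeasurableSpace Ω] (p : ℕ) (M : ModelClass) (P : Measure Ω)
    (X : ℤ → Ω → ℝ) (θ : Fin (M.dim p) → ℝ) : Measure ℝ :=
  P.map (fun ω => M.w p (lags p X 0 ω) (X 0 ω) θ)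

/-- `F` has a bounded Lebesgue density. -/
def HasBoundedDensity (F : Measure ℝ) : Prop :=
  ∃ f : ℝ → ℝ≥0∞, Measurable f ∧ (∃ C : ℝ≥0, ∀ x, f x ≤ C) ∧ F = volume.withDensity f

end MarkovBootstrap

end

set_option linter.unusedSectionVars false

noncomputable section

namespace MarkovBootstrap

/-! ### I.i.d. sequences -/

/-- The law of an i.i.d. family, indexed by `ι`, with common law `F`. -/
abbrev iid {E : Type*} [MeasurableSpace E] (ι : Type*) (F : Measure E) : Measure (ι → E) :=
  Measure.infinitePi fun _ : ι => F

section iid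

variable {E : Type*} [MeasurableSpace E] {F : Measure E} [IsProbabilityMeasure F] {ι κ : Type*}

lemma iid_map_reindex {f : κ → ι} (hf : Function.Injective f) :
    (iid ι F).map (fun a k => a (f k)) = iid κ F :=
  Measure.map_infinitePi_infinitePi_of_inj (P := fun _ : ι => F) hf

lemma measurePreserving_reindex {f : κ → ι} (hf : Function.Injective f) :
    MeasurePreserving (fun (a : ι → E) k => a (f k)) (iid ι F) (iid κ F) :=
  ⟨by fun_prop, iid_map_reindex hf⟩

lemma measurePreserving_eval_iid (i : ι) :
    MeasurePreserving (fun a : ι → E => a i) (iid ι F) F :=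
  measurePreserving_eval_infinitePi (fun _ : ι => F) i

lemma iid_map_comp {E' : Type*} [MeasurableSpace E'] {f : E → E'} (hf : Measurable f) :
    (iid ι F).map (fun a i => f (a i)) = iid ι (F.map f) := by
  have := Measure.isProbabilityMeasure_map (μ := F) hf.aemeasurable
  exact Measure.infinitePi_map_pi (fun _ : ι => F) (fun _ => hf)

lemma iIndepFun_eval_iid : iIndepFun (fun (i : ι) (a : ι → E) => a i) (iid ι F) :=
  iIndepFun_infinitePi (P := fun _ : ι => F) (X := fun _ x => x) fun _ => measurable_id

/-- A measurable function of the coordinates in `S` is measurable for the σ-algebra they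
generate. -/
lemma comap_le_of_dependsOn {β : Type*} [mβ : MeasurableSpace β] {f : (ι → E) → β}
    (hf : Measurable f) {S : Set ι} (hS : DependsOn f S) :
    mβ.comap f ≤ ⨆ i ∈ S, MeasurableSpace.comap (fun a : ι → E => a i) inferInstance := by
  classical
  rcases isEmpty_or_nonempty (ι → E) with h | ⟨⟨a₀⟩⟩
  · rintro s ⟨t, -, rfl⟩
    rw [Set.eq_empty_of_isEmpty (f ⁻¹' t)]
    exact @MeasurableSet.empty _ (_)
  · have hr : f = f ∘ fun a i => if i ∈ S then a i else a₀ i := by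
      ext a
      exact hS fun i hi => by simp [hi]
    have hm : @Measurable _ _ (⨆ i ∈ S, MeasurableSpace.comap (fun a : ι → E => a i) inferInstance)
        _ fun (a : ι → E) i => if i ∈ S then a i else a₀ i := ?_
    · rintro s ⟨t, ht, rfl⟩
      rw [hr, Set.preimage_comp]
      exact hm (hf ht)
    rw [@measurable_pi_iff _ _ _ (_)]
    intro i
    by_cases hi : i ∈ S
    · simp only [hi, if_true]
      rw [measurable_iff_comap_le]
      exact le_iSup₂_of_le i hi le_rfl
    · simp only [hi, if_false]
      exact measurable_const

lemma indepFun_of_dependsOn {β γ : Type*} [MeasurableSpace β] [MeasurableSpace γ]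
    {f : (ι → E) → β} {g : (ι → E) → γ} (hf : Measurable f) (hg : Measurable g) {S T : Set ι}
    (hS : DependsOn f S) (hT : DependsOn g T) (hST : Disjoint S T) :
    IndepFun f g (iid ι F) := by
  have h := indep_iSup_of_disjoint (fun i => (measurable_pi_apply i).comap_le)
    (iIndepFun_eval_iid (F := F) (ι := ι)).iIndep hST
  exact indep_of_indep_of_le_left (indep_of_indep_of_le_right h (comap_le_of_dependsOn hg hT))
    (comap_le_of_dependsOn hf hS)

lemma lintegral_mul_of_dependsOn {f g : (ι → E) → ℝ≥0∞} (hf : Measurable f) (hg : Measurable g)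
    {S T : Set ι} (hS : DependsOn f S) (hT : DependsOn g T) (hST : Disjoint S T) :
    ∫⁻ a, f a * g a ∂iid ι F = (∫⁻ a, f a ∂iid ι F) * ∫⁻ a, g a ∂iid ι F :=
  lintegral_mul_eq_lintegral_mul_lintegral_of_indepFun hf hg (indepFun_of_dependsOn hf hg hS hT hST)

/-- Removing the first term of a sequence. -/
def tail (a : ℕ → E) : ℕ → E := fun j => a (j + 1)

@[fun_prop]
lemma measurable_tail : Measurable (tail : (ℕ → E) → ℕ → E) :=
  measurable_pi_iff.2 fun j => measurable_pi_apply (j + 1)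

lemma measurePreserving_tail : MeasurePreserving tail (iid ℕ F) (iid ℕ F) :=
  measurePreserving_reindex (f := fun j => j + 1) (add_left_injective 1)

lemma map_zero_tail :
    (iid ℕ F).map (fun a => (a 0, tail a)) = F.prod (iid ℕ F) := by
  have h : IndepFun (fun a : ℕ → E => a 0) tail (iid ℕ F) :=
    indepFun_of_dependsOn (measurable_pi_apply 0) measurable_tail (S := {0}) (T := Set.Ioi 0)
      (fun _ _ hab => hab 0 rfl) (fun _ _ hab => funext fun j => hab (j + 1) (Nat.succ_pos j))
      (by simp)
  rw [h.map_prod_eq_prod_map_map (measurable_pi_apply 0).aemeasurable measurable_tail.aemeasurable,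
    (measurePreserving_eval_iid 0).map_eq, measurePreserving_tail.map_eq]

lemma lintegral_zero_tail {f : E → (ℕ → E) → ℝ≥0∞} (hf : Measurable (Function.uncurry f)) :
    ∫⁻ a, f (a 0) (tail a) ∂iid ℕ F = ∫⁻ a, ∫⁻ x, f x a ∂F ∂iid ℕ F := by
  have h := lintegral_map (μ := iid ℕ F) hf ((measurable_pi_apply 0).prodMk measurable_tail)
  simp only [Function.uncurry] at h
  rw [← h, map_zero_tail]
  exact lintegral_prod_symm _ hf.aemeasurable

/-- The present and past `(e_t, e_{t-1}, …)` of a two-sided sequence. -/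
def past (e : ℤ → E) (t : ℤ) : ℕ → E := fun j => e (t - j)

@[fun_prop]
lemma measurable_past (t : ℤ) : Measurable fun e : ℤ → E => past e t :=
  measurable_pi_iff.2 fun j => measurable_pi_apply (t - j)

lemma measurePreserving_past (t : ℤ) :
    MeasurePreserving (fun e : ℤ → E => past e t) (iid ℤ F) (iid ℕ F) :=
  measurePreserving_reindex (f := fun j : ℕ => t - (j : ℤ)) fun i j h => by simpa using h

lemma tail_past (e : ℤ → E) (t : ℤ) : tail (past e t) = past e (t - 1) := by
  ext j; simp only [tail, past]; congr 1; push_cast; ring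

lemma iterate_tail_apply (m : ℕ) (a : ℕ → E) (j : ℕ) : tail^[m] a j = a (j + m) := by
  induction m generalizing a with
  | zero => rfl
  | succ m ih => rw [Function.iterate_succ_apply, ih]; rfl

lemma measurePreserving_iterate_tail (m : ℕ) :
    MeasurePreserving (tail^[m]) (iid ℕ F) (iid ℕ F) := measurePreserving_tail.iterate m

/-- Shift of a two-sided sequence. -/
def shift (h : ℤ) (e : ℤ → E) : ℤ → E := fun t => e (t + h)

@[fun_prop]
lemma measurable_shift (h : ℤ) : Measurable (shift h : (ℤ → E) → ℤ → E) :=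
  measurable_pi_iff.2 fun j => measurable_pi_apply (j + h)

lemma measurePreserving_shift (h : ℤ) : MeasurePreserving (shift h) (iid ℤ F) (iid ℤ F) :=
  measurePreserving_reindex (f := fun t : ℤ => t + h) (add_left_injective h)

lemma past_shift (h t : ℤ) (e : ℤ → E) : past (shift h e) t = past e (t + h) := by
  ext j; simp only [past, shift]; congr 1; ring

/-- The joint law of an i.i.d. family. -/
lemma map_eq_iid {Ω : Type*} [MeasurableSpace Ω] {P : Measure Ω} {e : ι → Ω → E}
    (he : ∀ i, Measurable (e i)) (hi : iIndepFun e P) (hF : ∀ i, P.map (e i) = F) :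
    P.map (fun ω i => e i ω) = iid ι F := by
  rw [hi.map_fun_eq_infinitePi_map he]
  simp only [hF]

end iid

/-! ### Gauges and backward iteration -/

/-- A continuous map `ℝ → ℝ` with uniformly continuous inverse. -/
structure Gauge (T : ℝ → ℝ) : Prop where
  cont : Continuous T
  inv : ∀ ε > 0, ∃ δ > 0, ∀ x y, |T x - T y| < δ → |x - y| < ε

lemma Gauge.injective {T : ℝ → ℝ} (hT : Gauge T) : Function.Injective T := by
  intro x y h
  by_contra hne
  obtain ⟨δ, hδ, H⟩ := hT.inv |x - y| (abs_pos.2 (sub_ne_zero.2 hne))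
  exact lt_irrefl _ (H x y (by simpa [h] using hδ))

lemma Gauge.measurable {T : ℝ → ℝ} (hT : Gauge T) : Measurable T := hT.cont.measurable

/-- The distance of `T x` and `T y`, coordinatewise, in the maximum norm. -/
def gdist {p : ℕ} (T : ℝ → ℝ) (x y : Fin p → ℝ) : ℝ≥0∞ := edist (T ∘ x) (T ∘ y)

section gauge

variable {p : ℕ} {T : ℝ → ℝ}

lemma gdist_comm (x y : Fin p → ℝ) : gdist T x y = gdist T y x := edist_comm _ _

lemma gdist_triangle (x y z : Fin p → ℝ) : gdist T x z ≤ gdist T x y + gdist T y z :=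
  edist_triangle _ _ _

lemma gdist_self (x : Fin p → ℝ) : gdist T x x = 0 := edist_self _

lemma gdist_ne_top (x y : Fin p → ℝ) : gdist T x y ≠ ∞ := edist_ne_top _ _

lemma edist_le_gdist (x y : Fin p → ℝ) (i : Fin p) : edist (T (x i)) (T (y i)) ≤ gdist T x y :=
  edist_le_pi_edist (T ∘ x) (T ∘ y) i

lemma continuous_gauge_comp (hT : Gauge T) : Continuous fun x : Fin p → ℝ => T ∘ x :=
  continuous_pi fun i => hT.cont.comp (continuous_apply i)

lemma Measurable.gdist {α : Type*} [MeasurableSpace α] (hT : Gauge T) {f g : α → Fin p → ℝ}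
    (hf : Measurable f) (hg : Measurable g) : Measurable fun a => gdist T (f a) (g a) :=
  ((continuous_gauge_comp hT).measurable.comp hf).edist
    ((continuous_gauge_comp hT).measurable.comp hg)

lemma eq_of_gdist_eq_zero (hT : Gauge T) {x y : Fin p → ℝ} (h : gdist T x y = 0) : x = y := by
  have := edist_eq_zero.1 h
  exact funext fun i => hT.injective (congrFun this i)

lemma Gauge.exists_tendsto (hT : Gauge T) {f : ℕ → Fin p → ℝ}
    (hf : CauchySeq fun m => T ∘ f m) : ∃ z, Tendsto f atTop (𝓝 z) := by
  have : CauchySeq f := by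
    rw [Metric.cauchySeq_iff] at hf ⊢
    intro ε hε
    obtain ⟨δ, hδ, H⟩ := hT.inv (ε / 2) (half_pos hε)
    obtain ⟨N, hN⟩ := hf δ hδ
    refine ⟨N, fun m hm n hn => lt_of_le_of_lt ((dist_pi_le_iff (half_pos hε).le).2 fun i => ?_)
      (half_lt_self hε)⟩
    rw [Real.dist_eq]
    refine (H _ _ ?_).le
    exact ((dist_le_pi_dist (T ∘ f m) (T ∘ f n) i).trans_lt (hN m hm n hn))
  exact cauchySeq_tendsto_of_complete this

/-- The transition of the state `(X_{t-1}, …, X_{t-p})` to `(X_t, …, X_{t-p+1})`. -/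
def step (g : (Fin p → ℝ) → ℝ → ℝ) (e : ℝ) (x : Fin p → ℝ) : Fin p → ℝ :=
  fun i => (Fin.cons (g x e) x : Fin (p + 1) → ℝ) i.castSucc

lemma step_zero {g : (Fin p → ℝ) → ℝ → ℝ} {e : ℝ} {x : Fin p → ℝ} {i : Fin p}
    (hi : i.castSucc = 0) : step g e x i = g x e := by simp [step, hi]

lemma step_succ {g : (Fin p → ℝ) → ℝ → ℝ} {e : ℝ} {x : Fin p → ℝ} {i j : Fin p}
    (hi : i.castSucc = j.succ) : step g e x i = x j := by simp [step, hi]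

/-- The state reached from `x` through the innovations `a 0, …, a (m - 1)`, of which `a 0` is the
most recent one. -/
def iter (g : (Fin p → ℝ) → ℝ → ℝ) : ℕ → (ℕ → ℝ) → (Fin p → ℝ) → (Fin p → ℝ)
  | 0, _, x => x
  | m + 1, a, x => step g (a 0) (iter g m (tail a) x)

lemma iter_succ (g : (Fin p → ℝ) → ℝ → ℝ) (m : ℕ) (a : ℕ → ℝ) (x : Fin p → ℝ) :
    iter g (m + 1) a x = step g (a 0) (iter g m (tail a) x) := rfl

lemma iter_succ' (g : (Fin p → ℝ) → ℝ → ℝ) (m : ℕ) (a : ℕ → ℝ) (x : Fin p → ℝ) :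
    iter g (m + 1) a x = iter g m a (step g (a m) x) := by
  induction m generalizing a with
  | zero => rfl
  | succ m ih => rw [iter_succ, ih, iter_succ]; rfl

/-- The limiting state generated by the innovations `a 0, a 1, …`. -/
def sol (g : (Fin p → ℝ) → ℝ → ℝ) (a : ℕ → ℝ) : Fin p → ℝ :=
  fun i => limsup (fun m => iter g m a 0 i) atTop

/-- The stationary solution as a function of the present and past innovations. -/
def out (g : (Fin p → ℝ) → ℝ → ℝ) (a : ℕ → ℝ) : ℝ := g (sol g (tail a)) (a 0)

lemma sol_eq_of_tendsto {g : (Fin p → ℝ) → ℝ → ℝ} {a : ℕ → ℝ} {z : Fin p → ℝ}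
    (h : Tendsto (fun m => iter g m a 0) atTop (𝓝 z)) : sol g a = z :=
  funext fun i => ((tendsto_pi_nhds.1 h) i).limsup_eq

section measurability

variable {g : (Fin p → ℝ) → ℝ → ℝ} (hg : Measurable (Function.uncurry g))
include hg

lemma measurable_step : Measurable fun z : ℝ × (Fin p → ℝ) => step g z.1 z.2 := by
  refine measurable_pi_iff.2 fun i => ?_
  rcases Fin.eq_zero_or_eq_succ i.castSucc with h | ⟨j, h⟩
  · simp only [step_zero h]
    exact hg.comp measurable_swap
  · simp only [step_succ h]
    exact (measurable_pi_apply j).comp measurable_snd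

lemma measurable_iter (m : ℕ) :
    Measurable fun z : (ℕ → ℝ) × (Fin p → ℝ) => iter g m z.1 z.2 := by
  induction m with
  | zero => exact measurable_snd
  | succ m ih =>
    have h : Measurable fun z : (ℕ → ℝ) × (Fin p → ℝ) => (z.1 0, iter g m (tail z.1) z.2) :=
      ((measurable_pi_apply 0).comp measurable_fst).prodMk
        (ih.comp ((measurable_tail.comp measurable_fst).prodMk measurable_snd))
    exact (measurable_step hg).comp h

lemma measurable_sol : Measurable (sol g) :=
  measurable_pi_iff.2 fun i => Measurable.limsup fun m => (measurable_pi_apply i).comp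
    ((measurable_iter hg m).comp (measurable_id.prodMk measurable_const))

lemma measurable_out : Measurable (out g) :=
  hg.comp (((measurable_sol hg).comp measurable_tail).prodMk (measurable_pi_apply 0))

end measurability

/-- The recursion is contracting: the Lipschitz constants `Λ m a` of the `m`-fold iterate are
summable in mean. -/
structure Contracts (T : ℝ → ℝ) (g : (Fin p → ℝ) → ℝ → ℝ) (F : Measure ℝ)
    (Λ : ℕ → (ℕ → ℝ) → ℝ≥0∞) : Prop where
  measurable_map : Measurable (Function.uncurry g)
  continuous_map : ∀ e, Continuous fun x => g x e
  measurable : ∀ m, Measurable (Λ m)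
  dependsOn : ∀ m, DependsOn (Λ m) (Set.Iio m)
  summable : ∑' m, ∫⁻ a, Λ m a ∂iid ℕ F ≠ ∞
  lipschitz : ∀ m a x y, gdist T (iter g m a x) (iter g m a y) ≤ Λ m a * gdist T x y
  start : ∫⁻ e, gdist T 0 (step g e 0) ∂F ≠ ∞

lemma continuous_step {g : (Fin p → ℝ) → ℝ → ℝ} {e : ℝ} (h : Continuous fun x => g x e) :
    Continuous (step g e) := by
  refine continuous_pi fun i => ?_
  rcases Fin.eq_zero_or_eq_succ i.castSucc with hi | ⟨j, hi⟩
  · simpa only [step_zero hi] using h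
  · simpa only [step_succ hi] using continuous_apply j

namespace Contracts

variable {g : (Fin p → ℝ) → ℝ → ℝ} {F : Measure ℝ} [IsProbabilityMeasure F]
  {Λ : ℕ → (ℕ → ℝ) → ℝ≥0∞}

lemma lintegral_increment_le (hT : Gauge T) (h : Contracts T g F Λ) (m : ℕ) :
    ∫⁻ a, gdist T (iter g m a 0) (iter g (m + 1) a 0) ∂iid ℕ F ≤
      (∫⁻ a, Λ m a ∂iid ℕ F) * ∫⁻ e, gdist T 0 (step g e 0) ∂F := by
  have hm : Measurable fun e => gdist T 0 (step g e 0) :=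
    Measurable.gdist hT measurable_const
      ((measurable_step h.measurable_map).comp (measurable_id.prodMk measurable_const))
  calc _ ≤ ∫⁻ a, Λ m a * gdist T 0 (step g (a m) 0) ∂iid ℕ F :=
        lintegral_mono fun a => by rw [iter_succ']; exact h.lipschitz m a _ _
    _ = (∫⁻ a, Λ m a ∂iid ℕ F) * ∫⁻ a, gdist T 0 (step g (a m) 0) ∂iid ℕ F :=
        lintegral_mul_of_dependsOn (h.measurable m) (hm.comp (measurable_pi_apply m))
          (h.dependsOn m) (T := {m}) (fun a b hab => by rw [hab m rfl]) (by simp)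
    _ = _ := by rw [(measurePreserving_eval_iid m).lintegral_comp hm]

lemma tsum_lintegral_increment_ne_top (hT : Gauge T) (h : Contracts T g F Λ) :
    ∫⁻ a, ∑' m, gdist T (iter g m a 0) (iter g (m + 1) a 0) ∂iid ℕ F ≠ ∞ := by
  have hm (m : ℕ) : Measurable fun a => iter g m a 0 :=
    (measurable_iter h.measurable_map m).comp (measurable_id.prodMk measurable_const)
  rw [lintegral_tsum fun m => (Measurable.gdist hT (hm m) (hm (m + 1))).aemeasurable]
  refine ne_top_of_le_ne_top ?_ (ENNReal.tsum_le_tsum fun m => h.lintegral_increment_le hT m)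
  rw [ENNReal.tsum_mul_right]
  exact ENNReal.mul_ne_top h.summable h.start

lemma ae_tendsto (hT : Gauge T) (h : Contracts T g F Λ) :
    ∀ᵐ a ∂iid ℕ F, Tendsto (fun m => iter g m a 0) atTop (𝓝 (sol g a)) := by
  have hm (m : ℕ) : Measurable fun a => iter g m a 0 :=
    (measurable_iter h.measurable_map m).comp (measurable_id.prodMk measurable_const)
  filter_upwards [ae_lt_top (Measurable.tsum fun m => Measurable.gdist hT (hm m) (hm (m + 1)))
    (h.tsum_lintegral_increment_ne_top hT)] with a ha
  obtain ⟨z, hz⟩ := hT.exists_tendsto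
    (cauchySeq_of_edist_le_of_tsum_ne_top _ (fun n => le_rfl) ha.ne)
  rwa [sol_eq_of_tendsto hz]

lemma lintegral_sol_ne_top (hT : Gauge T) (h : Contracts T g F Λ) :
    ∫⁻ a, gdist T 0 (sol g a) ∂iid ℕ F ≠ ∞ := by
  refine ne_top_of_le_ne_top (h.tsum_lintegral_increment_ne_top hT) (lintegral_mono_ae ?_)
  filter_upwards [h.ae_tendsto hT] with a ha
  exact edist_le_tsum_of_edist_le_of_tendsto₀ _ (fun n => le_rfl)
    (((continuous_gauge_comp hT).tendsto _).comp ha)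

lemma ae_sol_eq_step (hT : Gauge T) (h : Contracts T g F Λ) :
    ∀ᵐ a ∂iid ℕ F, sol g a = step g (a 0) (sol g (tail a)) := by
  filter_upwards [measurePreserving_tail.quasiMeasurePreserving.ae (h.ae_tendsto hT)] with a ha
  refine sol_eq_of_tendsto ?_
  rw [← tendsto_add_atTop_iff_nat 1]
  exact ((continuous_step (h.continuous_map (a 0))).tendsto _).comp ha

lemma tendsto_lintegral (h : Contracts T g F Λ) :
    Tendsto (fun m => ∫⁻ a, Λ m a ∂iid ℕ F) atTop (𝓝 0) :=
  ENNReal.tendsto_atTop_zero_of_tsum_ne_top h.summable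

section process

variable {Ω : Type*} [MeasurableSpace Ω] {P : Measure Ω} {e : Ω → ℤ → ℝ}
  (he : MeasurePreserving e P (iid ℤ F))
include he

lemma ae_sol_past (hT : Gauge T) (h : Contracts T g F Λ) :
    ∀ᵐ ω ∂P, ∀ t, sol g (past (e ω) t) = step g (e ω t) (sol g (past (e ω) (t - 1))) := by
  refine ae_all_iff.2 fun t => ?_
  filter_upwards [((measurePreserving_past t).comp he).quasiMeasurePreserving.ae
    (h.ae_sol_eq_step hT)] with ω hω
  simp only [Function.comp_apply] at hω
  rw [hω, tail_past]
  simp [past]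

lemma ae_sol_apply (hT : Gauge T) (h : Contracts T g F Λ) :
    ∀ᵐ ω ∂P, ∀ t (i : Fin p), sol g (past (e ω) t) i = out g (past (e ω) (t - i)) := by
  filter_upwards [ae_sol_past he hT h] with ω hω
  have key : ∀ (n : ℕ) (hn : n < p) (t : ℤ),
      sol g (past (e ω) t) ⟨n, hn⟩ = out g (past (e ω) (t - n)) := by
    intro n
    induction n with
    | zero =>
      intro hn t
      rw [hω, step_zero (by rfl)]
      simp [out, tail_past, past]
    | succ n ih =>
      intro hn t
      rw [hω, step_succ (j := ⟨n, by omega⟩) (by ext; simp), ih]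
      congr 2; push_cast; ring
  exact fun t i => key i i.2 t

/-- The process generated by i.i.d. innovations obeys the recursion. -/
lemma ae_out_eq (hT : Gauge T) (h : Contracts T g F Λ) :
    ∀ᵐ ω ∂P, ∀ t, out g (past (e ω) t) =
      g (fun i : Fin p => out g (past (e ω) (t - 1 - (i : ℤ)))) (e ω t) := by
  filter_upwards [ae_sol_apply he hT h] with ω hω t
  rw [out, tail_past]
  congr 1
  · exact funext fun i => hω (t - 1) i
  · simp [past]

end process

end Contracts

/-- The law of the stationary process generated by i.i.d. innovations of law `F`. -/
def solutionLaw (g : (Fin p → ℝ) → ℝ → ℝ) (F : Measure ℝ) : Measure (ℤ → ℝ) :=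
  (iid ℤ F).map fun a t => out g (past a t)

lemma tendsto_measure_natCast_lt {Ω : Type*} [MeasurableSpace Ω] {P : Measure Ω}
    [IsFiniteMeasure P] {f : Ω → ℝ≥0∞} (hf : Measurable f) (hfin : ∀ ω, f ω ≠ ∞) :
    Tendsto (fun K : ℕ => P {ω | (K : ℝ≥0∞) < f ω}) atTop (𝓝 0) := by
  have h := tendsto_measure_iInter_atTop (μ := P) (s := fun K : ℕ => {ω | (K : ℝ≥0∞) < f ω})
    (fun K => (measurableSet_lt measurable_const hf).nullMeasurableSet)
    (fun K L hKL ω (hω : (L : ℝ≥0∞) < f ω) => lt_of_le_of_lt (by exact_mod_cast hKL) hω)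
    ⟨0, measure_ne_top _ _⟩
  have h0 : ⋂ K : ℕ, {ω | (K : ℝ≥0∞) < f ω} = ∅ := ?_
  · rw [h0, measure_empty] at h
    exact h
  refine Set.eq_empty_iff_forall_notMem.2 fun ω hω => ?_
  obtain ⟨K, hK⟩ := ENNReal.exists_nat_gt (hfin ω)
  exact lt_asymm hK (Set.mem_iInter.1 hω K)

lemma lags_eq_iter {Ω : Type*} {g : (Fin p → ℝ) → ℝ → ℝ} {X e : ℤ → Ω → ℝ} {ω : Ω}
    (h : ∀ t, X t ω = g (lags p X t ω) (e t ω)) (t : ℤ) (m : ℕ) :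
    lags p X (t + 1) ω = iter g m (past (fun s => e s ω) t) (lags p X (t - m + 1) ω) := by
  have hs : ∀ t, lags p X (t + 1) ω = step g (e t ω) (lags p X t ω) := by
    intro t
    ext i
    rcases Fin.eq_zero_or_eq_succ i.castSucc with hi | ⟨j, hi⟩
    · rw [step_zero hi, ← h t]
      have : (i : ℕ) = 0 := by simpa using congrArg Fin.val hi
      simp [lags, this]
    · rw [step_succ hi]
      have : (i : ℕ) = j + 1 := by simpa using congrArg Fin.val hi
      simp only [lags, this]
      congr 1; push_cast; ring
  induction m with
  | zero => simp [iter]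
  | succ m ih =>
    rw [ih, iter_succ', hs]
    congr 2
    rw [show t - ((m + 1 : ℕ) : ℤ) + 1 = t - m by push_cast; ring]

lemma map_lags_eq {Ω : Type*} [MeasurableSpace Ω] {P : Measure Ω} {X : ℤ → Ω → ℝ}
    (hX : ∀ t, Measurable (X t)) (hs : IsStationary P X) (t : ℤ) :
    P.map (lags p X t) = P.map (lags p X 0) := by
  have h := congrArg (Measure.map fun (x : ℤ → ℝ) (i : Fin p) => x (0 - 1 - (i : ℤ))) (hs t)
  rw [Measure.map_map (by fun_prop) (by fun_prop), Measure.map_map (by fun_prop) (by fun_prop)] at h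
  convert h using 2
  · ext ω i
    simp only [lags, Function.comp]
    congr 1; ring
  · ext ω i
    simp [lags]

lemma measurable_lags {Ω : Type*} [MeasurableSpace Ω] {X : ℤ → Ω → ℝ}
    (hX : ∀ t, Measurable (X t)) (t : ℤ) : Measurable (lags p X t) :=
  measurable_pi_iff.2 fun _ => hX _

/-- Every stationary solution is the causal one. -/
theorem IsStationarySolution.ae_eq_out {Ω : Type*} [MeasurableSpace Ω] {P : Measure Ω}
    [IsProbabilityMeasure P] {g : (Fin p → ℝ) → ℝ → ℝ} {F : Measure ℝ} [IsProbabilityMeasure F]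
    {Λ : ℕ → (ℕ → ℝ) → ℝ≥0∞} {X e : ℤ → Ω → ℝ} (hT : Gauge T) (h : Contracts T g F Λ)
    (hX : IsStationarySolution P p g F X e) :
    ∀ᵐ ω ∂P, ∀ t, X t ω = out g (past (fun s => e s ω) t) := by
  have he : MeasurePreserving (fun ω s => e s ω) P (iid ℤ F) :=
    ⟨measurable_pi_iff.2 hX.measurable_innov,
      map_eq_iid hX.measurable_innov hX.indep_innov hX.law_innov⟩
  have hpast (t : ℤ) : MeasurePreserving (fun ω => past (fun s => e s ω) t) P (iid ℕ F) :=
    (measurePreserving_past t).comp he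
  have heq : ∀ᵐ ω ∂P, ∀ t, X t ω = g (lags p X t ω) (e t ω) := ae_all_iff.2 hX.equation
  have hsol := h.ae_sol_past he hT
  have msol := measurable_sol h.measurable_map
  let U (t : ℤ) (ω : Ω) : ℝ≥0∞ := gdist T (lags p X (t + 1) ω) (sol g (past (fun s => e s ω) t))
  have hU : ∀ᵐ ω ∂P, ∀ t (m : ℕ), U t ω ≤ Λ m (past (fun s => e s ω) t) * U (t - m) ω := by
    filter_upwards [heq, hsol] with ω h1 h2 t m
    have h3 : sol g (past (fun s => e s ω) t) =
        iter g m (past (fun s => e s ω) t) (sol g (past (fun s => e s ω) (t - m))) := by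
      induction m with
      | zero => simp [iter]
      | succ m ih =>
        rw [iter_succ', ih, h2 (t - m)]
        congr 2
        push_cast
        rw [sub_sub]
    simp only [U]
    rw [lags_eq_iter h1 t m, h3]
    have := h.lipschitz m (past (fun s => e s ω) t) (lags p X (t - m + 1) ω)
      (sol g (past (fun s => e s ω) (t - m)))
    rwa [← h3] at this ⊢
  have mA : Measurable fun x : Fin p → ℝ => gdist T x 0 :=
    Measurable.gdist hT measurable_id measurable_const
  have mB : Measurable fun a => gdist T 0 (sol g a) :=
    Measurable.gdist hT measurable_const msol
  have tight : ∀ (t : ℤ) (K : ℕ), P {ω | (K : ℝ≥0∞) + K < U t ω} ≤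
      P {ω | (K : ℝ≥0∞) < gdist T (lags p X 0 ω) 0} +
        iid ℕ F {a | (K : ℝ≥0∞) < gdist T 0 (sol g a)} := by
    intro t K
    have hA : P {ω | (K : ℝ≥0∞) < gdist T (lags p X (t + 1) ω) 0} =
        P {ω | (K : ℝ≥0∞) < gdist T (lags p X 0 ω) 0} := by
      have hs : MeasurableSet {x : Fin p → ℝ | (K : ℝ≥0∞) < gdist T x 0} :=
        measurableSet_lt measurable_const mA
      have := map_lags_eq (p := p) hX.measurable_process hX.stationary (t + 1)
      have h2 := congrArg (fun μ : Measure (Fin p → ℝ) => μ {x | (K : ℝ≥0∞) < gdist T x 0}) this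
      simp only [Measure.map_apply (measurable_lags hX.measurable_process _) hs] at h2
      exact h2
    have hB : P {ω | (K : ℝ≥0∞) < gdist T 0 (sol g (past (fun s => e s ω) t))} =
        iid ℕ F {a | (K : ℝ≥0∞) < gdist T 0 (sol g a)} :=
      (hpast t).measure_preimage (measurableSet_lt measurable_const mB).nullMeasurableSet
    rw [← hA, ← hB]
    refine (measure_mono fun ω hω => ?_).trans (measure_union_le _ _)
    by_contra hcon
    simp only [Set.mem_union, Set.mem_ofPred_eq, not_or, not_lt] at hcon hω
    exact not_le.2 hω ((gdist_triangle _ 0 _).trans (add_le_add hcon.1 hcon.2))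
  have hUzero : ∀ t, ∀ᵐ ω ∂P, U t ω = 0 := by
    intro t
    have hlim : ∀ γ : ℝ≥0∞, γ ≠ 0 → P {ω | γ ≤ U t ω} = 0 := by
      intro γ hγ
      have hbound : ∀ K : ℕ, P {ω | γ ≤ U t ω} ≤
          P {ω | (K : ℝ≥0∞) < gdist T (lags p X 0 ω) 0} +
            iid ℕ F {a | (K : ℝ≥0∞) < gdist T 0 (sol g a)} := by
        intro K
        have hm : ∀ m : ℕ, P {ω | γ ≤ U t ω} ≤
            ((K + K) * ∫⁻ a, Λ m a ∂iid ℕ F) / γ +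
            (P {ω | (K : ℝ≥0∞) < gdist T (lags p X 0 ω) 0} +
            iid ℕ F {a | (K : ℝ≥0∞) < gdist T 0 (sol g a)}) := by
          intro m
          have h1 : P {ω | γ ≤ (K + K) * Λ m (past (fun s => e s ω) t)} ≤
              ((K + K) * ∫⁻ a, Λ m a ∂iid ℕ F) / γ := by
            by_cases hγ' : γ = ∞
            · subst hγ'
              refine le_of_eq_of_le ?_ zero_le
              have hfin : ∀ᵐ a ∂iid ℕ F, Λ m a < ∞ := ae_lt_top (h.measurable m)
                (ENNReal.ne_top_of_tsum_ne_top h.summable m)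
              refine measure_mono_null ?_ (ae_iff.1 ((hpast t).quasiMeasurePreserving.ae hfin))
              intro ω hω hlt
              exact (ENNReal.mul_lt_top (by simp) hlt).ne (top_le_iff.1 hω)
            refine (meas_ge_le_lintegral_div (((h.measurable m).comp
              (hpast t).measurable).const_mul _).aemeasurable hγ hγ').trans ?_
            rw [lintegral_const_mul _ ((h.measurable m).comp (hpast t).measurable)]
            gcongr
            exact ((hpast t).lintegral_comp (h.measurable m)).le
          refine le_trans ?_ (add_le_add h1 (tight (t - m) K))
          refine le_trans (measure_mono_ae ?_) (measure_union_le _ _)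
          filter_upwards [hU] with ω hω hmem
          change _ ∨ _
          by_contra hcon
          simp only [Set.mem_ofPred_eq, not_or, not_lt, not_le] at hcon
          have : γ ≤ (K + K) * Λ m (past (fun s => e s ω) t) :=
            (show γ ≤ U t ω from hmem).trans ((hω t m).trans (by
              rw [mul_comm]; exact mul_le_mul_left hcon.2 _))
          exact absurd this (not_le.2 hcon.1)
        have hlim : Tendsto (fun m => ((K + K) * ∫⁻ a, Λ m a ∂iid ℕ F) / γ +
            (P {ω | (K : ℝ≥0∞) < gdist T (lags p X 0 ω) 0} +
            iid ℕ F {a | (K : ℝ≥0∞) < gdist T 0 (sol g a)})) atTop (𝓝 (((K + K) * 0) / γ +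
            (P {ω | (K : ℝ≥0∞) < gdist T (lags p X 0 ω) 0} +
            iid ℕ F {a | (K : ℝ≥0∞) < gdist T 0 (sol g a)}))) :=
          (ENNReal.Tendsto.div_const (ENNReal.Tendsto.const_mul h.tendsto_lintegral
            (Or.inr (by simp))) (Or.inr hγ)).add tendsto_const_nhds
        simpa using ge_of_tendsto' hlim hm
      have hK := (tendsto_measure_natCast_lt (P := P)
        (mA.comp (measurable_lags hX.measurable_process 0)) fun _ => gdist_ne_top _ _).add
        (tendsto_measure_natCast_lt (P := iid ℕ F) mB fun _ => gdist_ne_top _ _)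
      simpa using ge_of_tendsto' hK hbound
    have : {ω | ¬ U t ω = 0} ⊆ ⋃ n : ℕ, {ω | ((n : ℝ≥0∞) + 1)⁻¹ ≤ U t ω} := by
      intro ω hω
      obtain ⟨n, hn⟩ := ENNReal.exists_inv_nat_lt hω
      exact Set.mem_iUnion.2 ⟨n, (ENNReal.inv_le_inv.2 le_self_add).trans hn.le⟩
    exact measure_mono_null this (measure_iUnion_null fun n => hlim _ (by simp))
  filter_upwards [heq, ae_all_iff.2 hUzero] with ω h1 h2 t
  have := eq_of_gdist_eq_zero hT (h2 (t - 1))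
  rw [sub_add_cancel] at this
  rw [h1 t, this, out, tail_past]
  simp [past]

end gauge

/-! ### Existence and uniqueness of the stationary law -/

section stationary

variable {p : ℕ} {T : ℝ → ℝ} {g : (Fin p → ℝ) → ℝ → ℝ} {F : Measure ℝ} [IsProbabilityMeasure F]
  {Λ : ℕ → (ℕ → ℝ) → ℝ≥0∞}

lemma measurable_out_past (hg : Measurable (Function.uncurry g)) (t : ℤ) :
    Measurable fun a : ℤ → ℝ => out g (past a t) :=
  (measurable_out hg).comp (measurable_past t)

lemma dependsOn_out_past (t : ℤ) :
    DependsOn (fun a : ℤ → ℝ => out g (past a t)) (Set.Iic t) := by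
  intro a b hab
  have : past a t = past b t := funext fun j => hab _ (by simp)
  simp only [this]

lemma solutionLaw_eq_map {Ω : Type*} [MeasurableSpace Ω] {P : Measure Ω} {e : Ω → ℤ → ℝ}
    (hg : Measurable (Function.uncurry g)) (he : MeasurePreserving e P (iid ℤ F)) :
    P.map (fun ω t => out g (past (e ω) t)) = solutionLaw g F := by
  rw [solutionLaw, ← he.map_eq, Measure.map_map
    (measurable_pi_iff.2 fun t => measurable_out_past hg t) he.measurable]
  rfl

theorem Contracts.isTheStationaryLaw (hT : Gauge T) (h : Contracts T g F Λ) :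
    IsTheStationaryLaw p g F (solutionLaw g F) := by
  have mout (t : ℤ) := measurable_out_past h.measurable_map t
  let Φ : (ℤ → ℝ) → ℤ → ℝ × ℝ := fun a t => (out g (past a t), a t)
  have mΦ : Measurable Φ := measurable_pi_iff.2 fun t => (mout t).prodMk (measurable_pi_apply t)
  have m1 (t : ℤ) : Measurable fun ω : ℤ → ℝ × ℝ => (ω t).1 := by fun_prop
  have m2 (t : ℤ) : Measurable fun ω : ℤ → ℝ × ℝ => (ω t).2 := by fun_prop
  have hR : IsProbabilityMeasure ((iid ℤ F).map Φ) :=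
    Measure.isProbabilityMeasure_map mΦ.aemeasurable
  have hlaw (t : ℤ) : ((iid ℤ F).map Φ).map (fun ω => (ω t).2) = F := by
    rw [Measure.map_map (m2 t) mΦ]
    exact (measurePreserving_eval_iid t).map_eq
  refine ⟨⟨(iid ℤ F).map Φ, hR, ?_, fun t => ?_, ?_⟩, ?_⟩
  · refine ⟨m1, m2, ?_, hlaw, fun s => ?_, fun t => ?_⟩
    · rw [iIndepFun_iff_map_fun_eq_infinitePi_map m2, Measure.map_map (by fun_prop) mΦ]
      simp only [hlaw]
      exact Measure.map_id
    · rw [Measure.map_map (by fun_prop) mΦ, Measure.map_map (by fun_prop) mΦ]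
      change (iid ℤ F).map (fun a t => out g (past a (t + s))) =
        (iid ℤ F).map (fun a t => out g (past a t))
      have := solutionLaw_eq_map h.measurable_map (measurePreserving_shift (F := F) s)
      simp only [past_shift] at this
      exact this
    · rw [ae_map_iff mΦ.aemeasurable]
      · filter_upwards [h.ae_out_eq (MeasurePreserving.id (iid ℤ F)) hT] with a ha
        exact ha t
      · have ml : Measurable fun ω : ℤ → ℝ × ℝ => lags p (fun t (ω : ℤ → ℝ × ℝ) => (ω t).1) t ω :=
          measurable_lags m1 t
        exact measurableSet_eq_fun (m1 t) (h.measurable_map.comp (ml.prodMk (m2 t)))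
  · have mpast : Measurable fun (ω : ℤ → ℝ × ℝ) (s : Set.Iio t) => (ω s).1 := by fun_prop
    have hind : IndepFun ((fun (ω : ℤ → ℝ × ℝ) (s : Set.Iio t) => (ω s).1) ∘ Φ)
        ((fun ω => (ω t).2) ∘ Φ) (iid ℤ F) :=
      indepFun_of_dependsOn (mpast.comp mΦ) ((m2 t).comp mΦ) (S := Set.Iio t) (T := {t})
        (fun a b hab => funext fun s => dependsOn_out_past s.1 fun i hi =>
          hab i (Set.mem_Iio.2 (lt_of_le_of_lt (Set.mem_Iic.1 hi) (Set.mem_Iio.1 s.2))))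
        (fun a b hab => hab t rfl) (by simp)
    rw [indepFun_iff_measure_inter_preimage_eq_mul] at hind ⊢
    intro u v hu hv
    rw [Measure.map_apply mΦ ((mpast hu).inter (m2 t hv)), Measure.map_apply mΦ (mpast hu),
      Measure.map_apply mΦ (m2 t hv)]
    exact hind u v hu hv
  · rw [Measure.map_map (by fun_prop) mΦ]
    rfl
  · rintro Q ⟨R, hR', hsol, rfl⟩
    have he : MeasurePreserving (fun (ω : ℤ → ℝ × ℝ) s => (ω s).2) R (iid ℤ F) :=
      ⟨by fun_prop, map_eq_iid m2 hsol.indep_innov hsol.law_innov⟩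
    rw [← solutionLaw_eq_map h.measurable_map he]
    refine Measure.map_congr ?_
    filter_upwards [hsol.ae_eq_out hT h] with ω hω
    exact funext hω

end stationary

/-! ### Continuity of the stationary law in the recursion -/

section perturbation

variable {p : ℕ} {T : ℝ → ℝ} {g g' : (Fin p → ℝ) → ℝ → ℝ} {F F' : Measure ℝ}
  [IsProbabilityMeasure F] [IsProbabilityMeasure F'] {Λ Λ' : ℕ → (ℕ → ℝ) → ℝ≥0∞}

lemma Contracts.ae_sol_eq_iter (hT : Gauge T) (h : Contracts T g F Λ) (m : ℕ) :
    ∀ᵐ a ∂iid ℕ F, sol g a = iter g m a (sol g (tail^[m] a)) := by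
  induction m with
  | zero => simp [iter]
  | succ m ih =>
    filter_upwards [ih, (measurePreserving_iterate_tail m).quasiMeasurePreserving.ae
      (h.ae_sol_eq_step hT)] with a h1 h2
    rw [h1, h2, iter_succ', ← Function.iterate_succ_apply' tail, iterate_tail_apply, zero_add]

lemma gdist_step_le (x' x : Fin p → ℝ) (e' e : ℝ) :
    gdist T (step g' e' x') (step g e x) ≤ edist (T (g' x' e')) (T (g x e)) + gdist T x' x := by
  refine edist_pi_le_iff.2 fun i => ?_
  simp only [Function.comp]
  rcases Fin.eq_zero_or_eq_succ i.castSucc with hi | ⟨j, hi⟩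
  · rw [step_zero hi, step_zero hi]
    exact le_self_add
  · rw [step_succ hi, step_succ hi]
    exact (edist_le_gdist x' x j).trans le_add_self

/-- The one-step comparison of two recursions, with innovations coupled by `π`. -/
def StepBound (T : ℝ → ℝ) (g' g : (Fin p → ℝ) → ℝ → ℝ) (π : Measure (ℝ × ℝ)) (L κ : ℝ≥0∞) : Prop :=
  ∀ x' x : Fin p → ℝ, ∫⁻ z, edist (T (g' x' z.1)) (T (g x z.2)) ∂π ≤
    L * gdist T x' x + κ * (1 + gdist T 0 x')

variable {π : Measure (ℝ × ℝ)} [IsProbabilityMeasure π]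

lemma measurePreserving_coord {f : ℝ × ℝ → ℝ} (hf : Measurable f) (hπ : π.map f = F) (ι : Type*) :
    MeasurePreserving (fun (a : ι → ℝ × ℝ) j => f (a j)) (iid ι π) (iid ι F) :=
  ⟨by fun_prop, by rw [iid_map_comp hf, hπ]⟩

lemma StepBound.lintegral_out_le {L κ : ℝ≥0∞} (hT : Gauge T)
    (hg : Measurable (Function.uncurry g)) (hg' : Measurable (Function.uncurry g'))
    (hπ' : π.map Prod.fst = F') (hb : StepBound T g' g π L κ) :
    ∫⁻ a, edist (T (out g' fun j => (a j).1)) (T (out g fun j => (a j).2)) ∂iid ℕ π ≤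
      L * ∫⁻ a, gdist T (sol g' fun j => (a j).1) (sol g fun j => (a j).2) ∂iid ℕ π +
        κ * (1 + ∫⁻ a, gdist T 0 (sol g' a) ∂iid ℕ F') := by
  have p1 := measurePreserving_coord measurable_fst hπ' ℕ
  have ms' : Measurable fun a : ℕ → ℝ × ℝ => sol g' fun j => (a j).1 :=
    (measurable_sol hg').comp (by fun_prop)
  have ms : Measurable fun a : ℕ → ℝ × ℝ => sol g fun j => (a j).2 :=
    (measurable_sol hg).comp (by fun_prop)
  have hmeas : Measurable (Function.uncurry fun (z : ℝ × ℝ) (b : ℕ → ℝ × ℝ) =>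
      edist (T (g' (sol g' fun j => (b j).1) z.1)) (T (g (sol g fun j => (b j).2) z.2))) := by
    exact (hT.measurable.comp (hg'.comp ((ms'.comp measurable_snd).prodMk
      (measurable_fst.comp measurable_fst)))).edist (hT.measurable.comp (hg.comp
      ((ms.comp measurable_snd).prodMk (measurable_snd.comp measurable_fst))))
  refine (lintegral_zero_tail hmeas).trans_le ((lintegral_mono fun b => hb _ _).trans ?_)
  have m0 : Measurable fun a : ℕ → ℝ × ℝ => gdist T 0 (sol g' fun j => (a j).1) :=
    Measurable.gdist hT measurable_const ms'
  have m0' : Measurable fun a => gdist T 0 (sol g' a) :=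
    Measurable.gdist hT measurable_const (measurable_sol hg')
  rw [lintegral_add_right _ ((m0.const_add 1).const_mul κ),
    lintegral_const_mul _ (Measurable.gdist hT ms' ms), lintegral_const_mul _ (m0.const_add 1),
    lintegral_add_right _ m0, ← p1.lintegral_comp m0']
  simp

lemma StepBound.lintegral_iter_le {L κ : ℝ≥0∞} (hT : Gauge T) (h : Contracts T g F Λ)
    (h' : Contracts T g' F' Λ') (hπ' : π.map Prod.fst = F') (hb : StepBound T g' g π L κ) (m : ℕ) :
    ∫⁻ a, gdist T (sol g' fun j => (a j).1)
        (iter g m (fun j => (a j).2) (sol g' (tail^[m] fun j => (a j).1))) ∂iid ℕ π ≤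
      (∑ j ∈ Finset.range m, (L + 1) ^ j) *
        (κ * (1 + ∫⁻ a, gdist T 0 (sol g' a) ∂iid ℕ F')) := by
  have p1 := measurePreserving_coord measurable_fst hπ' ℕ
  have ms' : Measurable fun a : ℕ → ℝ × ℝ => sol g' fun j => (a j).1 :=
    (measurable_sol h'.measurable_map).comp (by fun_prop)
  induction m with
  | zero => simp [iter, gdist_self]
  | succ m ih =>
    have mi : Measurable fun a : ℕ → ℝ × ℝ =>
        iter g m (fun j => (a j).2) (sol g' (tail^[m] fun j => (a j).1)) :=
      (measurable_iter h.measurable_map m).comp (Measurable.prodMk (by fun_prop)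
        ((measurable_sol h'.measurable_map).comp
          ((measurePreserving_iterate_tail (F := F') m).measurable.comp (by fun_prop))))
    have hmeas : Measurable (Function.uncurry fun (z : ℝ × ℝ) (b : ℕ → ℝ × ℝ) =>
        gdist T (step g' z.1 (sol g' fun j => (b j).1)) (step g z.2
          (iter g m (fun j => (b j).2) (sol g' (tail^[m] fun j => (b j).1))))) := by
      exact Measurable.gdist hT ((measurable_step h'.measurable_map).comp
          ((measurable_fst.comp measurable_fst).prodMk (ms'.comp measurable_snd)))
        ((measurable_step h.measurable_map).comp
          ((measurable_snd.comp measurable_fst).prodMk (mi.comp measurable_snd)))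
    have m0 : Measurable fun a : ℕ → ℝ × ℝ => gdist T 0 (sol g' fun j => (a j).1) :=
      Measurable.gdist hT measurable_const ms'
    have m0' : Measurable fun a => gdist T 0 (sol g' a) :=
      Measurable.gdist hT measurable_const (measurable_sol h'.measurable_map)
    calc _ = ∫⁻ a, gdist T (step g' (a 0).1 (sol g' fun j => (tail a j).1)) (step g (a 0).2
          (iter g m (fun j => (tail a j).2) (sol g' (tail^[m] fun j => (tail a j).1)))) ∂iid ℕ π := by
          refine lintegral_congr_ae ?_
          filter_upwards [p1.quasiMeasurePreserving.ae (h'.ae_sol_eq_step hT)] with a ha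
          rw [ha, iter_succ, Function.iterate_succ_apply]
          rfl
      _ = ∫⁻ b, ∫⁻ z, gdist T (step g' z.1 (sol g' fun j => (b j).1)) (step g z.2
          (iter g m (fun j => (b j).2) (sol g' (tail^[m] fun j => (b j).1)))) ∂π ∂iid ℕ π :=
          lintegral_zero_tail hmeas
      _ ≤ ∫⁻ b, ((L + 1) * gdist T (sol g' fun j => (b j).1)
          (iter g m (fun j => (b j).2) (sol g' (tail^[m] fun j => (b j).1))) +
          κ * (1 + gdist T 0 (sol g' fun j => (b j).1))) ∂iid ℕ π := by
          refine lintegral_mono fun b => (lintegral_mono fun z => gdist_step_le _ _ _ _).trans ?_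
          rw [lintegral_add_right _ measurable_const, lintegral_const, measure_univ, mul_one,
            add_mul, one_mul, add_right_comm]
          exact add_le_add_left (hb _ _) _
      _ = (L + 1) * ∫⁻ b, gdist T (sol g' fun j => (b j).1)
          (iter g m (fun j => (b j).2) (sol g' (tail^[m] fun j => (b j).1))) ∂iid ℕ π +
          κ * (1 + ∫⁻ a, gdist T 0 (sol g' a) ∂iid ℕ F') := by
          rw [lintegral_add_right _ ((m0.const_add 1).const_mul κ),
            lintegral_const_mul _ (Measurable.gdist hT ms' mi),
            lintegral_const_mul _ (m0.const_add 1),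
            lintegral_add_right _ m0, ← p1.lintegral_comp m0']
          simp
      _ ≤ _ := by
          rw [Finset.sum_range_succ', add_mul _ ((L + 1) ^ 0), pow_zero, one_mul]
          refine add_le_add_left ?_ _
          simp only [pow_succ']
          rw [← Finset.mul_sum, mul_assoc]
          exact mul_le_mul_right ih _

lemma absorb_le {d C κ M : ℝ≥0∞} (hd : d ≠ ∞) (hM : M ≠ ∞) (hCκ : C * κ ≤ 4⁻¹)
    (h : d ≤ C * (κ * (1 + (M + d))) + 2⁻¹ * d) : d ≤ 4 * (C * κ) * (1 + M) := by
  rw [← mul_assoc] at h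
  generalize C * κ = c at *
  have hc : c ≠ ∞ := ne_top_of_le_ne_top (by simp) hCκ
  lift d to ℝ≥0 using hd
  lift M to ℝ≥0 using hM
  lift c to ℝ≥0 using hc
  have h4 : (4 : ℝ≥0∞)⁻¹ = ((4⁻¹ : ℝ≥0) : ℝ≥0∞) := by norm_num
  have h2 : (2 : ℝ≥0∞)⁻¹ = ((2⁻¹ : ℝ≥0) : ℝ≥0∞) := by norm_num
  rw [h4] at hCκ
  rw [h2] at h
  norm_cast at *
  have a1 : (c : ℝ) ≤ 4⁻¹ := by exact_mod_cast hCκ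
  have a2 : (d : ℝ) ≤ c * (1 + (M + d)) + 2⁻¹ * d := by exact_mod_cast h
  have a3 : (d : ℝ) ≤ 4 * c * (1 + M) := by
    nlinarith [mul_le_mul_of_nonneg_right a1 d.2]
  exact_mod_cast a3

/-- If the recursion and the innovations are slightly perturbed, the stationary solution changes
little in mean. -/
theorem Contracts.exists_lintegral_out_le (hT : Gauge T) (h : Contracts T g F Λ) {L γ : ℝ≥0∞}
    (hL : L ≠ ∞) (hγ : γ ≠ 0) :
    ∃ κ₀ : ℝ≥0∞, κ₀ ≠ 0 ∧ ∀ (g' : (Fin p → ℝ) → ℝ → ℝ) (F' : Measure ℝ) (_ : IsProbabilityMeasure F')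
      (Λ' : ℕ → (ℕ → ℝ) → ℝ≥0∞) (_ : Contracts T g' F' Λ') (π : Measure (ℝ × ℝ))
      (_ : IsProbabilityMeasure π) (_ : π.map Prod.fst = F') (_ : π.map Prod.snd = F)
      (_ : StepBound T g' g π L κ₀),
      ∫⁻ a, edist (T (out g' fun j => (a j).1)) (T (out g fun j => (a j).2)) ∂iid ℕ π ≤ γ := by
  obtain ⟨m, hm⟩ : ∃ m, ∫⁻ a, Λ m a ∂iid ℕ F ≤ 2⁻¹ :=
    (h.tendsto_lintegral.eventually (ge_mem_nhds (by simp))).exists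
  set C : ℝ≥0∞ := ∑ j ∈ Finset.range m, (L + 1) ^ j with hC
  have hCtop : C ≠ ∞ := by
    simp only [hC, ENNReal.sum_ne_top]
    exact fun j _ => ENNReal.pow_ne_top (by simp [hL])
  set M := ∫⁻ a, gdist T 0 (sol g a) ∂iid ℕ F with hMdef
  have hM : M ≠ ∞ := h.lintegral_sol_ne_top hT
  set B : ℝ≥0∞ := L * (4 * C * (1 + M)) + (1 + M + (1 + M)) with hB
  have hBtop : B ≠ ∞ := by simp [hB, ENNReal.mul_eq_top, hL, hCtop, hM]
  refine ⟨min (4 * C)⁻¹ (γ / B), ?_, ?_⟩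
  · refine (lt_min ?_ (ENNReal.div_pos hγ hBtop)).ne'
    simp [ENNReal.mul_eq_top, hCtop]
  intro g' F' _ Λ' h' π _ hπ' hπ hb
  set κ := min (4 * C)⁻¹ (γ / B) with hκ
  have hCκ : C * κ ≤ 4⁻¹ := by
    calc C * κ ≤ C * (4 * C)⁻¹ := mul_le_mul_right (min_le_left _ _) _
      _ = 4⁻¹ * (C * C⁻¹) := by
        rw [ENNReal.mul_inv (by simp) (by simp)]; ring
      _ ≤ 4⁻¹ * 1 := mul_le_mul_right (ENNReal.mul_inv_le_one C) _
      _ = 4⁻¹ := mul_one _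
  have p1 := measurePreserving_coord measurable_fst hπ' ℕ
  have p2 := measurePreserving_coord measurable_snd hπ ℕ
  have ms1 : Measurable fun a : ℕ → ℝ × ℝ => sol g' fun j => (a j).1 :=
    (measurable_sol h'.measurable_map).comp p1.measurable
  have ms2 : Measurable fun a : ℕ → ℝ × ℝ => sol g fun j => (a j).2 :=
    (measurable_sol h.measurable_map).comp p2.measurable
  set d := ∫⁻ a, gdist T (sol g' fun j => (a j).1) (sol g fun j => (a j).2) ∂iid ℕ π with hd
  set M' := ∫⁻ a, gdist T 0 (sol g' a) ∂iid ℕ F' with hM'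
  have m0 : Measurable fun a => gdist T 0 (sol g a) :=
    Measurable.gdist hT measurable_const (measurable_sol h.measurable_map)
  have m0' : Measurable fun a => gdist T 0 (sol g' a) :=
    Measurable.gdist hT measurable_const (measurable_sol h'.measurable_map)
  have hdtop : d ≠ ∞ := by
    refine ne_top_of_le_ne_top (ENNReal.add_ne_top.2 ⟨h'.lintegral_sol_ne_top hT, hM⟩)
      ((lintegral_mono fun a => gdist_triangle _ 0 _).trans ?_)
    rw [lintegral_add_left (Measurable.gdist hT ms1 measurable_const), hMdef,
      ← p1.lintegral_comp m0', ← p2.lintegral_comp m0]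
    simp only [gdist_comm _ (0 : Fin p → ℝ), le_refl]
  have hM'le : M' ≤ M + d := by
    rw [hM', hMdef, hd, ← p1.lintegral_comp m0', ← p2.lintegral_comp m0,
      ← lintegral_add_left (show Measurable fun a : ℕ → ℝ × ℝ => gdist T 0 (sol g fun j => (a j).2)
        from m0.comp p2.measurable)]
    refine lintegral_mono fun a => (gdist_triangle _ (sol g fun j => (a j).2) _).trans ?_
    simp only [gdist_comm (sol g _) (sol g' _)]
    exact le_rfl
  have hdle : d ≤ C * (κ * (1 + (M + d))) + 2⁻¹ * d := by
    have hΛ : ∫⁻ a, Λ m (fun j => (a j).2) * gdist T (sol g' (tail^[m] fun j => (a j).1))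
        (sol g (tail^[m] fun j => (a j).2)) ∂iid ℕ π ≤ 2⁻¹ * d := by
      have hcomm (f : ℝ × ℝ → ℝ) (a : ℕ → ℝ × ℝ) :
          (tail^[m] fun j => f (a j)) = fun j => f (tail^[m] a j) := by
        ext j; simp [iterate_tail_apply]
      have md : Measurable fun a : ℕ → ℝ × ℝ =>
          gdist T (sol g' fun j => (a j).1) (sol g fun j => (a j).2) :=
        Measurable.gdist hT ms1 ms2
      have := lintegral_mul_of_dependsOn (F := π) (f := fun a : ℕ → ℝ × ℝ => Λ m fun j => (a j).2)
        (g := fun a => gdist T (sol g' fun j => (tail^[m] a j).1) (sol g fun j => (tail^[m] a j).2))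
        ((h.measurable m).comp p2.measurable)
        (md.comp (measurePreserving_iterate_tail (F := π) m).measurable)
        (S := Set.Iio m) (T := Set.Ici m)
        (fun a b hab => h.dependsOn m fun i hi => by rw [hab i hi])
        (fun a b hab => by
          have : tail^[m] a = tail^[m] b := by
            ext j : 1
            rw [iterate_tail_apply, iterate_tail_apply]
            exact hab _ (by simp)
          simp only [this])
        (Set.disjoint_left.2 fun i hi hi' => not_lt.2 (Set.mem_Ici.1 hi') (Set.mem_Iio.1 hi))
      simp only [hcomm Prod.fst, hcomm Prod.snd]
      rw [this, p2.lintegral_comp (h.measurable m),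
        (measurePreserving_iterate_tail (F := π) m).lintegral_comp md]
      exact mul_le_mul_left hm _
    calc d ≤ ∫⁻ a, (gdist T (sol g' fun j => (a j).1)
          (iter g m (fun j => (a j).2) (sol g' (tail^[m] fun j => (a j).1))) +
          Λ m (fun j => (a j).2) * gdist T (sol g' (tail^[m] fun j => (a j).1))
        (sol g (tail^[m] fun j => (a j).2))) ∂iid ℕ π := by
          refine lintegral_mono_ae ?_
          filter_upwards [p2.quasiMeasurePreserving.ae (h.ae_sol_eq_iter hT m)] with a ha
          refine (gdist_triangle _ _ _).trans (add_le_add_right ?_ _)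
          rw [ha]
          exact h.lipschitz m _ _ _
      _ = _ := by
          refine lintegral_add_left (Measurable.gdist hT ms1 ?_) _
          exact (measurable_iter h.measurable_map m).comp (p2.measurable.prodMk
            ((measurable_sol h'.measurable_map).comp
              ((measurePreserving_iterate_tail (F := F') m).measurable.comp p1.measurable)))
      _ ≤ C * (κ * (1 + M')) + 2⁻¹ * d :=
          add_le_add (hb.lintegral_iter_le hT h h' hπ' m) hΛ
      _ ≤ _ := by gcongr
  have hd1 := absorb_le hdtop hM hCκ hdle
  have hd2 : d ≤ 1 + M := by
    refine hd1.trans ?_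
    calc 4 * (C * κ) * (1 + M) ≤ 4 * 4⁻¹ * (1 + M) := by gcongr
      _ = 1 + M := by rw [ENNReal.mul_inv_cancel (by simp) (by simp), one_mul]
  calc _ ≤ L * d + κ * (1 + M') := hb.lintegral_out_le hT h.measurable_map h'.measurable_map hπ'
    _ ≤ L * (4 * (C * κ) * (1 + M)) + κ * (1 + (M + (1 + M))) := by
      gcongr
      exact hM'le.trans (by gcongr)
    _ = κ * B := by rw [hB]; ring
    _ ≤ (γ / B) * B := by gcongr; exact min_le_right _ _
    _ ≤ γ := by rw [mul_comm]; exact ENNReal.mul_div_le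

lemma seminorm_le_of_forall_abs_le {ι : Type*} [Fintype ι] (N : Seminorm ℝ (ι → ℝ)) :
    ∃ C : ℝ, 0 < C ∧ ∀ r, 0 ≤ r → ∀ x : ι → ℝ, (∀ i, |x i| ≤ r) → N x ≤ C * r := by
  classical
  refine ⟨1 + ∑ i, N (Pi.single i 1), by positivity, fun r hr x hx => ?_⟩
  have hxs : x = ∑ i, x i • (Pi.single i 1 : ι → ℝ) := by
    ext j; simp [Finset.sum_apply, Pi.single_apply]
  calc N x = N (∑ i, x i • (Pi.single i 1 : ι → ℝ)) := by rw [← hxs]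
    _ ≤ ∑ i, N (x i • (Pi.single i 1 : ι → ℝ)) :=
      Finset.le_sum_of_subadditive N (map_zero N).le (map_add_le_add N) _ _
    _ ≤ ∑ i, r * N (Pi.single i 1) := by
      refine Finset.sum_le_sum fun i _ => ?_
      rw [map_smul_eq_mul, Real.norm_eq_abs]
      exact mul_le_mul_of_nonneg_right (hx i) (apply_nonneg N _)
    _ ≤ _ := by rw [← Finset.mul_sum]; nlinarith

/-- Continuity of the finite-dimensional distributions of the stationary law. -/
theorem Contracts.exists_couplingDist_lt (hT : Gauge T) (h : Contracts T g F Λ) {L : ℝ≥0∞}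
    (hL : L ≠ ∞) (k : ℕ) (t : ℤ) (N : Seminorm ℝ (Fin (k + 1) → ℝ)) {δ : ℝ≥0∞} (hδ : 0 < δ) :
    ∃ κ₀ : ℝ≥0∞, κ₀ ≠ 0 ∧ ∀ (g' : (Fin p → ℝ) → ℝ → ℝ) (F' : Measure ℝ) (_ : IsProbabilityMeasure F')
      (Λ' : ℕ → (ℕ → ℝ) → ℝ≥0∞) (_ : Contracts T g' F' Λ') (π : Measure (ℝ × ℝ))
      (_ : IsProbabilityMeasure π) (_ : π.map Prod.fst = F') (_ : π.map Prod.snd = F)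
      (_ : StepBound T g' g π L κ₀),
      couplingDist N (fdd (solutionLaw g' F') t k) (fdd (solutionLaw g F) t k) < δ := by
  obtain ⟨s, hs0, hsδ⟩ := ENNReal.lt_iff_exists_nnreal_btwn.1 hδ
  have hs : (0 : ℝ) < s := by exact_mod_cast hs0
  obtain ⟨C, hC, hN⟩ := seminorm_le_of_forall_abs_le N
  obtain ⟨η, hη, hηT⟩ := hT.inv (s / 2 / C) (by positivity)
  set γ : ℝ≥0∞ := ENNReal.ofReal (η * (s / 2) / (k + 1)) with hγ
  have hγ0 : γ ≠ 0 := by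
    rw [hγ, Ne, ENNReal.ofReal_eq_zero, not_le]; positivity
  obtain ⟨κ₀, hκ₀, H⟩ := h.exists_lintegral_out_le hT hL hγ0
  refine ⟨κ₀, hκ₀, fun g' F' _ Λ' h' π _ hπ' hπ hb => ?_⟩
  have key := H g' F' inferInstance Λ' h' π inferInstance hπ' hπ hb
  have p1 := measurePreserving_coord measurable_fst hπ' ℤ
  have p2 := measurePreserving_coord measurable_snd hπ ℤ
  have mo' (u : ℤ) : Measurable fun a : ℤ → ℝ × ℝ => out g' (past (fun s => (a s).1) u) :=
    (measurable_out_past h'.measurable_map u).comp p1.measurable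
  have mo (u : ℤ) : Measurable fun a : ℤ → ℝ × ℝ => out g (past (fun s => (a s).2) u) :=
    (measurable_out_past h.measurable_map u).comp p2.measurable
  have mV : Measurable fun (a : ℤ → ℝ × ℝ) (i : Fin (k + 1)) =>
      out g' (past (fun s => (a s).1) (t + (i : ℤ))) := measurable_pi_iff.2 fun i => mo' _
  have mU : Measurable fun (a : ℤ → ℝ × ℝ) (i : Fin (k + 1)) =>
      out g (past (fun s => (a s).2) (t + (i : ℤ))) := measurable_pi_iff.2 fun i => mo _
  have hfst : ((iid ℤ π).map fun a => ((fun i : Fin (k + 1) =>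
      out g' (past (fun s => (a s).1) (t + (i : ℤ)))), fun i : Fin (k + 1) =>
      out g (past (fun s => (a s).2) (t + (i : ℤ))))).map Prod.fst =
      fdd (solutionLaw g' F') t k := by
    rw [Measure.map_map measurable_fst (mV.prodMk mU), fdd,
      ← solutionLaw_eq_map h'.measurable_map p1, Measure.map_map (by fun_prop)
        (measurable_pi_iff.2 fun u => mo' u)]
    rfl
  have hsnd : ((iid ℤ π).map fun a => ((fun i : Fin (k + 1) =>
      out g' (past (fun s => (a s).1) (t + (i : ℤ)))), fun i : Fin (k + 1) =>
      out g (past (fun s => (a s).2) (t + (i : ℤ))))).map Prod.snd =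
      fdd (solutionLaw g F) t k := by
    rw [Measure.map_map measurable_snd (mV.prodMk mU), fdd,
      ← solutionLaw_eq_map h.measurable_map p2, Measure.map_map (by fun_prop)
        (measurable_pi_iff.2 fun u => mo u)]
    rfl
  refine lt_of_le_of_lt ?_ hsδ
  refine (iInf_le _ _).trans ((iInf_le _ hfst).trans ((iInf_le _ hsnd).trans ?_))
  refine (lintegral_map_le _ _).trans ?_
  have hpt : ∀ z : (Fin (k + 1) → ℝ) × (Fin (k + 1) → ℝ),
      ENNReal.ofReal (min (N (z.1 - z.2)) 1) ≤ ENNReal.ofReal (s / 2) +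
        ∑ i, (ENNReal.ofReal η)⁻¹ * edist (T (z.1 i)) (T (z.2 i)) := by
    intro z
    by_cases hz : ∀ i, |T (z.1 i) - T (z.2 i)| < η
    · refine le_trans (ENNReal.ofReal_le_ofReal ?_) le_self_add
      refine (min_le_left _ _).trans
        ((hN (s / 2 / C) (by positivity) _ fun i => (hηT _ _ (hz i)).le).trans ?_)
      field_simp
      exact le_rfl
    · push Not at hz
      obtain ⟨i, hi⟩ := hz
      refine le_trans ?_ le_add_self
      refine le_trans ?_ (Finset.single_le_sum (f := fun i =>
        (ENNReal.ofReal η)⁻¹ * edist (T (z.1 i)) (T (z.2 i))) (fun _ _ => zero_le)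
        (Finset.mem_univ i))
      calc ENNReal.ofReal (min (N (z.1 - z.2)) 1) ≤ ENNReal.ofReal 1 :=
            ENNReal.ofReal_le_ofReal (min_le_right _ _)
        _ = (ENNReal.ofReal η)⁻¹ * ENNReal.ofReal η := by
            rw [ENNReal.ofReal_one, ENNReal.inv_mul_cancel (by simpa using hη) (by simp)]
        _ ≤ _ := by
            refine mul_le_mul_right ?_ _
            rw [edist_dist, Real.dist_eq]
            exact ENNReal.ofReal_le_ofReal hi
  refine (lintegral_mono fun a => hpt _).trans ?_
  have me (u : ℤ) : Measurable fun a : ℤ → ℝ × ℝ =>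
      edist (T (out g' (past (fun s => (a s).1) u))) (T (out g (past (fun s => (a s).2) u))) :=
    (hT.measurable.comp (mo' u)).edist (hT.measurable.comp (mo u))
  have hval (u : ℤ) : ∫⁻ a, edist (T (out g' (past (fun s => (a s).1) u)))
      (T (out g (past (fun s => (a s).2) u))) ∂iid ℤ π ≤ γ := by
    have m' : Measurable fun a : ℕ → ℝ × ℝ =>
        edist (T (out g' fun j => (a j).1)) (T (out g fun j => (a j).2)) :=
      (hT.measurable.comp ((measurable_out h'.measurable_map).comp (by fun_prop))).edist
        (hT.measurable.comp ((measurable_out h.measurable_map).comp (by fun_prop)))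
    exact ((measurePreserving_past (F := π) u).lintegral_comp m').trans_le key
  rw [lintegral_add_left measurable_const, lintegral_const, measure_univ, mul_one,
    lintegral_finsetSum _ fun i _ => (me _).const_mul _]
  calc _ ≤ ENNReal.ofReal (s / 2) + ∑ i : Fin (k + 1), (ENNReal.ofReal η)⁻¹ * γ := by
        refine add_le_add_right (Finset.sum_le_sum fun i _ => ?_) _
        rw [lintegral_const_mul _ (me _)]
        exact mul_le_mul_right (hval _) _
    _ = ENNReal.ofReal (s / 2) + ENNReal.ofReal (s / 2) := by
        rw [Finset.sum_const, Finset.card_univ, Fintype.card_fin, nsmul_eq_mul, hγ,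
          ← ENNReal.ofReal_inv_of_pos hη, ← ENNReal.ofReal_natCast,
          ← ENNReal.ofReal_mul (by positivity), ← ENNReal.ofReal_mul (by positivity)]
        congr 2
        push_cast
        field_simp
    _ = s := by
        rw [← ENNReal.ofReal_add (by positivity) (by positivity), add_halves,
          ENNReal.ofReal_coe_nnreal]

end perturbation

/-! ### The `L¹` distance of distribution functions -/

/-- The indicator of `a ≤ x`. -/
def ind (a x : ℝ) : ℝ := if a ≤ x then 1 else 0

lemma measurable_ind : Measurable (Function.uncurry ind) :=
  Measurable.ite (measurableSet_le measurable_fst measurable_snd) measurable_const measurable_const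

lemma edist_ind (a b x : ℝ) : edist (ind a x) (ind b x) =
    (Set.Ico (min a b) (max a b)).indicator 1 x := by
  by_cases ha : a ≤ x <;> by_cases hb : b ≤ x
  all_goals simp [ind, Set.indicator_apply, ha, hb, not_lt, edist_dist]

lemma edist_ind' (a b x : ℝ) : edist (ind x a) (ind x b) =
    (Set.Ioc (min a b) (max a b)).indicator 1 x := by
  by_cases ha : x ≤ a <;> by_cases hb : x ≤ b
  all_goals simp [ind, Set.indicator_apply, ha, hb, not_lt, edist_dist]

lemma lintegral_edist_ind (a b : ℝ) : ∫⁻ x, edist (ind a x) (ind b x) = edist a b := by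
  simp only [edist_ind]
  rw [lintegral_indicator_one measurableSet_Ico, Real.volume_Ico, max_sub_min_eq_abs, edist_dist,
    Real.dist_eq, abs_sub_comm]

lemma lintegral_edist_ind' (a b : ℝ) : ∫⁻ x, edist (ind x a) (ind x b) = edist a b := by
  simp only [edist_ind']
  rw [lintegral_indicator_one measurableSet_Ioc, Real.volume_Ioc, max_sub_min_eq_abs, edist_dist,
    Real.dist_eq, abs_sub_comm]

/-- The `L¹` distance of the distribution functions of `μ` and `ν`. -/
def w1 (μ ν : Measure ℝ) : ℝ≥0∞ := ∫⁻ x, edist (cdf μ x) (cdf ν x)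

lemma w1_triangle (μ ν ρ : Measure ℝ) : w1 μ ρ ≤ w1 μ ν + w1 ν ρ := by
  have (κ : Measure ℝ) : Measurable fun x => cdf κ x := (monotone_cdf κ).measurable
  rw [w1, w1, w1, ← lintegral_add_left ((this μ).edist (this ν))]
  exact lintegral_mono fun x => edist_triangle _ _ _

/-- The quantile function. -/
def quantile (μ : Measure ℝ) (u : ℝ) : ℝ := sInf {x | u ≤ cdf μ x}

lemma quantile_le_iff (μ : Measure ℝ) {u : ℝ} (hu : u ∈ Set.Ioo (0 : ℝ) 1)
    (x : ℝ) : quantile μ u ≤ x ↔ u ≤ cdf μ x := by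
  have hne : {x | u ≤ cdf μ x}.Nonempty :=
    ((tendsto_cdf_atTop μ).eventually (le_mem_nhds hu.2)).exists
  obtain ⟨y, hy⟩ := ((tendsto_cdf_atBot μ).eventually (gt_mem_nhds hu.1)).exists
  have hbdd : BddBelow {x | u ≤ cdf μ x} := ⟨y, fun z hz => by
    by_contra h
    have hz' : u ≤ cdf μ z := hz
    exact absurd (hz'.trans (monotone_cdf μ (not_le.1 h).le)) (not_le.2 hy)⟩
  refine ⟨fun h => ?_, fun h => csInf_le hbdd h⟩
  have hmem : u ≤ cdf μ (quantile μ u) := by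
    have hr : Tendsto (cdf μ) (𝓝[>] (quantile μ u)) (𝓝 (cdf μ (quantile μ u))) :=
      ((cdf μ).right_continuous _).mono_left (nhdsWithin_mono _ Set.Ioi_subset_Ici_self)
    refine ge_of_tendsto hr ?_
    filter_upwards [self_mem_nhdsWithin] with z hz
    obtain ⟨v, hv, hvz⟩ := exists_lt_of_csInf_lt hne (Set.mem_Ioi.1 hz)
    exact le_trans hv (monotone_cdf μ hvz.le)
  exact hmem.trans (monotone_cdf μ h)

/-- The uniform distribution on the unit interval. -/
abbrev unif : Measure ℝ := volume.restrict (Set.Ioo 0 1)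

instance : IsProbabilityMeasure unif := ⟨by simp⟩

lemma aemeasurable_quantile (μ : Measure ℝ) : AEMeasurable (quantile μ) unif := by
  refine aemeasurable_restrict_of_monotoneOn measurableSet_Ioo fun u hu v hv huv => ?_
  rw [quantile_le_iff μ hu]
  exact huv.trans ((quantile_le_iff μ hv _).1 le_rfl)

lemma map_quantile (μ : Measure ℝ) [IsProbabilityMeasure μ] : unif.map (quantile μ) = μ := by
  have := Measure.isProbabilityMeasure_map (aemeasurable_quantile μ)
  refine Measure.ext_of_Iic _ _ fun x => ?_
  rw [Measure.map_apply_of_aemeasurable (aemeasurable_quantile μ) measurableSet_Iic,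
    Measure.restrict_apply' measurableSet_Ioo]
  have : quantile μ ⁻¹' Set.Iic x ∩ Set.Ioo 0 1 = Set.Iic (cdf μ x) ∩ Set.Ioo 0 1 := by
    ext u
    refine and_congr_left fun hu => ?_
    rw [Set.mem_preimage, Set.mem_Iic, Set.mem_Iic, quantile_le_iff μ hu]
  rw [this, ← ofReal_cdf]
  refine le_antisymm ((measure_mono (t := Set.Ioc 0 (cdf μ x)) fun u hu => ⟨hu.2.1, hu.1⟩).trans
    (by simp)) (le_trans (by simp) (measure_mono (s := Set.Ioo 0 (cdf μ x)) fun u hu =>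
      ⟨hu.2.le, hu.1, hu.2.trans_le (cdf_le_one μ x)⟩))

/-- The quantile coupling attains the `L¹` distance of the distribution functions. -/
theorem exists_coupling_le_w1 (μ ν : Measure ℝ) [IsProbabilityMeasure μ] [IsProbabilityMeasure ν] :
    ∃ π : Measure (ℝ × ℝ), π.map Prod.fst = μ ∧ π.map Prod.snd = ν ∧
      ∫⁻ z, edist z.1 z.2 ∂π ≤ w1 μ ν := by
  have hμ := aemeasurable_quantile μ
  have hν := aemeasurable_quantile ν
  refine ⟨unif.map fun u => (quantile μ u, quantile ν u), ?_, ?_, ?_⟩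
  · rw [AEMeasurable.map_map_of_aemeasurable measurable_fst.aemeasurable (hμ.prodMk hν)]
    exact map_quantile μ
  · rw [AEMeasurable.map_map_of_aemeasurable measurable_snd.aemeasurable (hμ.prodMk hν)]
    exact map_quantile ν
  · have hI : ∀ κ : Measure ℝ, AEMeasurable (fun z : ℝ × ℝ => ind (quantile κ z.1) z.2)
        (unif.prod volume) := fun κ =>
      measurable_ind.comp_aemeasurable (((aemeasurable_quantile κ).comp_quasiMeasurePreserving
        Measure.quasiMeasurePreserving_fst).prodMk measurable_snd.aemeasurable)
    calc _ = ∫⁻ u, edist (quantile μ u) (quantile ν u) ∂unif :=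
          lintegral_map' (f := fun z : ℝ × ℝ => edist z.1 z.2)
            (measurable_fst.edist measurable_snd).aemeasurable (hμ.prodMk hν)
      _ = ∫⁻ u, ∫⁻ x, edist (ind (quantile μ u) x) (ind (quantile ν u) x) ∂volume ∂unif := by
          simp only [lintegral_edist_ind]
      _ = ∫⁻ x, ∫⁻ u, edist (ind (quantile μ u) x) (ind (quantile ν u) x) ∂unif ∂volume :=
          lintegral_lintegral_swap ((hI μ).edist (hI ν))
      _ = ∫⁻ x, ∫⁻ u, edist (ind u (cdf μ x)) (ind u (cdf ν x)) ∂unif ∂volume := by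
          refine lintegral_congr fun x => setLIntegral_congr_fun measurableSet_Ioo fun u hu => ?_
          simp only [ind, quantile_le_iff μ hu, quantile_le_iff ν hu]
      _ ≤ ∫⁻ x, ∫⁻ u, edist (ind u (cdf μ x)) (ind u (cdf ν x)) :=
          lintegral_mono fun x => setLIntegral_le_lintegral _ _
      _ = w1 μ ν := by simp only [lintegral_edist_ind', w1]

/-! ### Empirical distributions -/

section empirical

variable {n : ℕ}

instance [NeZero n] (a : Fin n → ℝ) : IsProbabilityMeasure (empirical a) := ⟨by
  simp [empirical, ENNReal.inv_mul_cancel (Nat.cast_ne_zero.2 (NeZero.ne n))]⟩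

lemma lintegral_empirical (a : Fin n → ℝ) (f : ℝ → ℝ≥0∞) :
    ∫⁻ x, f x ∂empirical a = (n : ℝ≥0∞)⁻¹ * ∑ i, f (a i) := by
  simp [empirical, lintegral_smul_measure]

lemma empirical_map {T : ℝ → ℝ} (hT : Measurable T) (a : Fin n → ℝ) :
    (empirical a).map T = empirical fun i => T (a i) := by
  ext s hs
  rw [Measure.map_apply hT hs]
  simp [empirical, Measure.finsetSum_apply, hs, hT hs]
  rfl

lemma cdf_empirical [NeZero n] (a : Fin n → ℝ) (x : ℝ) :
    cdf (empirical a) x = (n : ℝ)⁻¹ * ∑ i, ind (a i) x := by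
  rw [cdf_eq_real, measureReal_def]
  simp only [empirical, Measure.smul_apply, Measure.finsetSum_apply, smul_eq_mul,
    ENNReal.toReal_mul, ENNReal.toReal_inv, ENNReal.toReal_natCast]
  rw [ENNReal.toReal_sum fun i _ => measure_ne_top _ _]
  congr 1
  refine Finset.sum_congr rfl fun i _ => ?_
  rw [Measure.dirac_apply' _ measurableSet_Iic]
  by_cases h : a i ≤ x <;> simp [ind, h]

lemma edist_mean_le (u v : Fin n → ℝ) :
    edist ((n : ℝ)⁻¹ * ∑ i, u i) ((n : ℝ)⁻¹ * ∑ i, v i) ≤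
      (n : ℝ≥0∞)⁻¹ * ∑ i, edist (u i) (v i) := by
  rcases Nat.eq_zero_or_pos n with rfl | hn
  · simp
  have h : |(n : ℝ)⁻¹ * ∑ i, u i - (n : ℝ)⁻¹ * ∑ i, v i| ≤ (n : ℝ)⁻¹ * ∑ i, |u i - v i| := by
    rw [← mul_sub, ← Finset.sum_sub_distrib, abs_mul, abs_of_nonneg (a := (n : ℝ)⁻¹) (by positivity)]
    exact mul_le_mul_of_nonneg_left (Finset.abs_sum_le_sum_abs _ _) (by positivity)
  simp only [edist_dist, Real.dist_eq]
  refine (ENNReal.ofReal_le_ofReal h).trans_eq ?_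
  rw [ENNReal.ofReal_mul (by positivity), ENNReal.ofReal_inv_of_pos (by positivity),
    ENNReal.ofReal_natCast, ENNReal.ofReal_sum_of_nonneg fun i _ => abs_nonneg _]

lemma w1_empirical_le [NeZero n] (a b : Fin n → ℝ) :
    w1 (empirical a) (empirical b) ≤ (n : ℝ≥0∞)⁻¹ * ∑ i, edist (a i) (b i) := by
  have m (c : ℝ) : Measurable (ind c) := measurable_ind.comp (measurable_const.prodMk measurable_id)
  calc w1 (empirical a) (empirical b)
      ≤ ∫⁻ x, (n : ℝ≥0∞)⁻¹ * ∑ i, edist (ind (a i) x) (ind (b i) x) := by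
        refine lintegral_mono fun x => ?_
        simp only [cdf_empirical]
        exact edist_mean_le _ _
    _ = _ := by
        rw [lintegral_const_mul _ (Finset.measurable_sum _ fun i _ => (m _).edist (m _)),
          lintegral_finsetSum _ fun i _ => (m _).edist (m _)]
        simp only [lintegral_edist_ind]

end empirical

/-! ### Law of large numbers for functionals of i.i.d. sequences -/

section lln

variable {F : Measure ℝ} [IsProbabilityMeasure F]

lemma shift_zero (a : ℤ → ℝ) : shift 0 a = a := funext fun t => by simp [shift]

lemma integral_shift (h : ℤ) {f : (ℤ → ℝ) → ℝ} (hf : Measurable f) :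
    ∫ a, f (shift h a) ∂iid ℤ F = ∫ a, f a ∂iid ℤ F := by
  rw [← (measurePreserving_shift (F := F) h).map_eq, integral_map (measurable_shift h).aemeasurable
    hf.aestronglyMeasurable, (measurePreserving_shift (F := F) h).map_eq]

lemma lintegral_mean_shift_le (n : ℕ) {f : (ℤ → ℝ) → ℝ≥0∞} (hf : Measurable f) :
    ∫⁻ a, (n : ℝ≥0∞)⁻¹ * ∑ i : Fin n, f (shift ((i : ℤ) + 1) a) ∂iid ℤ F ≤ ∫⁻ a, f a ∂iid ℤ F := by
  have hm (t : ℤ) : Measurable fun a => f (shift t a) := hf.comp (measurable_shift t)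
  rw [lintegral_const_mul _ (Finset.measurable_sum _ fun i _ => hm _),
    lintegral_finsetSum _ fun i _ => hm _,
    Finset.sum_congr rfl fun (i : Fin n) _ =>
      (measurePreserving_shift ((i : ℤ) + 1)).lintegral_comp (μ := iid ℤ F) hf,
    Finset.sum_const, Finset.card_univ, Fintype.card_fin, nsmul_eq_mul, ← mul_assoc]
  exact mul_le_of_le_one_left zero_le (ENNReal.inv_mul_le_one _)

lemma integrable_of_abs_le {Ω : Type*} [MeasurableSpace Ω] {P : Measure Ω} [IsFiniteMeasure P]
    {f : Ω → ℝ} (hf : Measurable f) {C : ℝ} (hC : ∀ a, |f a| ≤ C) : Integrable f P :=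
  Integrable.of_bound hf.aestronglyMeasurable C (Eventually.of_forall hC)

lemma card_near_le (n m : ℕ) (i : Fin n) :
    ((Finset.univ.filter fun j : Fin n => |(i : ℤ) - (j : ℤ)| ≤ m).card : ℝ) ≤ 2 * m + 1 := by
  have h : (Finset.univ.filter fun j : Fin n => |(i : ℤ) - (j : ℤ)| ≤ m).card ≤
      (Finset.Icc ((i : ℤ) - m) (i + m)).card := by
    refine Finset.card_le_card_of_injOn (fun j => ((j : ℕ) : ℤ)) (fun j hj => ?_) fun j _ k _ hjk => ?_
    · have := abs_le.1 (Finset.mem_filter.1 (Finset.mem_coe.1 hj)).2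
      simp only [Finset.coe_Icc, Set.mem_Icc]
      omega
    · exact Fin.ext (by simpa using hjk)
  rw [Int.card_Icc] at h
  have h2 : ((i : ℤ) + m + 1 - ((i : ℤ) - m)).toNat = 2 * m + 1 := by omega
  rw [h2] at h
  exact_mod_cast h

lemma integral_sq_mean_le {ψ : (ℤ → ℝ) → ℝ} (hψ : Measurable ψ) (h1 : ∀ a, |ψ a| ≤ 2) {m : ℕ}
    (hdep : DependsOn ψ (Set.Icc (-m : ℤ) m)) (h0 : ∫ a, ψ a ∂iid ℤ F = 0) {n : ℕ} (hn : 0 < n) :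
    ∫ a, ((n : ℝ)⁻¹ * ∑ i : Fin n, ψ (shift ((i : ℤ) + 1) a)) ^ 2 ∂iid ℤ F ≤
      4 * (4 * m + 1) / n := by
  have hm (t : ℤ) : Measurable fun a => ψ (shift t a) := hψ.comp (measurable_shift t)
  have hprod (s t : ℤ) : Integrable (fun a => ψ (shift s a) * ψ (shift t a)) (iid ℤ F) :=
    integrable_of_abs_le ((hm s).mul (hm t)) (C := 2 * 2) fun a => by
      rw [abs_mul]; exact mul_le_mul (h1 _) (h1 _) (abs_nonneg _) (by norm_num)
  have hcov (i j : Fin n) : ∫ a, ψ (shift ((i : ℤ) + 1) a) * ψ (shift ((j : ℤ) + 1) a) ∂iid ℤ F ≤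
      if |(i : ℤ) - (j : ℤ)| ≤ (2 * m : ℕ) then 4 else 0 := by
    split_ifs with hij
    · calc _ ≤ ∫ a, (4 : ℝ) ∂iid ℤ F := by
            refine integral_mono (hprod _ _) (integrable_const _) fun a => ?_
            refine (le_abs_self _).trans ?_
            rw [abs_mul]
            exact (mul_le_mul (h1 _) (h1 _) (abs_nonneg _) (by norm_num)).trans (by norm_num)
        _ = 4 := by simp
    · have hd (s : ℤ) : DependsOn (fun a => ψ (shift s a)) (Set.Icc (s - m) (s + m)) :=
        fun a b hab => hdep fun t ht => hab (t + s) (by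
          have := Set.mem_Icc.1 ht; rw [Set.mem_Icc]; omega)
      have hind := indepFun_of_dependsOn (F := F) (hm (i + 1)) (hm (j + 1)) (hd _) (hd _) (by
        refine Set.disjoint_left.2 fun t ht ht' => hij ?_
        rw [Set.mem_Icc] at ht ht'
        rw [abs_le]; push_cast; omega)
      rw [hind.integral_fun_mul_eq_mul_integral (hm _).aestronglyMeasurable
        (hm _).aestronglyMeasurable, integral_shift _ hψ, h0, zero_mul]
  have hn' : (0 : ℝ) < n := by exact_mod_cast hn
  calc _ = ∫ a, ((n : ℝ)⁻¹) ^ 2 * ∑ i : Fin n, ∑ j : Fin n,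
        ψ (shift ((i : ℤ) + 1) a) * ψ (shift ((j : ℤ) + 1) a) ∂iid ℤ F := by
        refine integral_congr_ae (Eventually.of_forall fun a => ?_)
        simp only [mul_pow, sq (∑ i : Fin n, _), Finset.sum_mul_sum]
    _ = ((n : ℝ)⁻¹) ^ 2 * ∑ i : Fin n, ∑ j : Fin n,
        ∫ a, ψ (shift ((i : ℤ) + 1) a) * ψ (shift ((j : ℤ) + 1) a) ∂iid ℤ F := by
        rw [integral_const_mul, integral_finsetSum _ fun i _ =>
          integrable_finsetSum _ fun j _ => hprod _ _]
        congr 1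
        exact Finset.sum_congr rfl fun i _ => integral_finsetSum _ fun j _ => hprod _ _
    _ ≤ ((n : ℝ)⁻¹) ^ 2 * ∑ i : Fin n, (4 * (4 * m + 1) : ℝ) := by
        refine mul_le_mul_of_nonneg_left (Finset.sum_le_sum fun i _ => ?_) (by positivity)
        refine (Finset.sum_le_sum fun j _ => hcov i j).trans ?_
        rw [← Finset.sum_filter, Finset.sum_const, nsmul_eq_mul, mul_comm]
        have := card_near_le n (2 * m) i
        push_cast at this ⊢
        nlinarith
    _ = _ := by
        rw [Finset.sum_const, Finset.card_univ, Fintype.card_fin, nsmul_eq_mul]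
        field_simp

lemma tendsto_lintegral_mean_of_dependsOn {ψ : (ℤ → ℝ) → ℝ} (hψ : Measurable ψ)
    (h1 : ∀ a, |ψ a| ≤ 1) {m : ℕ} (hdep : DependsOn ψ (Set.Icc (-m : ℤ) m)) :
    Tendsto (fun n : ℕ => ∫⁻ a, edist ((n : ℝ)⁻¹ * ∑ i : Fin n, ψ (shift ((i : ℤ) + 1) a))
      (∫ b, ψ b ∂iid ℤ F) ∂iid ℤ F) atTop (𝓝 0) := by
  set c := ∫ b, ψ b ∂iid ℤ F with hc
  have hc1 : |c| ≤ 1 := by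
    refine abs_integral_le_integral_abs.trans ?_
    refine (integral_mono (integrable_of_abs_le hψ h1).abs (integrable_const 1) h1).trans ?_
    simp
  have hψc : Measurable fun a => ψ a - c := hψ.sub_const c
  have hb : ∀ a, |ψ a - c| ≤ 2 := fun a => (abs_sub _ _).trans (by linarith [h1 a])
  have hint0 : ∫ a, (ψ a - c) ∂iid ℤ F = 0 := by
    rw [integral_sub (integrable_of_abs_le hψ h1) (integrable_const c)]; simp [hc]
  rw [ENNReal.tendsto_atTop_zero]
  intro ε hε
  obtain ⟨s, hs0, hsε⟩ := ENNReal.lt_iff_exists_nnreal_btwn.1 hε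
  have hs : (0 : ℝ) < s := by exact_mod_cast hs0
  obtain ⟨N, hN⟩ := exists_nat_gt ((s / 2 : ℝ)⁻¹ * (4 * (4 * m + 1)) / (s / 2))
  refine ⟨N + 1, fun n hn => le_trans ?_ hsε.le⟩
  have hn0 : 0 < n := by omega
  have hn' : (0 : ℝ) < n := by exact_mod_cast hn0
  have : NeZero n := ⟨hn0.ne'⟩
  set W : (ℤ → ℝ) → ℝ := fun a => (n : ℝ)⁻¹ * ∑ i : Fin n, (ψ (shift ((i : ℤ) + 1) a) - c) with hW
  have mW : Measurable W := Measurable.const_mul (Finset.measurable_sum _ fun i _ =>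
    hψc.comp (measurable_shift _)) _
  have hWb : ∀ a, |W a| ≤ 2 := by
    intro a
    rw [hW, abs_mul, abs_of_nonneg (by positivity)]
    calc (n : ℝ)⁻¹ * |∑ i : Fin n, (ψ (shift ((i : ℤ) + 1) a) - c)| ≤ (n : ℝ)⁻¹ * ∑ i : Fin n, 2 :=
          mul_le_mul_of_nonneg_left ((Finset.abs_sum_le_sum_abs _ _).trans
            (Finset.sum_le_sum fun i _ => hb _)) (by positivity)
      _ = 2 := by
          rw [Finset.sum_const, Finset.card_univ, Fintype.card_fin, nsmul_eq_mul]; field_simp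
  have hsq := integral_sq_mean_le (F := F) hψc hb (m := m)
    (fun a b hab => by simp only [hdep hab]) hint0 hn0
  have mW2 : Integrable (fun a => W a ^ 2) (iid ℤ F) :=
    integrable_of_abs_le (mW.pow_const 2) (C := 2 ^ 2) fun a => by
      rw [abs_pow]; exact pow_le_pow_left₀ (abs_nonneg _) (hWb a) 2
  calc _ = ∫⁻ a, ENNReal.ofReal |W a| ∂iid ℤ F := by
        refine lintegral_congr fun a => ?_
        rw [edist_dist, Real.dist_eq]
        congr 2
        simp only [hW, Finset.sum_sub_distrib, Finset.sum_const, Finset.card_univ, Fintype.card_fin,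
          nsmul_eq_mul, mul_sub]
        field_simp
    _ ≤ ∫⁻ a, ENNReal.ofReal (s / 2 + (s / 2 : ℝ)⁻¹ * W a ^ 2) ∂iid ℤ F := by
        refine lintegral_mono fun a => ENNReal.ofReal_le_ofReal ?_
        rw [← sq_abs (W a)]
        have hs2 : (0 : ℝ) < s / 2 := by positivity
        have : (s / 2 : ℝ)⁻¹ * (s / 2) = 1 := inv_mul_cancel₀ hs2.ne'
        have h3 := mul_nonneg (inv_nonneg.2 hs2.le) (sq_nonneg (|W a| - s / 2))
        nlinarith [abs_nonneg (W a)]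
    _ = ENNReal.ofReal (∫ a, (s / 2 + (s / 2 : ℝ)⁻¹ * W a ^ 2) ∂iid ℤ F) :=
        (ofReal_integral_eq_lintegral_ofReal ((integrable_const _).add (mW2.const_mul _))
          (Eventually.of_forall fun a => add_nonneg (by positivity)
            (mul_nonneg (by positivity) (sq_nonneg _)))).symm
    _ ≤ ENNReal.ofReal (s / 2 + s / 2) := by
        refine ENNReal.ofReal_le_ofReal ?_
        rw [integral_add (integrable_const _) (mW2.const_mul _), integral_const_mul]
        simp only [integral_const, probReal_univ, one_smul]
        refine add_le_add_right ?_ _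
        refine (mul_le_mul_of_nonneg_left hsq (by positivity)).trans ?_
        rw [← mul_div_assoc, div_le_iff₀ hn', ← div_le_iff₀' (by positivity)]
        refine hN.le.trans ?_
        exact_mod_cast (by omega : N ≤ n)
    _ = s := by rw [add_halves, ENNReal.ofReal_coe_nnreal]

/-- The σ-algebras generated by the coordinates in `[-m, m]`. -/
def windowFiltration : Filtration ℕ (inferInstance : MeasurableSpace (ℤ → ℝ)) where
  seq m := MeasurableSpace.comap (fun (a : ℤ → ℝ) (i : Set.Icc (-m : ℤ) m) => a i) inferInstance
  mono' m n hmn := by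
    have h : (fun (a : ℤ → ℝ) (i : Set.Icc (-m : ℤ) m) => a i) =
        (fun (b : Set.Icc (-n : ℤ) n → ℝ) (i : Set.Icc (-m : ℤ) m) =>
          b ⟨i, by have := Set.mem_Icc.1 i.2; rw [Set.mem_Icc]; omega⟩) ∘
        fun (a : ℤ → ℝ) (i : Set.Icc (-n : ℤ) n) => a i := rfl
    change MeasurableSpace.comap _ _ ≤ _
    rw [h, ← MeasurableSpace.comap_comp]
    exact MeasurableSpace.comap_mono (measurable_iff_comap_le.1 (by fun_prop))
  le' m := measurable_iff_comap_le.1 (by fun_prop)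

lemma iSup_windowFiltration :
    (⨆ m, windowFiltration m) = (inferInstance : MeasurableSpace (ℤ → ℝ)) := by
  refine le_antisymm (iSup_le fun m => windowFiltration.le m) ?_
  refine iSup_le fun t => ?_
  refine le_trans ?_ (le_iSup _ t.natAbs)
  change _ ≤ MeasurableSpace.comap _ _
  have h : (fun a : ℤ → ℝ => a t) =
      (fun b : Set.Icc (-t.natAbs : ℤ) t.natAbs → ℝ => b ⟨t, by rw [Set.mem_Icc]; omega⟩) ∘
        fun (a : ℤ → ℝ) (i : Set.Icc (-t.natAbs : ℤ) t.natAbs) => a i := rfl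
  rw [h, ← MeasurableSpace.comap_comp]
  exact MeasurableSpace.comap_mono (measurable_iff_comap_le.1 (by fun_prop))

lemma dependsOn_of_measurable_window {m : ℕ} {ψ : (ℤ → ℝ) → ℝ}
    (h : Measurable[windowFiltration m] ψ) : DependsOn ψ (Set.Icc (-m : ℤ) m) := by
  intro a b hab
  obtain ⟨s, -, hs⟩ := h (measurableSet_singleton (ψ a))
  have ha : a ∈ ψ ⁻¹' {ψ a} := rfl
  rw [← hs, Set.mem_preimage] at ha
  have : (fun i : Set.Icc (-m : ℤ) m => a i) = fun i : Set.Icc (-m : ℤ) m => b i :=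
    funext fun i => hab i i.2
  rw [this] at ha
  have hb : b ∈ ψ ⁻¹' {ψ a} := by rw [← hs]; exact ha
  exact hb.symm

lemma exists_dependsOn_approx {φ : (ℤ → ℝ) → ℝ} (hφ : Measurable φ) (h1 : ∀ a, |φ a| ≤ 1)
    {ε : ℝ≥0∞} (hε : 0 < ε) : ∃ (m : ℕ) (ψ : (ℤ → ℝ) → ℝ), Measurable ψ ∧ (∀ a, |ψ a| ≤ 1) ∧
      DependsOn ψ (Set.Icc (-m : ℤ) m) ∧ ∫⁻ a, edist (φ a) (ψ a) ∂iid ℤ F ≤ ε := by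
  have hlim := Integrable.tendsto_eLpNorm_condExp (ℱ := windowFiltration) (μ := iid ℤ F)
    (integrable_of_abs_le hφ h1) (by rw [iSup_windowFiltration]; exact hφ.stronglyMeasurable)
  obtain ⟨m, hm⟩ := (hlim.eventually (ge_mem_nhds hε)).exists
  set ψ₀ := (iid ℤ F)[φ | windowFiltration m] with hψ₀
  have mψ₀ : Measurable[windowFiltration m] ψ₀ := stronglyMeasurable_condExp.measurable
  have mψ : Measurable[windowFiltration m] fun a => max (min (ψ₀ a) 1) (-1) :=
    ((measurable_id.min measurable_const).max measurable_const).comp mψ₀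
  refine ⟨m, fun a => max (min (ψ₀ a) 1) (-1), mψ.mono (windowFiltration.le m) le_rfl,
    fun a => ?_, dependsOn_of_measurable_window mψ, ?_⟩
  · rw [abs_le]
    exact ⟨le_max_right _ _, max_le (min_le_right _ _) (by norm_num)⟩
  · refine le_trans (lintegral_mono fun a => ?_) (eLpNorm_one_eq_lintegral_enorm.symm.trans_le hm)
    rw [Pi.sub_apply, ← edist_eq_enorm_sub, edist_comm (ψ₀ a), edist_dist, edist_dist]
    refine ENNReal.ofReal_le_ofReal ?_
    have := abs_le.1 (h1 a)
    have e : φ a = max (min (φ a) 1) (-1) := by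
      rw [min_eq_left this.2, max_eq_left this.1]
    rw [Real.dist_eq, Real.dist_eq]
    nth_rewrite 1 [e]
    exact (abs_max_sub_max_le_abs _ _ _).trans (abs_inf_sub_inf_le_abs _ _ _)

/-- The mean ergodic theorem for bounded functionals of an i.i.d. sequence. -/
theorem tendsto_lintegral_mean {φ : (ℤ → ℝ) → ℝ} (hφ : Measurable φ) (h1 : ∀ a, |φ a| ≤ 1) :
    Tendsto (fun n : ℕ => ∫⁻ a, edist ((n : ℝ)⁻¹ * ∑ i : Fin n, φ (shift ((i : ℤ) + 1) a))
      (∫ b, φ b ∂iid ℤ F) ∂iid ℤ F) atTop (𝓝 0) := by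
  rw [ENNReal.tendsto_atTop_zero]
  intro ε hε
  have hε3 : 0 < ε / 3 := ENNReal.div_pos hε.ne' (by simp)
  obtain ⟨m, ψ, hψ, hψ1, hdep, happ⟩ := exists_dependsOn_approx (F := F) hφ h1 hε3
  obtain ⟨N, hN⟩ := (ENNReal.tendsto_atTop_zero.1
    (tendsto_lintegral_mean_of_dependsOn (F := F) hψ hψ1 hdep)) (ε / 3) hε3
  refine ⟨N + 1, fun n hn => ?_⟩
  have mshift {f : (ℤ → ℝ) → ℝ} (hf : Measurable f) :
      Measurable fun a => (n : ℝ)⁻¹ * ∑ i : Fin n, f (shift ((i : ℤ) + 1) a) :=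
    Measurable.const_mul (Finset.measurable_sum _ fun i _ => hf.comp (measurable_shift _)) _
  have m1 : Measurable fun a => edist (φ a) (ψ a) := hφ.edist hψ
  have e1 : ∫⁻ a, edist ((n : ℝ)⁻¹ * ∑ i : Fin n, φ (shift ((i : ℤ) + 1) a))
      ((n : ℝ)⁻¹ * ∑ i : Fin n, ψ (shift ((i : ℤ) + 1) a)) ∂iid ℤ F ≤ ε / 3 := by
    calc _ ≤ ∫⁻ a, (n : ℝ≥0∞)⁻¹ * ∑ i : Fin n,
          edist (φ (shift ((i : ℤ) + 1) a)) (ψ (shift ((i : ℤ) + 1) a)) ∂iid ℤ F :=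
          lintegral_mono fun a => edist_mean_le _ _
      _ ≤ ε / 3 := (lintegral_mean_shift_le n m1).trans happ
  have e3 : edist (∫ b, ψ b ∂iid ℤ F) (∫ b, φ b ∂iid ℤ F) ≤ ε / 3 := by
    rw [edist_eq_enorm_sub, ← integral_sub (integrable_of_abs_le hψ hψ1)
      (integrable_of_abs_le hφ h1)]
    refine (enorm_integral_le_lintegral_enorm _).trans (le_trans (lintegral_mono fun a => ?_) happ)
    rw [← edist_eq_enorm_sub, edist_comm]
  calc _ ≤ ∫⁻ a, (edist ((n : ℝ)⁻¹ * ∑ i : Fin n, φ (shift ((i : ℤ) + 1) a))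
      ((n : ℝ)⁻¹ * ∑ i : Fin n, ψ (shift ((i : ℤ) + 1) a)) +
      (edist ((n : ℝ)⁻¹ * ∑ i : Fin n, ψ (shift ((i : ℤ) + 1) a)) (∫ b, ψ b ∂iid ℤ F) +
        edist (∫ b, ψ b ∂iid ℤ F) (∫ b, φ b ∂iid ℤ F))) ∂iid ℤ F :=
        lintegral_mono fun a => (edist_triangle _ _ _).trans
          (add_le_add_right (edist_triangle _ _ _) _)
    _ ≤ ε / 3 + (ε / 3 + ε / 3) := by
        rw [lintegral_add_left ((mshift hφ).edist (mshift hψ)), lintegral_add_right _ measurable_const,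
          lintegral_const, measure_univ, mul_one]
        exact add_le_add e1 (add_le_add (hN n (by omega)) e3)
    _ = ε := by rw [← add_assoc, ENNReal.add_thirds]

/-! ### Convergence of empirical distributions -/

lemma integral_ind {Ω : Type*} [MeasurableSpace Ω] {P : Measure Ω} [IsProbabilityMeasure P]
    {Y : Ω → ℝ} (hY : Measurable Y) (x : ℝ) : ∫ ω, ind (Y ω) x ∂P = cdf (P.map Y) x := by
  have := Measure.isProbabilityMeasure_map (μ := P) hY.aemeasurable
  have h : (fun ω => ind (Y ω) x) = (Y ⁻¹' Set.Iic x).indicator 1 := by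
    ext ω; by_cases h : Y ω ≤ x <;> simp [ind, h]
  rw [h, integral_indicator_one (hY measurableSet_Iic), cdf_eq_real, map_measureReal_apply hY
    measurableSet_Iic]

theorem tendsto_lintegral_w1 {H : (ℤ → ℝ) → ℝ} (hH : Measurable H)
    (hfin : ∫⁻ a, edist (H a) 0 ∂iid ℤ F ≠ ∞) :
    Tendsto (fun n : ℕ => ∫⁻ a, w1 (empirical fun i : Fin n => H (shift ((i : ℤ) + 1) a))
      ((iid ℤ F).map H) ∂iid ℤ F) atTop (𝓝 0) := by
  set ν := (iid ℤ F).map H with hν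
  let D (n : ℕ) (a : ℤ → ℝ) (x : ℝ) : ℝ≥0∞ :=
    edist ((n : ℝ)⁻¹ * ∑ i : Fin n, ind (H (shift ((i : ℤ) + 1) a)) x) (cdf ν x)
  have mI : Measurable (Function.uncurry fun (a : ℤ → ℝ) x => ind (H a) x) :=
    measurable_ind.comp ((hH.comp measurable_fst).prodMk measurable_snd)
  have mIx (x : ℝ) : Measurable fun a => ind (H a) x :=
    mI.comp (measurable_id.prodMk measurable_const)
  have mD (n : ℕ) : Measurable (Function.uncurry (D n)) := by
    refine Measurable.edist (Measurable.const_mul (Finset.measurable_sum _ fun i _ => ?_) _)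
      ((monotone_cdf ν).measurable.comp measurable_snd)
    exact mI.comp (((measurable_shift _).comp measurable_fst).prodMk measurable_snd)
  let B (x : ℝ) : ℝ≥0∞ := ∫⁻ a, edist (ind (H a) x) (ind 0 x) ∂iid ℤ F
  have mB0 : Measurable (Function.uncurry fun (a : ℤ → ℝ) x => edist (ind (H a) x) (ind 0 x)) :=
    mI.edist (measurable_ind.comp (measurable_const.prodMk measurable_snd))
  have hB : ∫⁻ x, B x ≠ ∞ := by
    rw [← lintegral_lintegral_swap mB0.aemeasurable]
    simpa only [lintegral_edist_ind] using hfin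
  have hDB (n : ℕ) (x : ℝ) : ∫⁻ a, D (n + 1) a x ∂iid ℤ F ≤ B x + B x := by
    have mx : Measurable fun a => edist (ind (H a) x) (ind 0 x) :=
      (mIx x).edist measurable_const
    have hconst : ((n + 1 : ℕ) : ℝ)⁻¹ * ∑ i : Fin (n + 1), ind 0 x = ind 0 x := by
      rw [Finset.sum_const, Finset.card_univ, Fintype.card_fin, nsmul_eq_mul]
      field_simp
    calc _ ≤ ∫⁻ a, (((n + 1 : ℕ) : ℝ≥0∞)⁻¹ * ∑ i : Fin (n + 1),
          edist (ind (H (shift ((i : ℤ) + 1) a)) x) (ind 0 x) + edist (ind 0 x) (cdf ν x)) ∂iid ℤ F := by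
          refine lintegral_mono fun a => (edist_triangle _ (ind 0 x) _).trans (add_le_add_left ?_ _)
          conv_lhs => rw [← hconst]
          exact edist_mean_le _ _
      _ ≤ _ := by
          rw [lintegral_add_right _ measurable_const, lintegral_const, measure_univ, mul_one]
          refine add_le_add ?_ ?_
          · exact lintegral_mean_shift_le (n + 1) mx
          · rw [edist_comm, edist_eq_enorm_sub, ← integral_ind hH]
            have hi : Integrable (fun a => ind (H a) x) (iid ℤ F) :=
              integrable_of_abs_le (mIx x) (C := 1) fun a => by
                by_cases h : H a ≤ x <;> simp [ind, h]
            have : ∫ a, ind (H a) x ∂iid ℤ F - ind 0 x = ∫ a, (ind (H a) x - ind 0 x) ∂iid ℤ F := by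
              rw [integral_sub hi (integrable_const _)]; simp
            rw [this]
            refine (enorm_integral_le_lintegral_enorm _).trans (lintegral_mono fun a => ?_)
            rw [edist_eq_enorm_sub]
  have key : Tendsto (fun n : ℕ => ∫⁻ x, ∫⁻ a, D (n + 1) a x ∂iid ℤ F) atTop
      (𝓝 (∫⁻ _ : ℝ, 0)) := by
    refine tendsto_lintegral_of_dominated_convergence (fun x => B x + B x)
      (fun n => ?_) (fun n => Eventually.of_forall (hDB n)) ?_ (Eventually.of_forall fun x => ?_)
    · exact Measurable.lintegral_prod_left' (mD (n + 1))
    · have mB : Measurable B := Measurable.lintegral_prod_left' mB0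
      rw [lintegral_add_left mB]
      exact ENNReal.add_ne_top.2 ⟨hB, hB⟩
    · refine (tendsto_add_atTop_iff_nat (f := fun n => ∫⁻ a, D n a x ∂iid ℤ F) 1).2 ?_
      have hc : cdf ν x = ∫ a, ind (H a) x ∂iid ℤ F := (integral_ind hH x).symm
      have hI (a : ℤ → ℝ) : |ind (H a) x| ≤ 1 := by
        by_cases h : H a ≤ x <;> simp [ind, h]
      have hl := tendsto_lintegral_mean (F := F) (φ := fun a => ind (H a) x) (mIx x) hI
      rw [← hc] at hl
      exact hl
  rw [lintegral_zero] at key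
  refine (tendsto_add_atTop_iff_nat 1).1 (key.congr fun n => ?_)
  rw [← lintegral_lintegral_swap (mD (n + 1)).aemeasurable]
  simp only [D, w1, cdf_empirical]

lemma measurable_w1_empirical {H : (ℤ → ℝ) → ℝ} (hH : Measurable H) (n : ℕ) [NeZero n]
    (ν : Measure ℝ) :
    Measurable fun a => w1 (empirical fun i : Fin n => H (shift ((i : ℤ) + 1) a)) ν := by
  simp only [w1, cdf_empirical]
  refine Measurable.lintegral_prod_right' (f := fun z : (ℤ → ℝ) × ℝ =>
    edist ((n : ℝ)⁻¹ * ∑ i : Fin n, ind (H (shift ((i : ℤ) + 1) z.1)) z.2) (cdf ν z.2)) ?_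
  refine Measurable.edist (Measurable.const_mul (Finset.measurable_sum _ fun i _ => ?_) _)
    ((monotone_cdf ν).measurable.comp measurable_snd)
  exact measurable_ind.comp ((hH.comp ((measurable_shift _).comp measurable_fst)).prodMk
    measurable_snd)

/-- Weak convergence of the empirical distribution of a stationary functional of an i.i.d. sequence,
in probability. -/
theorem tendsto_measure_w1 {Ω : Type*} [MeasurableSpace Ω] {P : Measure Ω} {e : Ω → ℤ → ℝ}
    (he : MeasurePreserving e P (iid ℤ F)) {Y : ℤ → Ω → ℝ} {H : (ℤ → ℝ) → ℝ} (hH : Measurable H)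
    (hY : ∀ᵐ ω ∂P, ∀ t, Y t ω = H (shift t (e ω))) (hfin : ∫⁻ ω, edist (Y 0 ω) 0 ∂P ≠ ∞)
    {γ : ℝ≥0∞} (hγ : γ ≠ 0) :
    Tendsto (fun n : ℕ => P {ω | γ ≤ w1 (empirical fun i : Fin n => Y ((i : ℤ) + 1) ω)
      (P.map (Y 0))}) atTop (𝓝 0) := by
  have h0 : Y 0 =ᵐ[P] fun ω => H (e ω) := by
    filter_upwards [hY] with ω hω
    rw [hω 0, shift_zero]
  have hmap : P.map (Y 0) = (iid ℤ F).map H := by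
    rw [Measure.map_congr h0, ← he.map_eq, Measure.map_map hH he.measurable]
    rfl
  have hfin' : ∫⁻ a, edist (H a) 0 ∂iid ℤ F ≠ ∞ := by
    rw [← he.lintegral_comp (hH.edist measurable_const)]
    rwa [lintegral_congr_ae (h0.mono fun ω hω => by rw [hω])] at hfin
  have hγ' : min γ 1 ≠ 0 := (lt_min (pos_iff_ne_zero.2 hγ) one_pos).ne'
  have hlim := ENNReal.Tendsto.div_const (tendsto_lintegral_w1 (F := F) hH hfin') (Or.inr hγ')
  rw [ENNReal.zero_div] at hlim
  refine tendsto_of_tendsto_of_tendsto_of_le_of_le' tendsto_const_nhds hlim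
    (Eventually.of_forall fun _ => zero_le) ?_
  filter_upwards [eventually_gt_atTop 0] with n hn
  have : NeZero n := ⟨hn.ne'⟩
  have mw := measurable_w1_empirical hH n ((iid ℤ F).map H)
  refine le_trans ?_ (meas_ge_le_lintegral_div mw.aemeasurable hγ'
    (ne_top_of_le_ne_top (by simp) (min_le_right _ _)))
  rw [← he.measure_preimage (measurableSet_le measurable_const mw).nullMeasurableSet, hmap]
  refine measure_mono_ae ?_
  filter_upwards [hY] with ω hω hmem
  change γ ≤ _ at hmem
  simp only [hω] at hmem
  exact (min_le_left _ _).trans hmem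

end lln

/-! ### The gauges of the two model classes -/

/-- The autoregression contracts in `x`, the ARCH recursion in the signed square `x |x|`. -/
def ModelClass.gauge : ModelClass → ℝ → ℝ
  | .ar => fun x => x
  | .arch => fun x => x * |x|

lemma sq_sub_le_signed_sq (x y : ℝ) : (x - y) ^ 2 ≤ 2 * |x * abs x - y * abs y| := by
  rcases le_total 0 x with hx | hx <;> rcases le_total 0 y with hy | hy
  · rw [abs_of_nonneg hx, abs_of_nonneg hy]
    rcases le_total x y with h | h
    · nlinarith [neg_le_abs (x * x - y * y), mul_nonneg hx (sub_nonneg.2 h)]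
    · nlinarith [le_abs_self (x * x - y * y), mul_nonneg hy (sub_nonneg.2 h)]
  · rw [abs_of_nonneg hx, abs_of_nonpos hy]
    nlinarith [le_abs_self (x * x - y * -y), sq_nonneg (x + y)]
  · rw [abs_of_nonpos hx, abs_of_nonneg hy]
    nlinarith [neg_le_abs (x * -x - y * y), sq_nonneg (x + y)]
  · rw [abs_of_nonpos hx, abs_of_nonpos hy]
    rcases le_total x y with h | h
    · nlinarith [neg_le_abs (x * -x - y * -y), mul_nonneg (neg_nonneg.2 hy) (sub_nonneg.2 h)]
    · nlinarith [le_abs_self (x * -x - y * -y), mul_nonneg (neg_nonneg.2 hx) (sub_nonneg.2 h)]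

lemma ModelClass.gauge_zero (M : ModelClass) : M.gauge 0 = 0 := by cases M <;> simp [gauge]

lemma abs_gauge_arch (x : ℝ) : |ModelClass.arch.gauge x| = x ^ 2 := by
  simp [ModelClass.gauge, abs_mul, sq]

lemma gauge_isGauge (M : ModelClass) : Gauge M.gauge := by
  cases M
  · exact ⟨continuous_id, fun ε hε => ⟨ε, hε, fun x y h => h⟩⟩
  · refine ⟨continuous_id.mul continuous_abs, fun ε hε => ⟨ε ^ 2 / 2, by positivity, fun x y h => ?_⟩⟩
    have h1 := sq_sub_le_signed_sq x y
    simp only [ModelClass.gauge] at h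
    exact abs_lt_of_sq_lt_sq (by linarith) hε.le

/-! ### The autoregression -/

section ar

variable {p : ℕ}

/-- The companion matrix of the autoregression. -/
def companion (θ : Fin p → ℝ) : (Fin p → ℂ) →ₗ[ℂ] (Fin p → ℂ) where
  toFun v i := (Fin.cons (∑ j, (θ j : ℂ) * v j) v : Fin (p + 1) → ℂ) i.castSucc
  map_add' u v := by
    ext i
    rcases Fin.eq_zero_or_eq_succ i.castSucc with h | ⟨j, h⟩ <;>
      simp [h, mul_add, Finset.sum_add_distrib]
  map_smul' c v := by
    ext i
    rcases Fin.eq_zero_or_eq_succ i.castSucc with h | ⟨j, h⟩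
    · simp only [h, Fin.cons_zero, Pi.smul_apply, smul_eq_mul, RingHom.id_apply, Finset.mul_sum]
      exact Finset.sum_congr rfl fun j _ => by ring
    · simp [h]

lemma norm_eigenvalue_companion_lt {θ : Fin p → ℝ} (hθ : θ ∈ ModelClass.ar.Θ p) {l : ℂ}
    (hl : Module.End.HasEigenvalue (companion θ) l) : ‖l‖ < 1 := by
  by_contra! h
  obtain ⟨v, hv⟩ := hl.exists_hasEigenvector
  have hl0 : l ≠ 0 := fun h0 => by simp [h0] at h; linarith
  have heq : ∀ i, (Fin.cons (∑ j, (θ j : ℂ) * v j) v : Fin (p + 1) → ℂ) i.castSucc = l * v i :=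
    fun i => congrFun hv.apply_eq_smul i
  rcases Nat.eq_zero_or_pos p with hp | hp
  · subst hp
    exact hv.2 (Subsingleton.elim _ _)
  · have hvi : ∀ (k : ℕ) (hk : k < p), v ⟨k, hk⟩ = l⁻¹ ^ k * v ⟨0, hp⟩ := by
      intro k
      induction k with
      | zero => intro _; simp
      | succ k ih =>
        intro hk
        have h1 := heq ⟨k + 1, hk⟩
        have h2 : (⟨k + 1, hk⟩ : Fin p).castSucc = Fin.succ ⟨k, by omega⟩ := by ext; simp
        rw [h2, Fin.cons_succ, ih] at h1
        rw [pow_succ, mul_comm (l⁻¹ ^ k), mul_assoc, h1, ← mul_assoc, inv_mul_cancel₀ hl0, one_mul]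
    have h0 : v ⟨0, hp⟩ ≠ 0 := fun h0 => hv.2 (funext fun i => by
      rw [show i = ⟨i, i.2⟩ from rfl, hvi, h0]; simp)
    have h1 := heq ⟨0, hp⟩
    have h2 : (⟨0, hp⟩ : Fin p).castSucc = 0 := by ext; simp
    rw [h2, Fin.cons_zero] at h1
    refine hθ l⁻¹ (by rw [norm_inv]; exact inv_le_one_of_one_le₀ h) ?_
    have h3 : (∑ i : Fin p, (θ i : ℂ) * l⁻¹ ^ ((i : ℕ) + 1)) * (l * v ⟨0, hp⟩) = l * v ⟨0, hp⟩ := by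
      conv_rhs => rw [← h1]
      rw [Finset.sum_mul]
      refine Finset.sum_congr rfl fun i _ => ?_
      have hll : l⁻¹ * l = 1 := inv_mul_cancel₀ hl0
      rw [hvi i i.2, pow_succ]
      linear_combination (θ i * l⁻¹ ^ (i : ℕ) * v ⟨0, hp⟩ : ℂ) * hll
    rw [sub_eq_zero]
    exact (mul_right_cancel₀ (mul_ne_zero hl0 h0) (h3.trans (one_mul _).symm)).symm

lemma tsum_pow_ne_top_of_spectralRadius_lt {A : Type*} [NormedRing A] [NormedAlgebra ℂ A]
    [CompleteSpace A] {a : A} (ha : spectralRadius ℂ a < 1) : ∑' n : ℕ, ‖a ^ n‖ₑ ≠ ∞ := by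
  obtain ⟨r, hr, hr1⟩ := ENNReal.lt_iff_exists_nnreal_btwn.1 ha
  obtain ⟨N, hN⟩ := eventually_atTop.1
    ((spectrum.pow_nnnorm_pow_one_div_tendsto_nhds_spectralRadius a).eventually (gt_mem_nhds hr))
  have hle : ∀ n, N + 1 ≤ n → ‖a ^ n‖ₑ ≤ (r : ℝ≥0∞) ^ n := by
    intro n hn
    have hn0 : (n : ℝ) ≠ 0 := by exact_mod_cast (by omega : n ≠ 0)
    have h1 := ENNReal.rpow_le_rpow (hN n (by omega)).le (Nat.cast_nonneg (α := ℝ) n)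
    rwa [← ENNReal.rpow_mul, one_div_mul_cancel hn0, ENNReal.rpow_one, ENNReal.rpow_natCast] at h1
  rw [← Summable.sum_add_tsum_nat_add' (f := fun n => ‖a ^ n‖ₑ) (k := N + 1) ENNReal.summable]
  have h1 : ∑' n : ℕ, ‖a ^ (n + (N + 1))‖ₑ ≤ ∑' n : ℕ, (r : ℝ≥0∞) ^ n := by
    refine ENNReal.tsum_le_tsum fun n => (hle _ (by omega)).trans ?_
    rw [pow_add]
    exact mul_le_of_le_one_right zero_le (pow_le_one₀ zero_le hr1.le)
  have h2 : ∑' n : ℕ, (r : ℝ≥0∞) ^ n ≠ ∞ := by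
    rw [ENNReal.tsum_geometric]
    exact ENNReal.inv_ne_top.2 (tsub_pos_of_lt hr1).ne'
  exact ENNReal.add_ne_top.2 ⟨ENNReal.sum_ne_top.2 fun n _ => enorm_ne_top,
    ne_top_of_le_ne_top h2 h1⟩

lemma tsum_companion_pow_ne_top {θ : Fin p → ℝ} (hθ : θ ∈ ModelClass.ar.Θ p) :
    ∑' n : ℕ, ‖(Module.End.toContinuousLinearMap (Fin p → ℂ) (companion θ)) ^ n‖ₑ ≠ ∞ := by
  refine tsum_pow_ne_top_of_spectralRadius_lt ?_
  set a := Module.End.toContinuousLinearMap (Fin p → ℂ) (companion θ) with ha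
  have hlt : ∀ k ∈ spectrum ℂ a, ‖k‖₊ < 1 := by
    intro k hk
    rw [ha, AlgEquiv.spectrum_eq, ← Module.End.hasEigenvalue_iff_mem_spectrum] at hk
    exact norm_eigenvalue_companion_lt hθ hk
  rcases (spectrum ℂ a).eq_empty_or_nonempty with h | h
  · simp [spectralRadius, h]
  · exact spectrum.spectralRadius_lt_of_forall_lt_of_nonempty h hlt

lemma iter_ar_sub (θ : Fin p → ℝ) (m : ℕ) (a : ℕ → ℝ) (x y : Fin p → ℝ) :
    (fun i => ((iter (fun x e => ModelClass.ar.G p x θ e) m a x i -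
      iter (fun x e => ModelClass.ar.G p x θ e) m a y i : ℝ) : ℂ)) =
    ((Module.End.toContinuousLinearMap (Fin p → ℂ) (companion θ)) ^ m)
      (fun i => ((x i - y i : ℝ) : ℂ)) := by
  induction m generalizing a with
  | zero => rfl
  | succ m ih =>
    rw [pow_succ', mul_apply_eq_comp, ← ih (tail a)]
    ext i
    change _ = (Fin.cons (∑ j, (θ j : ℂ) * _) _ : Fin (p + 1) → ℂ) i.castSucc
    simp only [iter_succ]
    rcases Fin.eq_zero_or_eq_succ i.castSucc with h | ⟨j, h⟩
    · rw [step_zero h, step_zero h, h, Fin.cons_zero]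
      simp only [ModelClass.G]
      push_cast
      simp only [mul_sub, Finset.sum_sub_distrib]
      ring
    · rw [step_succ h, step_succ h, h, Fin.cons_succ]

lemma edist_eq_enorm_ofReal (x y : Fin p → ℝ) :
    edist x y = ‖(fun i => ((x i - y i : ℝ) : ℂ) : Fin p → ℂ)‖ₑ := by
  have h (i : Fin p) : edist ((x i - y i : ℝ) : ℂ) 0 = edist (x i) (y i) := by
    rw [edist_zero_right, edist_eq_enorm_sub, enorm_eq_nnnorm, Complex.nnnorm_real, enorm_eq_nnnorm]
  rw [← edist_zero_right]
  refine le_antisymm (edist_pi_le_iff.2 fun i => ?_) (edist_pi_le_iff.2 fun i => ?_)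
  · rw [← h]
    exact edist_le_pi_edist (fun i => ((x i - y i : ℝ) : ℂ) : Fin p → ℂ) 0 i
  · exact (h i).trans_le (edist_le_pi_edist x y i)

lemma gdist_zero_step_le {T : ℝ → ℝ} (g : (Fin p → ℝ) → ℝ → ℝ) (e : ℝ) :
    gdist T 0 (step g e 0) ≤ edist (T 0) (T (g 0 e)) := by
  refine edist_pi_le_iff.2 fun i => ?_
  simp only [Function.comp]
  rcases Fin.eq_zero_or_eq_succ i.castSucc with hi | ⟨j, hi⟩
  · rw [step_zero hi]; rfl
  · rw [step_succ hi]; simp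

lemma contracts_ar {θ : Fin p → ℝ} (hθ : θ ∈ ModelClass.ar.Θ p) {F : Measure ℝ}
    [IsProbabilityMeasure F] (hF : ∫⁻ e, edist 0 (ModelClass.ar.gauge e) ∂F ≠ ∞) :
    Contracts ModelClass.ar.gauge (fun x e => ModelClass.ar.G p x θ e) F fun m _ =>
      ‖(Module.End.toContinuousLinearMap (Fin p → ℂ) (companion θ)) ^ m‖ₑ where
  measurable_map := by
    simp only [ModelClass.G, Function.uncurry_def]
    fun_prop
  continuous_map e := by
    simp only [ModelClass.G]
    fun_prop
  measurable m := measurable_const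
  dependsOn m := fun _ _ _ => rfl
  summable := by simpa using tsum_companion_pow_ne_top hθ
  lipschitz m a x y := by
    change edist (iter _ m a x) (iter _ m a y) ≤ _ * edist x y
    rw [edist_eq_enorm_ofReal, edist_eq_enorm_ofReal, iter_ar_sub]
    exact ContinuousLinearMap.le_opENorm _ _
  start := by
    refine ne_top_of_le_ne_top hF (lintegral_mono fun e => (gdist_zero_step_le _ _).trans ?_)
    simp [ModelClass.G, ModelClass.gauge]

end ar

/-! ### The ARCH recursion -/

section arch

variable {p : ℕ}

lemma exists_weights {θ : Fin p → ℝ} (h0 : ∀ i, 0 ≤ θ i) (h1 : ∑ i, θ i < 1) :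
    ∃ (c : ℕ → ℝ) (ρ ε : ℝ), 0 ≤ ρ ∧ ρ < 1 ∧ 0 < ε ∧ c p = 0 ∧ (∀ i, i < p → ε ≤ c i) ∧ 0 ≤ c 0 ∧
      ∀ i : Fin p, θ i * c 0 + c (i + 1) ≤ ρ * c i := by
  set S := ∑ i, θ i with hS
  have hS0 : 0 ≤ S := Finset.sum_nonneg fun i _ => h0 i
  set ε := (1 - S) / (p + 1) with hε
  have hε0 : 0 < ε := div_pos (by linarith) (by positivity)
  have hεp : ε * (p + 1) = 1 - S := by rw [hε]; field_simp
  let c : ℕ → ℝ := fun i => ∑ j : Fin p, (if i ≤ j then θ j else 0) + ((p : ℝ) - i) * ε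
  have hpart (i : ℕ) : 0 ≤ ∑ j : Fin p, (if i ≤ j then θ j else 0) :=
    Finset.sum_nonneg fun j _ => by split_ifs <;> simp [h0]
  have hpart1 (i : ℕ) : ∑ j : Fin p, (if i ≤ j then θ j else 0) ≤ S :=
    Finset.sum_le_sum fun j _ => by split_ifs <;> simp [h0]
  have hpc : (0 : ℝ) ≤ p := Nat.cast_nonneg _
  have hc1 (i : ℕ) : c i ≤ 1 := by
    have : (0 : ℝ) ≤ i := Nat.cast_nonneg _
    have := hpart1 i
    simp only [c]
    nlinarith
  refine ⟨c, 1 - ε, ε, by nlinarith, by linarith, hε0, ?_, fun i hi => ?_, ?_, fun i => ?_⟩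
  · simp only [c, sub_self, zero_mul, add_zero]
    exact Finset.sum_eq_zero fun j _ => if_neg (by omega)
  · have : (i : ℝ) + 1 ≤ p := by exact_mod_cast hi
    simp only [c]
    nlinarith [hpart i]
  · simp only [c, Nat.cast_zero, sub_zero]
    have := hpart 0
    positivity
  · have hsplit : c i = θ i + c (i + 1) + ε := by
      simp only [c]
      have : ∑ j : Fin p, (if (i : ℕ) ≤ j then θ j else 0) =
          θ i + ∑ j : Fin p, (if (i : ℕ) + 1 ≤ j then θ j else 0) := by
        have hi : θ i = ∑ j : Fin p, if j = i then θ j else 0 := by simp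
        rw [hi, ← Finset.sum_add_distrib]
        refine Finset.sum_congr rfl fun j _ => ?_
        rcases lt_trichotomy (i : ℕ) j with h | h | h
        · rw [if_pos h.le, if_neg (by rintro rfl; omega), if_pos (Nat.succ_le_of_lt h), zero_add]
        · rw [if_pos h.le, if_pos (Fin.ext h.symm), if_neg (by omega), add_zero]
        · rw [if_neg (by omega), if_neg (by rintro rfl; omega), if_neg (by omega), zero_add]
      rw [this]; push_cast; ring
    nlinarith [mul_le_mul_of_nonneg_left (hc1 0) (h0 i), mul_le_mul_of_nonneg_left (hc1 i) hε0.le]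

/-- The linear recursion dominating differences of solutions of the ARCH recursion. -/
def archStep (θ : Fin p → ℝ) (e : ℝ) (u : Fin p → ℝ≥0∞) : Fin p → ℝ≥0∞ := fun i =>
  (Fin.cons (ENNReal.ofReal (e ^ 2) * ∑ j, ENNReal.ofReal (θ j) * u j) u : Fin (p + 1) → ℝ≥0∞)
    i.castSucc

/-- The iterates of `archStep`, started at `1`. -/
def archIter (θ : Fin p → ℝ) : ℕ → (ℕ → ℝ) → Fin p → ℝ≥0∞
  | 0, _ => fun _ => 1
  | m + 1, a => archStep θ (a 0) (archIter θ m (tail a))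

lemma measurable_archStep (θ : Fin p → ℝ) :
    Measurable fun z : ℝ × (Fin p → ℝ≥0∞) => archStep θ z.1 z.2 := by
  refine measurable_pi_iff.2 fun i => ?_
  rcases Fin.eq_zero_or_eq_succ i.castSucc with h | ⟨j, h⟩
  · simp only [archStep, h, Fin.cons_zero]
    fun_prop
  · simp only [archStep, h, Fin.cons_succ]
    fun_prop

lemma measurable_archIter (θ : Fin p → ℝ) (m : ℕ) : Measurable (archIter θ m) := by
  induction m with
  | zero => exact measurable_const
  | succ m ih =>
    have h : Measurable fun a : ℕ → ℝ => (a 0, archIter θ m (tail a)) :=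
      (measurable_pi_apply 0).prodMk (ih.comp measurable_tail)
    have h' := (measurable_archStep θ).comp h
    rw [Function.comp_def] at h'
    exact h'

lemma dependsOn_archIter (θ : Fin p → ℝ) (m : ℕ) : DependsOn (archIter θ m) (Set.Iio m) := by
  induction m with
  | zero => exact fun _ _ _ => rfl
  | succ m ih =>
    intro a b hab
    have h1 : archIter θ m (tail a) = archIter θ m (tail b) :=
      ih fun i hi => hab (i + 1) (by rw [Set.mem_Iio] at hi ⊢; omega)
    simp only [archIter, h1, hab 0 (by simp)]

lemma weighted_archStep (θ : Fin p → ℝ) (C : ℕ → ℝ≥0∞) (hC : C p = 0) (e : ℝ) (u : Fin p → ℝ≥0∞) :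
    ∑ i : Fin p, C i * archStep θ e u i =
      ENNReal.ofReal (e ^ 2) * ∑ j, (C 0 * ENNReal.ofReal (θ j)) * u j + ∑ j : Fin p, C (j + 1) * u j := by
  have h := Fin.sum_univ_castSucc fun i : Fin (p + 1) => C i *
    (Fin.cons (ENNReal.ofReal (e ^ 2) * ∑ j, ENNReal.ofReal (θ j) * u j) u : Fin (p + 1) → ℝ≥0∞) i
  rw [Fin.sum_univ_succ] at h
  simp only [Fin.val_zero, Fin.cons_zero, Fin.val_succ, Fin.cons_succ, Fin.val_castSucc,
    Fin.val_last, hC, zero_mul, add_zero] at h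
  simp only [archStep]
  rw [← h]
  congr 1
  rw [← mul_assoc, mul_comm (C 0), mul_assoc, Finset.mul_sum]
  simp only [mul_assoc]

lemma lintegral_archIter_le {θ : Fin p → ℝ} {C : ℕ → ℝ≥0∞} {ρ : ℝ≥0∞} (hC : C p = 0)
    (h : ∀ i : Fin p, ENNReal.ofReal (θ i) * C 0 + C (i + 1) ≤ ρ * C i) {F : Measure ℝ}
    [IsProbabilityMeasure F] (hF : ∫⁻ e, ENNReal.ofReal (e ^ 2) ∂F ≤ 1) (m : ℕ) :
    ∫⁻ a, ∑ i : Fin p, C i * archIter θ m a i ∂iid ℕ F ≤ ρ ^ m * ∑ i : Fin p, C i := by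
  induction m with
  | zero => simp [archIter]
  | succ m ih =>
    have mi (i : Fin p) : Measurable fun a => archIter θ m a i :=
      (measurable_pi_apply i).comp (measurable_archIter θ m)
    have hmeas : Measurable (Function.uncurry fun (e : ℝ) (a : ℕ → ℝ) =>
        ∑ i : Fin p, C i * archStep θ e (archIter θ m a) i) := by
      refine Finset.measurable_sum _ fun i _ => Measurable.const_mul ?_ _
      exact (measurable_pi_apply i).comp ((measurable_archStep θ).comp
        (measurable_fst.prodMk ((measurable_archIter θ m).comp measurable_snd)))
    calc _ = ∫⁻ a, ∫⁻ e, ∑ i : Fin p, C i * archStep θ e (archIter θ m a) i ∂F ∂iid ℕ F :=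
          lintegral_zero_tail hmeas
      _ ≤ ∫⁻ a, ρ * ∑ i : Fin p, C i * archIter θ m a i ∂iid ℕ F := by
          refine lintegral_mono fun a => ?_
          simp only [weighted_archStep θ C hC]
          rw [lintegral_add_right _ measurable_const, lintegral_mul_const _ (by fun_prop),
            lintegral_const, measure_univ, mul_one]
          refine (add_le_add_left (mul_le_of_le_one_left zero_le hF) _).trans ?_
          rw [← Finset.sum_add_distrib, Finset.mul_sum]
          refine Finset.sum_le_sum fun i _ => ?_
          rw [← add_mul, ← mul_assoc, mul_comm (C 0)]
          exact mul_le_mul_left (h i) _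
      _ ≤ _ := by
          rw [lintegral_const_mul _ (Finset.measurable_sum _ fun i _ => (mi i).const_mul _),
            pow_succ', mul_assoc]
          exact mul_le_mul_right ih _

lemma archScale_nonneg (x : Fin p → ℝ) (θ : Fin (p + 1) → ℝ) : 0 ≤ ModelClass.archScale x θ :=
  Real.sqrt_nonneg _

lemma archScale_sq {θ : Fin (p + 1) → ℝ} (hθ : θ ∈ ModelClass.arch.Θ p) (x : Fin p → ℝ) :
    ModelClass.archScale x θ ^ 2 = θ 0 + ∑ i : Fin p, θ i.succ * x i ^ 2 :=
  Real.sq_sqrt (add_nonneg hθ.1.le (Finset.sum_nonneg fun i _ =>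
    mul_nonneg (hθ.2.1 i) (sq_nonneg _)))

lemma gauge_arch_G {θ : Fin (p + 1) → ℝ} (hθ : θ ∈ ModelClass.arch.Θ p) (x : Fin p → ℝ) (e : ℝ) :
    ModelClass.arch.gauge (ModelClass.arch.G p x θ e) =
      (θ 0 + ∑ i : Fin p, θ i.succ * |ModelClass.arch.gauge (x i)|) * ModelClass.arch.gauge e := by
  simp only [abs_gauge_arch]
  rw [← archScale_sq hθ]
  simp only [ModelClass.gauge, ModelClass.G, abs_mul, abs_of_nonneg (archScale_nonneg x θ)]
  ring

lemma measurable_archScale (θ : Fin (p + 1) → ℝ) :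
    Measurable fun x : Fin p → ℝ => ModelClass.archScale x θ := by
  unfold ModelClass.archScale
  fun_prop

lemma edist_iter_arch_le {θ : Fin (p + 1) → ℝ} (hθ : θ ∈ ModelClass.arch.Θ p) (m : ℕ) (a : ℕ → ℝ)
    (x y : Fin p → ℝ) (i : Fin p) :
    edist (ModelClass.arch.gauge (iter (fun x e => ModelClass.arch.G p x θ e) m a x i))
      (ModelClass.arch.gauge (iter (fun x e => ModelClass.arch.G p x θ e) m a y i)) ≤
      archIter (fun j => θ j.succ) m a i * gdist ModelClass.arch.gauge x y := by
  induction m generalizing a i with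
  | zero => simpa [iter, archIter] using edist_le_gdist x y i
  | succ m ih =>
    simp only [iter_succ, archIter, archStep]
    rcases Fin.eq_zero_or_eq_succ i.castSucc with h | ⟨j, h⟩
    · rw [step_zero h, step_zero h, h, Fin.cons_zero, gauge_arch_G hθ, gauge_arch_G hθ]
      set x' := iter (fun x e => ModelClass.arch.G p x θ e) m (tail a) x
      set y' := iter (fun x e => ModelClass.arch.G p x θ e) m (tail a) y
      calc _ ≤ ENNReal.ofReal (a 0 ^ 2) * ∑ j, ENNReal.ofReal (θ j.succ) *
            edist (ModelClass.arch.gauge (x' j)) (ModelClass.arch.gauge (y' j)) := by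
            simp only [edist_dist, Real.dist_eq]
            simp only [← ENNReal.ofReal_mul (hθ.2.1 _)]
            rw [← ENNReal.ofReal_sum_of_nonneg fun j _ => mul_nonneg (hθ.2.1 _) (abs_nonneg _),
              ← ENNReal.ofReal_mul (sq_nonneg _)]
            refine ENNReal.ofReal_le_ofReal ?_
            rw [← sub_mul, abs_mul, abs_gauge_arch, mul_comm, add_sub_add_left_eq_sub,
              ← Finset.sum_sub_distrib]
            refine mul_le_mul_of_nonneg_left ((Finset.abs_sum_le_sum_abs _ _).trans
              (Finset.sum_le_sum fun j _ => ?_)) (sq_nonneg _)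
            rw [← mul_sub, abs_mul, abs_of_nonneg (hθ.2.1 j)]
            exact mul_le_mul_of_nonneg_left (abs_abs_sub_abs_le_abs_sub _ _) (hθ.2.1 j)
        _ ≤ ENNReal.ofReal (a 0 ^ 2) * ∑ j, ENNReal.ofReal (θ j.succ) *
            (archIter (fun j => θ j.succ) m (tail a) j * gdist ModelClass.arch.gauge x y) := by
            gcongr with j
            exact ih _ _
        _ = _ := by
            rw [mul_assoc, Finset.sum_mul]
            simp only [mul_assoc]
    · rw [step_succ h, step_succ h, h, Fin.cons_succ]
      exact ih _ _

lemma contracts_arch {θ : Fin (p + 1) → ℝ} (hθ : θ ∈ ModelClass.arch.Θ p) {F : Measure ℝ}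
    [IsProbabilityMeasure F] (hF : ∫⁻ e, ENNReal.ofReal (e ^ 2) ∂F ≤ 1) :
    Contracts ModelClass.arch.gauge (fun x e => ModelClass.arch.G p x θ e) F fun m a =>
      ∑ i, archIter (fun j => θ j.succ) m a i where
  measurable_map := (measurable_archScale θ).comp measurable_fst |>.mul measurable_snd
  continuous_map e := by
    simp only [ModelClass.G, ModelClass.archScale]
    fun_prop
  measurable m := Finset.measurable_sum _ fun i _ =>
    (measurable_pi_apply i).comp (measurable_archIter _ m)
  dependsOn m := fun a b hab => by simp only [dependsOn_archIter _ m hab]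
  summable := by
    obtain ⟨c, ρ, ε, hρ0, hρ1, hε, hcp, hcε, hc0, hc⟩ := exists_weights hθ.2.1 hθ.2.2
    have hcn : ∀ i : ℕ, i ≤ p → 0 ≤ c i := fun i hi => by
      rcases hi.lt_or_eq with h | h
      · exact hε.le.trans (hcε i h)
      · rw [h, hcp]
    have hε' : ENNReal.ofReal ε ≠ 0 := by simpa using hε
    have key := lintegral_archIter_le (θ := fun j => θ j.succ) (C := fun i => ENNReal.ofReal (c i))
      (ρ := ENNReal.ofReal ρ) (by simp [hcp]) (fun i => by
        rw [← ENNReal.ofReal_mul (hθ.2.1 i), ← ENNReal.ofReal_mul hρ0,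
          ← ENNReal.ofReal_add (mul_nonneg (hθ.2.1 i) hc0) (hcn _ (by omega))]
        exact ENNReal.ofReal_le_ofReal (hc i)) hF
    have hle (m : ℕ) : ∫⁻ a, ∑ i, archIter (fun j => θ j.succ) m a i ∂iid ℕ F ≤
        ((ENNReal.ofReal ε)⁻¹ * ∑ i : Fin p, ENNReal.ofReal (c i)) * ENNReal.ofReal ρ ^ m := by
      have mi (i : Fin p) : Measurable fun a => archIter (fun j => θ j.succ) m a i :=
        (measurable_pi_apply i).comp (measurable_archIter _ m)
      calc _ ≤ ∫⁻ a, (ENNReal.ofReal ε)⁻¹ * ∑ i : Fin p, ENNReal.ofReal (c i) *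
            archIter (fun j => θ j.succ) m a i ∂iid ℕ F := by
            refine lintegral_mono fun a => ?_
            rw [Finset.mul_sum]
            refine Finset.sum_le_sum fun i _ => ?_
            rw [← mul_assoc]
            refine le_mul_of_one_le_left zero_le ?_
            rw [← ENNReal.inv_mul_cancel hε' (by simp)]
            exact mul_le_mul_right (ENNReal.ofReal_le_ofReal (hcε i i.2)) _
        _ ≤ _ := by
            rw [lintegral_const_mul _ (Finset.measurable_sum _ fun i _ => (mi i).const_mul _),
              mul_assoc, mul_comm (∑ i : Fin p, ENNReal.ofReal (c i))]
            exact mul_le_mul_right (key m) _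
    refine ne_top_of_le_ne_top ?_ (ENNReal.tsum_le_tsum hle)
    rw [ENNReal.tsum_mul_left, ENNReal.tsum_geometric]
    refine ENNReal.mul_ne_top (ENNReal.mul_ne_top (ENNReal.inv_ne_top.2 hε')
      (by simp)) (ENNReal.inv_ne_top.2 (tsub_pos_of_lt ?_).ne')
    rwa [ENNReal.ofReal_lt_one]
  lipschitz m a x y := by
    refine edist_pi_le_iff.2 fun i => (edist_iter_arch_le hθ m a x y i).trans ?_
    exact mul_le_mul_left (Finset.single_le_sum (f := fun i => archIter (fun j => θ j.succ) m a i)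
      (fun _ _ => zero_le) (Finset.mem_univ i)) _
  start := by
    refine ne_top_of_le_ne_top (b := ENNReal.ofReal (θ 0) * 1) (by simp)
      (le_trans (lintegral_mono fun e => (gdist_zero_step_le _ _).trans_eq (?_ : _ =
        ENNReal.ofReal (θ 0) * ENNReal.ofReal (e ^ 2))) ?_)
    · rw [gauge_arch_G hθ, edist_dist, Real.dist_eq, ModelClass.gauge_zero, zero_sub, abs_neg, abs_mul,
        abs_gauge_arch, ← ENNReal.ofReal_mul hθ.1.le]
      simp [ModelClass.gauge_zero, abs_of_nonneg hθ.1.le]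
    · rw [lintegral_const_mul _ (by fun_prop)]
      exact mul_le_mul_right hF _

end arch

/-! ### Both model classes -/

section model

variable {p : ℕ}

/-- The moment conditions on the innovations under which the recursion contracts. -/
def MomentOK (M : ModelClass) (F : Measure ℝ) : Prop :=
  ∫⁻ e, edist 0 (M.gauge e) ∂F ≠ ∞ ∧ (M = .arch → ∫⁻ e, ENNReal.ofReal (e ^ 2) ∂F ≤ 1)

lemma exists_contracts (M : ModelClass) {θ : Fin (M.dim p) → ℝ} (hθ : θ ∈ M.Θ p) {F : Measure ℝ}
    [IsProbabilityMeasure F] (hF : MomentOK M F) :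
    ∃ Λ, Contracts M.gauge (fun x e => M.G p x θ e) F Λ := by
  cases M
  · exact ⟨_, contracts_ar hθ hF.1⟩
  · exact ⟨_, contracts_arch hθ (hF.2 rfl)⟩

lemma gdist_eq_ofReal (T : ℝ → ℝ) (x y : Fin p → ℝ) :
    gdist T x y = ENNReal.ofReal (dist (T ∘ x) (T ∘ y)) := edist_dist _ _

lemma abs_affine_le (v : Fin (p + 1) → ℝ) {u : Fin p → ℝ} {r : ℝ} (hu : ∀ i, |u i| ≤ r)
    (hr : 0 ≤ r) : |v 0 + ∑ i, v i.succ * u i| ≤ (∑ i, |v i|) * (1 + r) := by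
  have h1 : |∑ i, v i.succ * u i| ≤ (∑ i : Fin p, |v i.succ|) * r := by
    rw [Finset.sum_mul]
    refine (Finset.abs_sum_le_sum_abs _ _).trans (Finset.sum_le_sum fun i _ => ?_)
    rw [abs_mul]
    exact mul_le_mul_of_nonneg_left (hu i) (abs_nonneg _)
  rw [Fin.sum_univ_succ]
  have h2 : 0 ≤ ∑ i : Fin p, |v i.succ| := Finset.sum_nonneg fun i _ => abs_nonneg _
  calc _ ≤ |v 0| + |∑ i, v i.succ * u i| := abs_add_le _ _
    _ ≤ _ := by nlinarith [abs_nonneg (v 0)]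

lemma abs_linear_le {ι : Type*} [Fintype ι] (v : ι → ℝ) {u : ι → ℝ} {r : ℝ} (hu : ∀ i, |u i| ≤ r) :
    |∑ i, v i * u i| ≤ (∑ i, |v i|) * r := by
  rw [Finset.sum_mul]
  refine (Finset.abs_sum_le_sum_abs _ _).trans (Finset.sum_le_sum fun i _ => ?_)
  rw [abs_mul]
  exact mul_le_mul_of_nonneg_left (hu i) (abs_nonneg _)

lemma StepBound.mono {T : ℝ → ℝ} {g' g : (Fin p → ℝ) → ℝ → ℝ} {π : Measure (ℝ × ℝ)} {L κ κ' : ℝ≥0∞}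
    (h : StepBound T g' g π L κ) (hκ : κ ≤ κ') : StepBound T g' g π L κ' :=
  fun x' x => (h x' x).trans (by gcongr)

lemma stepBound_ar (θ' θ : Fin p → ℝ) (π : Measure (ℝ × ℝ)) [IsProbabilityMeasure π] :
    StepBound ModelClass.ar.gauge (fun x e => ModelClass.ar.G p x θ' e)
      (fun x e => ModelClass.ar.G p x θ e) π (ENNReal.ofReal (∑ i, |θ i|))
      (ENNReal.ofReal (∑ i, |θ' i - θ i|) + (1 + ENNReal.ofReal (∑ i, |θ i|)) *
        ∫⁻ z, edist (ModelClass.ar.gauge z.1) (ModelClass.ar.gauge z.2) ∂π) := by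
  intro x' x
  set D := dist (ModelClass.ar.gauge ∘ x') (ModelClass.ar.gauge ∘ x) with hD
  set Z := dist (ModelClass.ar.gauge ∘ (0 : Fin p → ℝ)) (ModelClass.ar.gauge ∘ x') with hZ
  rw [gdist_eq_ofReal, gdist_eq_ofReal, ← hD, ← hZ]
  set I := ∫⁻ z, edist (ModelClass.ar.gauge z.1) (ModelClass.ar.gauge z.2) ∂π
  set S := ∑ i, |θ i| with hS
  set Δ := ∑ i, |θ' i - θ i| with hΔ
  have hS0 : 0 ≤ S := Finset.sum_nonneg fun i _ => abs_nonneg _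
  have hΔ0 : 0 ≤ Δ := Finset.sum_nonneg fun i _ => abs_nonneg _
  have hpt (z : ℝ × ℝ) : edist (ModelClass.ar.gauge (ModelClass.ar.G p x' θ' z.1))
      (ModelClass.ar.gauge (ModelClass.ar.G p x θ z.2)) ≤
      ENNReal.ofReal (S * D + Δ * Z) + edist (ModelClass.ar.gauge z.1) (ModelClass.ar.gauge z.2) := by
    simp only [edist_dist, Real.dist_eq, ModelClass.gauge, ModelClass.G]
    rw [← ENNReal.ofReal_add (add_nonneg (mul_nonneg hS0 dist_nonneg)
      (mul_nonneg hΔ0 dist_nonneg)) (abs_nonneg _)]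
    refine ENNReal.ofReal_le_ofReal ?_
    have h1 : |∑ i, θ i * (x' i - x i)| ≤ S * D := abs_linear_le θ fun i =>
      dist_le_pi_dist (ModelClass.ar.gauge ∘ x') (ModelClass.ar.gauge ∘ x) i
    have h2 : |∑ i, (θ' i - θ i) * x' i| ≤ Δ * Z := abs_linear_le (fun i => θ' i - θ i) fun i => by
      have := dist_le_pi_dist (ModelClass.ar.gauge ∘ (0 : Fin p → ℝ)) (ModelClass.ar.gauge ∘ x') i
      rwa [Real.dist_eq, abs_sub_comm, Function.comp_apply, Function.comp_apply, Pi.zero_apply,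
        ModelClass.gauge_zero, sub_zero] at this
    have e : (∑ i, θ' i * x' i + z.1) - (∑ i, θ i * x i + z.2) =
        ∑ i, θ i * (x' i - x i) + ∑ i, (θ' i - θ i) * x' i + (z.1 - z.2) := by
      simp only [mul_sub, sub_mul, Finset.sum_sub_distrib]; ring
    rw [e]
    refine (abs_add_le _ _).trans (add_le_add_left ((abs_add_le _ _).trans (add_le_add h1 h2)) _)
  refine (lintegral_mono hpt).trans ?_
  rw [lintegral_add_left measurable_const, lintegral_const, measure_univ, mul_one,
    ENNReal.ofReal_add (mul_nonneg hS0 dist_nonneg) (mul_nonneg hΔ0 dist_nonneg),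
    ENNReal.ofReal_mul hS0, ENNReal.ofReal_mul hΔ0, add_assoc]
  refine add_le_add_right ?_ _
  rw [add_mul]
  refine add_le_add (mul_le_mul_right le_add_self _) ?_
  rw [mul_right_comm]
  exact le_mul_of_one_le_left zero_le (one_le_mul le_self_add le_self_add)

lemma stepBound_arch {θ' θ : Fin (p + 1) → ℝ} (hθ' : θ' ∈ ModelClass.arch.Θ p)
    (hθ : θ ∈ ModelClass.arch.Θ p) {π : Measure (ℝ × ℝ)} [IsProbabilityMeasure π]
    (h1 : ∫⁻ z, ENNReal.ofReal (z.1 ^ 2) ∂π ≤ 1) (h2 : ∫⁻ z, ENNReal.ofReal (z.2 ^ 2) ∂π ≤ 1) :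
    StepBound ModelClass.arch.gauge (fun x e => ModelClass.arch.G p x θ' e)
      (fun x e => ModelClass.arch.G p x θ e) π (ENNReal.ofReal (∑ i, |θ i|))
      (ENNReal.ofReal (∑ i, |θ' i - θ i|) + (1 + ENNReal.ofReal (∑ i, |θ i|)) *
        ∫⁻ z, edist (ModelClass.arch.gauge z.1) (ModelClass.arch.gauge z.2) ∂π) := by
  intro x' x
  set T := ModelClass.arch.gauge with hT
  set D := dist (T ∘ x') (T ∘ x) with hD
  set Z := dist (T ∘ (0 : Fin p → ℝ)) (T ∘ x') with hZ
  rw [gdist_eq_ofReal, gdist_eq_ofReal, ← hD, ← hZ]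
  set I := ∫⁻ z, edist (T z.1) (T z.2) ∂π
  set S := ∑ i, |θ i| with hS
  set Δ := ∑ i, |θ' i - θ i| with hΔ
  have hS0 : 0 ≤ S := Finset.sum_nonneg fun i _ => abs_nonneg _
  have hΔ0 : 0 ≤ Δ := Finset.sum_nonneg fun i _ => abs_nonneg _
  have hZ0 : 0 ≤ Z := dist_nonneg
  have hD0 : 0 ≤ D := dist_nonneg
  have mT : Measurable T := (gauge_isGauge .arch).measurable
  have hu (i : Fin p) : |(|T (x' i)|)| ≤ Z := by
    rw [abs_abs]
    have := dist_le_pi_dist (T ∘ (0 : Fin p → ℝ)) (T ∘ x') i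
    rwa [Real.dist_eq, abs_sub_comm, Function.comp_apply, Function.comp_apply, Pi.zero_apply,
      hT, ModelClass.gauge_zero, sub_zero, ← hT] at this
  have hd (i : Fin p) : |(|T (x' i)| - |T (x i)|)| ≤ D :=
    (abs_abs_sub_abs_le_abs_sub _ _).trans (dist_le_pi_dist (T ∘ x') (T ∘ x) i)
  have hpt (z : ℝ × ℝ) : edist (T (ModelClass.arch.G p x' θ' z.1))
      (T (ModelClass.arch.G p x θ z.2)) ≤
      ENNReal.ofReal (Δ * (1 + Z)) * ENNReal.ofReal (z.1 ^ 2) +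
        (ENNReal.ofReal (S * (1 + Z)) * edist (T z.1) (T z.2) +
          ENNReal.ofReal (S * D) * ENNReal.ofReal (z.2 ^ 2)) := by
    simp only [edist_dist, Real.dist_eq]
    rw [← ENNReal.ofReal_mul (by positivity), ← ENNReal.ofReal_mul (by positivity),
      ← ENNReal.ofReal_mul (by positivity), ← ENNReal.ofReal_add (by positivity) (by positivity),
      ← ENNReal.ofReal_add (by positivity) (by positivity)]
    refine ENNReal.ofReal_le_ofReal ?_
    rw [hT, gauge_arch_G hθ', gauge_arch_G hθ, ← hT, ← abs_gauge_arch, ← abs_gauge_arch, ← hT]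
    have b1 := abs_affine_le (fun i => θ' i - θ i) hu hZ0
    have b2 := abs_affine_le θ hu hZ0
    have b3 : |∑ i : Fin p, θ i.succ * (|T (x' i)| - |T (x i)|)| ≤ S * D := by
      refine (abs_linear_le (fun i => θ (Fin.succ i)) hd).trans
        (mul_le_mul_of_nonneg_right ?_ hD0)
      rw [hS, Fin.sum_univ_succ]
      exact le_add_of_nonneg_left (abs_nonneg _)
    have e : (θ' 0 + ∑ i : Fin p, θ' i.succ * |T (x' i)|) * T z.1 -
        (θ 0 + ∑ i : Fin p, θ i.succ * |T (x i)|) * T z.2 =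
        ((θ' 0 - θ 0) + ∑ i : Fin p, (θ' i.succ - θ i.succ) * |T (x' i)|) * T z.1 +
        ((θ 0 + ∑ i : Fin p, θ i.succ * |T (x' i)|) * (T z.1 - T z.2) +
        (∑ i : Fin p, θ i.succ * (|T (x' i)| - |T (x i)|)) * T z.2) := by
      simp only [mul_sub, sub_mul, Finset.sum_sub_distrib]; ring
    rw [e]
    refine (abs_add_le _ _).trans (add_le_add ?_ ((abs_add_le _ _).trans (add_le_add ?_ ?_)))
    · rw [abs_mul]; exact mul_le_mul_of_nonneg_right b1 (abs_nonneg _)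
    · rw [abs_mul]; exact mul_le_mul_of_nonneg_right b2 (abs_nonneg _)
    · rw [abs_mul]; exact mul_le_mul_of_nonneg_right b3 (abs_nonneg _)
  have mI : Measurable fun z : ℝ × ℝ => edist (T z.1) (T z.2) :=
    (mT.comp measurable_fst).edist (mT.comp measurable_snd)
  refine (lintegral_mono hpt).trans ?_
  rw [lintegral_add_left (by fun_prop), lintegral_add_left (mI.const_mul _),
    lintegral_const_mul _ (by fun_prop), lintegral_const_mul _ mI,
    lintegral_const_mul _ (by fun_prop)]
  calc _ ≤ ENNReal.ofReal (Δ * (1 + Z)) * 1 + (ENNReal.ofReal (S * (1 + Z)) * I +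
        ENNReal.ofReal (S * D) * 1) := by gcongr
    _ = ENNReal.ofReal S * ENNReal.ofReal D + (ENNReal.ofReal Δ + ENNReal.ofReal S * I) *
        (1 + ENNReal.ofReal Z) := by
      rw [ENNReal.ofReal_mul hΔ0, ENNReal.ofReal_mul hS0, ENNReal.ofReal_mul hS0,
        ENNReal.ofReal_add zero_le_one hZ0, ENNReal.ofReal_one]
      ring
    _ ≤ _ := by
      gcongr
      exact le_add_self

lemma stepBound_model (M : ModelClass) {θ' θ : Fin (M.dim p) → ℝ} (hθ' : θ' ∈ M.Θ p)
    (hθ : θ ∈ M.Θ p) {π : Measure (ℝ × ℝ)} [IsProbabilityMeasure π] {F' F : Measure ℝ}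
    (hπ' : π.map Prod.fst = F') (hπ : π.map Prod.snd = F) (hF' : MomentOK M F')
    (hF : MomentOK M F) :
    StepBound M.gauge (fun x e => M.G p x θ' e) (fun x e => M.G p x θ e) π
      (ENNReal.ofReal (∑ i, |θ i|)) (ENNReal.ofReal (∑ i, |θ' i - θ i|) +
        (1 + ENNReal.ofReal (∑ i, |θ i|)) * ∫⁻ z, edist (M.gauge z.1) (M.gauge z.2) ∂π) := by
  cases M
  · exact stepBound_ar θ' θ π
  · refine stepBound_arch hθ' hθ ?_ ?_
    · have := hF'.2 rfl
      rwa [← hπ', lintegral_map (by fun_prop) measurable_fst] at this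
    · have := hF.2 rfl
      rwa [← hπ, lintegral_map (by fun_prop) measurable_snd] at this

lemma lintegral_gauge_arch_G_zero_ne_top {θ : Fin (p + 1) → ℝ} (hθ : θ ∈ ModelClass.arch.Θ p)
    {F : Measure ℝ} (hF : ∫⁻ e, ENNReal.ofReal (e ^ 2) ∂F ≤ 1) :
    ∫⁻ e, edist 0 (ModelClass.arch.gauge (ModelClass.arch.G p 0 θ e)) ∂F ≠ ∞ := by
  have h0 : 0 < θ 0 := hθ.1
  refine ne_top_of_le_ne_top (b := ENNReal.ofReal (θ 0) * 1) (by simp) ?_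
  calc _ = ∫⁻ e, ENNReal.ofReal (θ 0) * ENNReal.ofReal (e ^ 2) ∂F := by
        refine lintegral_congr fun e => ?_
        rw [gauge_arch_G hθ, edist_dist, Real.dist_eq, zero_sub, abs_neg, abs_mul,
          abs_gauge_arch, ← ENNReal.ofReal_mul h0.le]
        simp [ModelClass.gauge_zero, abs_of_nonneg h0.le]
    _ ≤ _ := by
        rw [lintegral_const_mul _ (by fun_prop)]
        exact mul_le_mul_right hF _

/-- The stationary solution has a finite moment. -/
lemma lintegral_out_ne_top (M : ModelClass) {θ : Fin (M.dim p) → ℝ} (hθ : θ ∈ M.Θ p) {F : Measure ℝ}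
    [IsProbabilityMeasure F] (hF : MomentOK M F) :
    ∫⁻ a, edist 0 (M.gauge (out (fun x e => M.G p x θ e) a)) ∂iid ℕ F ≠ ∞ := by
  obtain ⟨Λ, h⟩ := exists_contracts M hθ hF
  have hT := gauge_isGauge M
  set g : (Fin p → ℝ) → ℝ → ℝ := fun x e => M.G p x θ e with hg
  have md : Measurable fun e : ℝ => (e, e) := measurable_id.prodMk measurable_id
  have hπ1 : (F.map fun e => (e, e)).map Prod.fst = F := by
    rw [Measure.map_map measurable_fst md]; exact Measure.map_id
  have hπ2 : (F.map fun e => (e, e)).map Prod.snd = F := by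
    rw [Measure.map_map measurable_snd md]; exact Measure.map_id
  have := Measure.isProbabilityMeasure_map (μ := F) md.aemeasurable
  have hb := stepBound_model M hθ hθ hπ1 hπ2 hF hF
  have mTG (x : Fin p → ℝ) : Measurable fun e => M.gauge (g x e) :=
    hT.measurable.comp (h.measurable_map.comp (measurable_const.prodMk measurable_id))
  have hI : ∫⁻ z, edist (M.gauge z.1) (M.gauge z.2) ∂(F.map fun e => (e, e)) = 0 := by
    have mI : Measurable fun z : ℝ × ℝ => edist (M.gauge z.1) (M.gauge z.2) :=
      (hT.measurable.comp measurable_fst).edist (hT.measurable.comp measurable_snd)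
    rw [lintegral_map mI md]
    simp
  simp only [hI, sub_self, abs_zero, Finset.sum_const_zero, ENNReal.ofReal_zero, mul_zero,
    add_zero] at hb
  have hstep (x : Fin p → ℝ) : ∫⁻ e, edist (M.gauge (g x e)) (M.gauge (g 0 e)) ∂F ≤
      ENNReal.ofReal (∑ i, |θ i|) * gdist M.gauge x 0 := by
    have h1 := hb x 0
    have mI : Measurable fun z : ℝ × ℝ => edist (M.gauge (g x z.1)) (M.gauge (g 0 z.2)) :=
      ((mTG x).comp measurable_fst).edist ((mTG 0).comp measurable_snd)
    change ∫⁻ z : ℝ × ℝ, edist (M.gauge (g x z.1)) (M.gauge (g 0 z.2)) ∂_ ≤ _ at h1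
    rw [lintegral_map mI md] at h1
    simpa using h1
  have h0 : ∫⁻ e, edist 0 (M.gauge (g 0 e)) ∂F ≠ ∞ := by
    cases M
    · simpa [hg, ModelClass.gauge, ModelClass.G] using hF.1
    · exact lintegral_gauge_arch_G_zero_ne_top hθ (hF.2 rfl)
  have ms : Measurable (sol g) := measurable_sol h.measurable_map
  have hmeas : Measurable (Function.uncurry fun (e : ℝ) (a : ℕ → ℝ) =>
      edist 0 (M.gauge (g (sol g a) e))) :=
    measurable_const.edist (hT.measurable.comp (h.measurable_map.comp
      ((ms.comp measurable_snd).prodMk measurable_fst)))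
  have m0 : Measurable fun a => gdist M.gauge 0 (sol g a) :=
    Measurable.gdist hT measurable_const ms
  refine ne_top_of_le_ne_top (b := ENNReal.ofReal (∑ i, |θ i|) *
    (∫⁻ a, gdist M.gauge 0 (sol g a) ∂iid ℕ F) + ∫⁻ e, edist 0 (M.gauge (g 0 e)) ∂F)
    (ENNReal.add_ne_top.2 ⟨ENNReal.mul_ne_top (by simp) (h.lintegral_sol_ne_top hT), h0⟩) ?_
  refine (lintegral_zero_tail hmeas).trans_le ?_
  calc _ ≤ ∫⁻ a, (ENNReal.ofReal (∑ i, |θ i|) * gdist M.gauge 0 (sol g a) +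
        ∫⁻ e, edist 0 (M.gauge (g 0 e)) ∂F) ∂iid ℕ F := by
        refine lintegral_mono fun a => ?_
        calc _ ≤ ∫⁻ e, (edist (M.gauge (g (sol g a) e)) (M.gauge (g 0 e)) +
              edist 0 (M.gauge (g 0 e))) ∂F := by
              refine lintegral_mono fun e => (edist_triangle _ (M.gauge (g 0 e)) _).trans_eq ?_
              rw [add_comm, edist_comm (M.gauge (g 0 e)) (M.gauge (g _ e))]
          _ ≤ _ := by
              rw [lintegral_add_right _ (measurable_const.edist (mTG 0)), gdist_comm]
              exact add_le_add_left (hstep _) _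
    _ = _ := by
        rw [lintegral_add_right _ measurable_const, lintegral_const_mul _ m0, lintegral_const,
          measure_univ, mul_one]

end model

/-! ### Moments and residuals -/

section residual

variable {p : ℕ}

lemma edist_zero_gauge_arch (x : ℝ) :
    edist 0 (ModelClass.arch.gauge x) = ENNReal.ofReal (x ^ 2) := by
  rw [edist_dist, Real.dist_eq, zero_sub, abs_neg, abs_gauge_arch]

lemma lintegral_sq_eq_one {F : Measure ℝ} (h : ∫ x, x ^ 2 ∂F = 1) :
    ∫⁻ x, ENNReal.ofReal (x ^ 2) ∂F = 1 := by
  rw [← ofReal_integral_eq_lintegral_ofReal (integrable_of_integral_eq_one h)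
    (ae_of_all _ fun x => sq_nonneg x), h, ENNReal.ofReal_one]

lemma momentOK_arch {F : Measure ℝ} (h : ∫⁻ x, ENNReal.ofReal (x ^ 2) ∂F ≤ 1) :
    MomentOK .arch F := by
  refine ⟨?_, fun _ => h⟩
  simp only [edist_zero_gauge_arch]
  exact ne_top_of_le_ne_top ENNReal.one_ne_top h

lemma momentOK_of_innovationMoments {M : ModelClass} {F : Measure ℝ} [IsProbabilityMeasure F]
    (h : M.InnovationMoments F) : MomentOK M F := by
  cases M
  · refine ⟨?_, fun h => by cases h⟩
    have hi : Integrable (fun x : ℝ => 1 + x ^ 4) F := (integrable_const _).add h.2.2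
    refine ne_top_of_le_ne_top hi.lintegral_lt_top.ne (lintegral_mono fun x => ?_)
    rw [edist_dist, Real.dist_eq, zero_sub, abs_neg]
    refine ENNReal.ofReal_le_ofReal ?_
    change |x| ≤ 1 + x ^ 4
    have h4 : x ^ 4 = |x| ^ 4 := by rw [← abs_pow, abs_of_nonneg (by positivity)]
    rw [h4]
    nlinarith [sq_nonneg (|x| ^ 2 - 1 / 2), sq_nonneg (|x| - 1 / 2), abs_nonneg x]
  · exact momentOK_arch (lintegral_sq_eq_one h.2.1).le

lemma measurable_w (M : ModelClass) (θ : Fin (M.dim p) → ℝ) :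
    Measurable fun z : (Fin p → ℝ) × ℝ => M.w p z.1 z.2 θ := by
  cases M
  · exact measurable_snd.sub (Finset.measurable_sum _ fun i _ =>
      ((measurable_pi_apply i).comp measurable_fst).const_mul _)
  · exact measurable_snd.div ((measurable_archScale θ).comp measurable_fst)

/-- The gauged size of the point `(x, y)`. -/
def gsize (M : ModelClass) (z : (Fin p → ℝ) × ℝ) : ℝ≥0∞ :=
  edist 0 (M.gauge z.2) + ∑ i, edist 0 (M.gauge (z.1 i))

lemma measurable_gsize (M : ModelClass) : Measurable (gsize M : (Fin p → ℝ) × ℝ → ℝ≥0∞) := by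
  have mT := (gauge_isGauge M).measurable
  exact (measurable_const.edist (mT.comp measurable_snd)).add (Finset.measurable_sum _ fun i _ =>
    measurable_const.edist (mT.comp ((measurable_pi_apply i).comp measurable_fst)))

lemma gauge_arch_w {θ : Fin (p + 1) → ℝ} (hθ : θ ∈ ModelClass.arch.Θ p) (x : Fin p → ℝ) (y : ℝ) :
    ModelClass.arch.gauge (ModelClass.arch.w p x y θ) =
      ModelClass.arch.gauge y / (θ 0 + ∑ i : Fin p, θ i.succ * x i ^ 2) := by
  rw [← archScale_sq hθ]
  change y / ModelClass.archScale x θ * |y / ModelClass.archScale x θ| = y * |y| / _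
  rw [abs_div, abs_of_nonneg (archScale_nonneg x θ), div_mul_div_comm, sq]

lemma le_archScale_sq {θ : Fin (p + 1) → ℝ} (hθ : θ ∈ ModelClass.arch.Θ p) (x : Fin p → ℝ) :
    θ 0 ≤ θ 0 + ∑ i : Fin p, θ i.succ * x i ^ 2 :=
  le_add_of_nonneg_right (Finset.sum_nonneg fun i _ => mul_nonneg (hθ.2.1 i) (sq_nonneg _))

/-- The residuals grow at most linearly on the gauged scale. -/
lemma exists_edist_gauge_w_le (M : ModelClass) {θ : Fin (M.dim p) → ℝ} (hθ : θ ∈ M.Θ p) :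
    ∃ C : ℝ≥0∞, C ≠ ∞ ∧ ∀ x y, edist 0 (M.gauge (M.w p x y θ)) ≤ C * gsize M (x, y) := by
  cases M
  · refine ⟨1 + ∑ i, ENNReal.ofReal |θ i|, by simp, fun x y => ?_⟩
    have e0 (u : ℝ) : edist 0 (ModelClass.ar.gauge u) = ENNReal.ofReal |u| := by
      rw [edist_dist, Real.dist_eq, zero_sub, abs_neg]; rfl
    simp only [gsize, e0]
    rw [add_mul, one_mul]
    have h1 : |ModelClass.ar.w p x y θ| ≤ |y| + ∑ i, |θ i| * |x i| := by
      refine (abs_sub _ _).trans (add_le_add_right ((Finset.abs_sum_le_sum_abs _ _).trans_eq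
        (Finset.sum_congr rfl fun i _ => abs_mul _ _)) _)
    refine (ENNReal.ofReal_le_ofReal h1).trans ?_
    rw [ENNReal.ofReal_add (abs_nonneg _) (Finset.sum_nonneg fun i _ => by positivity)]
    refine add_le_add le_self_add ?_
    rw [ENNReal.ofReal_sum_of_nonneg fun i _ => by positivity, Finset.sum_mul]
    refine Finset.sum_le_sum fun i _ => ?_
    rw [ENNReal.ofReal_mul (abs_nonneg _)]
    refine mul_le_mul_right ?_ _
    exact (Finset.single_le_sum (f := fun i => ENNReal.ofReal |x i|) (fun _ _ => zero_le)
      (Finset.mem_univ i)).trans le_add_self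
  · obtain ⟨θ, rfl⟩ : ∃ θ' : Fin (p + 1) → ℝ, θ' = θ := ⟨θ, rfl⟩
    have h0 : 0 < θ 0 := hθ.1
    refine ⟨ENNReal.ofReal (θ 0)⁻¹, by simp, fun x y => ?_⟩
    refine le_trans ?_ (mul_le_mul_right (le_self_add : edist 0 (ModelClass.arch.gauge y) ≤ _) _)
    rw [edist_zero_gauge_arch y, ← ENNReal.ofReal_mul (by positivity), edist_dist, Real.dist_eq,
      zero_sub, abs_neg, gauge_arch_w hθ, abs_div, abs_gauge_arch]
    refine ENNReal.ofReal_le_ofReal ?_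
    have hle := le_archScale_sq hθ x
    rw [abs_of_pos (h0.trans_le hle), div_eq_inv_mul]
    gcongr

/-- The residuals depend continuously on the parameter, uniformly with respect to a dominating
family of functions decreasing to zero. -/
lemma exists_residual_modulus (M : ModelClass) {θ : Fin (M.dim p) → ℝ} (hθ : θ ∈ M.Θ p) :
    ∃ (r : ℕ → ℝ) (R : ℕ → (Fin p → ℝ) × ℝ → ℝ≥0∞) (C : ℝ≥0∞), (∀ k, 0 < r k) ∧
      (∀ k, Measurable (R k)) ∧ (∀ z, Tendsto (fun k => R k z) atTop (𝓝 0)) ∧ C ≠ ∞ ∧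
      (∀ k z, R k z ≤ C * gsize M z) ∧ ∀ k, ∀ θ' ∈ M.Θ p, (∀ i, |θ' i - θ i| < r k) → ∀ z,
        edist (M.gauge (M.w p z.1 z.2 θ')) (M.gauge (M.w p z.1 z.2 θ)) ≤ R k z := by
  cases M
  · refine ⟨fun k => 1 / ((k : ℝ) + 1), fun k z => ENNReal.ofReal ((∑ i, |z.1 i|) *
      (1 / ((k : ℝ) + 1))), 1, fun k => by positivity, fun k => by fun_prop, fun z => ?_, by simp,
      fun k z => ?_, fun k θ' _ h z => ?_⟩
    · have := (tendsto_one_div_add_atTop_nhds_zero_nat (𝕜 := ℝ)).const_mul (∑ i, |z.1 i|)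
      rw [mul_zero] at this
      simpa using ENNReal.tendsto_ofReal this
    · have e0 (u : ℝ) : edist 0 (ModelClass.ar.gauge u) = ENNReal.ofReal |u| := by
        rw [edist_dist, Real.dist_eq, zero_sub, abs_neg]; rfl
      simp only [gsize, e0, one_mul]
      rw [← ENNReal.ofReal_sum_of_nonneg fun i _ => abs_nonneg _]
      refine le_trans (ENNReal.ofReal_le_ofReal ?_) le_add_self
      refine mul_le_of_le_one_right (Finset.sum_nonneg fun i _ => abs_nonneg _) ?_
      rw [div_le_one (by positivity)]
      linarith [(k.cast_nonneg : (0 : ℝ) ≤ k)]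
    · rw [edist_dist, Real.dist_eq]
      refine ENNReal.ofReal_le_ofReal ?_
      change |(z.2 - ∑ i, θ' i * z.1 i) - (z.2 - ∑ i, θ i * z.1 i)| ≤ _
      have e : (z.2 - ∑ i, θ' i * z.1 i) - (z.2 - ∑ i, θ i * z.1 i) =
          -∑ i, z.1 i * (θ' i - θ i) := by
        rw [sub_sub_sub_cancel_left, ← Finset.sum_sub_distrib, ← Finset.sum_neg_distrib]
        exact Finset.sum_congr rfl fun i _ => by ring
      rw [e, abs_neg]
      exact abs_linear_le z.1 fun i => (h i).le
  · obtain ⟨θ, rfl⟩ : ∃ θ' : Fin (p + 1) → ℝ, θ' = θ := ⟨θ, rfl⟩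
    have h0 : 0 < θ 0 := hθ.1
    have hS (z : (Fin p → ℝ) × ℝ) : 0 ≤ ∑ i, z.1 i ^ 2 := Finset.sum_nonneg fun i _ => sq_nonneg _
    refine ⟨fun k => θ 0 / 2 * (1 / ((k : ℝ) + 1)), fun k z => ENNReal.ofReal (z.2 ^ 2 *
      min (2 / θ 0) (θ 0 / 2 * (1 / ((k : ℝ) + 1)) * (1 + ∑ i, z.1 i ^ 2) * (2 / θ 0 ^ 2))),
      ENNReal.ofReal (2 / θ 0), fun k => by positivity, fun k => by fun_prop, fun z => ?_, by simp,
      fun k z => ?_, fun k θ' hθ' h z => ?_⟩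
    · have h1 := (tendsto_one_div_add_atTop_nhds_zero_nat (𝕜 := ℝ)).const_mul (θ 0 / 2)
      have h2 := (h1.mul_const (1 + ∑ i, z.1 i ^ 2)).mul_const (2 / θ 0 ^ 2)
      have h3 := ((tendsto_const_nhds (x := 2 / θ 0)).min h2).const_mul (z.2 ^ 2)
      rw [mul_zero, zero_mul, zero_mul, min_eq_right (by positivity), mul_zero] at h3
      simpa only [ENNReal.ofReal_zero] using ENNReal.tendsto_ofReal h3
    · refine le_trans ?_ (mul_le_mul_right (le_self_add : edist 0 (ModelClass.arch.gauge z.2) ≤ _) _)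
      rw [edist_zero_gauge_arch, ← ENNReal.ofReal_mul (by positivity)]
      refine ENNReal.ofReal_le_ofReal ?_
      rw [mul_comm]
      exact mul_le_mul_of_nonneg_right (min_le_left _ _) (sq_nonneg _)
    · obtain ⟨θ', rfl⟩ : ∃ θ'' : Fin (p + 1) → ℝ, θ'' = θ' := ⟨θ', rfl⟩
      change ∀ i : Fin (p + 1), _ at h
      set r := θ 0 / 2 * (1 / ((k : ℝ) + 1)) with hr
      have hr2 : r ≤ θ 0 / 2 := by
        refine mul_le_of_le_one_right (by positivity) ?_
        rw [div_le_one (by positivity)]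
        linarith [(k.cast_nonneg : (0 : ℝ) ≤ k)]
      have h0' : θ 0 / 2 ≤ θ' 0 := by have := (abs_lt.1 (h 0)).1; linarith
      rw [edist_dist, Real.dist_eq, gauge_arch_w hθ', gauge_arch_w hθ]
      refine ENNReal.ofReal_le_ofReal ?_
      have hv := le_archScale_sq hθ z.1
      have hv' := le_archScale_sq hθ' z.1
      have hdiff : |(θ 0 + ∑ i : Fin p, θ i.succ * z.1 i ^ 2) -
          (θ' 0 + ∑ i : Fin p, θ' i.succ * z.1 i ^ 2)| ≤ r * (1 + ∑ i, z.1 i ^ 2) := by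
        have e : (θ 0 + ∑ i : Fin p, θ i.succ * z.1 i ^ 2) -
            (θ' 0 + ∑ i : Fin p, θ' i.succ * z.1 i ^ 2) =
            -((θ' 0 - θ 0) + ∑ i : Fin p, z.1 i ^ 2 * (θ' i.succ - θ i.succ)) := by
          have : ∑ i : Fin p, z.1 i ^ 2 * (θ' i.succ - θ i.succ) =
              ∑ i : Fin p, θ' i.succ * z.1 i ^ 2 - ∑ i : Fin p, θ i.succ * z.1 i ^ 2 := by
            rw [← Finset.sum_sub_distrib]
            exact Finset.sum_congr rfl fun i _ => by ring
          rw [this]; ring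
        rw [e, abs_neg, mul_add, mul_one, mul_comm r]
        refine (abs_add_le _ _).trans (add_le_add (h 0).le ?_)
        refine (abs_linear_le (fun i => z.1 i ^ 2) fun i => (h (Fin.succ i)).le).trans_eq ?_
        simp only [abs_pow, sq_abs, ← hr]
      generalize θ 0 + ∑ i : Fin p, θ i.succ * z.1 i ^ 2 = v at hv hdiff ⊢
      generalize θ' 0 + ∑ i : Fin p, θ' i.succ * z.1 i ^ 2 = v' at hv' hdiff ⊢
      have hvp : 0 < v := h0.trans_le hv
      have hv2 : θ 0 / 2 ≤ v' := h0'.trans hv'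
      have hvp' : 0 < v' := (half_pos h0).trans_le hv2
      rw [div_eq_mul_inv, div_eq_mul_inv, ← mul_sub, abs_mul, abs_gauge_arch]
      refine mul_le_mul_of_nonneg_left (le_min ?_ ?_) (sq_nonneg _)
      · have b1 : v⁻¹ ≤ 2 / θ 0 := by
          rw [← inv_div]; exact inv_anti₀ (half_pos h0) ((half_le_self h0.le).trans hv)
        have b2 : v'⁻¹ ≤ 2 / θ 0 := by rw [← inv_div]; exact inv_anti₀ (half_pos h0) hv2
        have p1 := inv_pos.2 hvp
        have p2 := inv_pos.2 hvp'
        rw [abs_le]; constructor <;> linarith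
      · rw [inv_sub_inv hvp'.ne' hvp.ne', abs_div, abs_of_pos (mul_pos hvp' hvp), div_eq_mul_inv]
        refine mul_le_mul hdiff ?_ (by positivity) (mul_nonneg (by positivity) (by positivity))
        rw [← inv_div]
        refine inv_anti₀ (by positivity) ?_
        calc θ 0 ^ 2 / 2 = θ 0 / 2 * θ 0 := by ring
          _ ≤ _ := mul_le_mul hv2 hv h0.le hvp'.le

lemma exists_residual_bound (M : ModelClass) {θ : Fin (M.dim p) → ℝ} (hθ : θ ∈ M.Θ p)
    {μ : Measure ((Fin p → ℝ) × ℝ)} (hμ : ∫⁻ z, gsize M z ∂μ ≠ ∞) {ρ : ℝ≥0∞} (hρ : ρ ≠ 0) :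
    ∃ (r : ℝ) (R : (Fin p → ℝ) × ℝ → ℝ≥0∞), 0 < r ∧ Measurable R ∧ ∫⁻ z, R z ∂μ ≤ ρ ∧
      ∀ θ' ∈ M.Θ p, (∀ i, |θ' i - θ i| < r) → ∀ z,
        edist (M.gauge (M.w p z.1 z.2 θ')) (M.gauge (M.w p z.1 z.2 θ)) ≤ R z := by
  obtain ⟨r, R, C, hr, hR, hlim, hC, hRC, h⟩ := exists_residual_modulus M hθ
  have ht := tendsto_lintegral_of_dominated_convergence (μ := μ) (fun z => C * gsize M z) hR
    (fun k => ae_of_all _ (hRC k))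
    (by rw [lintegral_const_mul _ (measurable_gsize M)]; exact ENNReal.mul_ne_top hC hμ)
    (ae_of_all _ hlim)
  rw [lintegral_zero] at ht
  obtain ⟨k, hk⟩ := (ENNReal.tendsto_nhds_zero.1 ht ρ (pos_iff_ne_zero.2 hρ)).exists
  exact ⟨r k, R k, hr k, hR k, hk, h k⟩

end residual

/-! ### The observed process -/

section process

variable {Ω : Type*} [MeasurableSpace Ω] {P : Measure Ω} [IsProbabilityMeasure P] {p : ℕ}
  {X ε : ℤ → Ω → ℝ}

lemma IsStationarySolution.isProbabilityMeasure_law {g : (Fin p → ℝ) → ℝ → ℝ} {F : Measure ℝ}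
    (hX : IsStationarySolution P p g F X ε) : IsProbabilityMeasure F := by
  rw [← hX.law_innov 0]
  exact Measure.isProbabilityMeasure_map (hX.measurable_innov 0).aemeasurable

lemma IsStationarySolution.measurePreserving_innov {g : (Fin p → ℝ) → ℝ → ℝ} {F : Measure ℝ}
    [IsProbabilityMeasure F] (hX : IsStationarySolution P p g F X ε) :
    MeasurePreserving (fun ω t => ε t ω) P (iid ℤ F) :=
  ⟨measurable_pi_iff.2 hX.measurable_innov,
    map_eq_iid hX.measurable_innov hX.indep_innov hX.law_innov⟩

lemma measurable_lags_prodMk (hX : ∀ t, Measurable (X t)) (t : ℤ) :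
    Measurable fun ω => (lags p X t ω, X t ω) :=
  (measurable_lags hX t).prodMk (hX t)

lemma lintegral_stationary (hX : ∀ t, Measurable (X t)) (hs : IsStationary P X)
    {f : (ℤ → ℝ) → ℝ≥0∞} (hf : Measurable f) (h : ℤ) :
    ∫⁻ ω, f (fun t => X (t + h) ω) ∂P = ∫⁻ ω, f (fun t => X t ω) ∂P := by
  rw [← lintegral_map hf (measurable_pi_iff.2 fun t => hX (t + h)), hs h,
    lintegral_map hf (measurable_pi_iff.2 hX)]

lemma lintegral_lags_eq (hX : ∀ t, Measurable (X t)) (hs : IsStationary P X)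
    {f : (Fin p → ℝ) × ℝ → ℝ≥0∞} (hf : Measurable f) (t : ℤ) :
    ∫⁻ ω, f (lags p X t ω, X t ω) ∂P = ∫⁻ ω, f (lags p X 0 ω, X 0 ω) ∂P := by
  have hm : Measurable fun x : ℤ → ℝ => f (fun i : Fin p => x (0 - 1 - (i : ℤ)), x 0) :=
    hf.comp ((measurable_pi_iff.2 fun i => measurable_pi_apply _).prodMk (measurable_pi_apply 0))
  have := lintegral_stationary hX hs hm t
  simp only [zero_add] at this
  rw [show (fun ω => f (lags p X 0 ω, X 0 ω)) =
    fun ω => f (fun i : Fin p => X (0 - 1 - (i : ℤ)) ω, X 0 ω) from rfl, ← this]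
  refine lintegral_congr fun ω => ?_
  congr 2
  ext i
  simp only [lags]
  congr 1; ring

lemma lintegral_mean_lags_le (hX : ∀ t, Measurable (X t)) (hs : IsStationary P X)
    {f : (Fin p → ℝ) × ℝ → ℝ≥0∞} (hf : Measurable f) (n : ℕ) :
    ∫⁻ ω, (n : ℝ≥0∞)⁻¹ * ∑ i : Fin n, f (lags p X ((i : ℤ) + 1) ω, X ((i : ℤ) + 1) ω) ∂P ≤
      ∫⁻ ω, f (lags p X 0 ω, X 0 ω) ∂P := by
  have hm (i : Fin n) : Measurable fun ω => f (lags p X ((i : ℤ) + 1) ω, X ((i : ℤ) + 1) ω) :=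
    hf.comp (measurable_lags_prodMk hX _)
  rw [lintegral_const_mul _ (Finset.measurable_sum _ fun i _ => hm i),
    lintegral_finsetSum _ fun i _ => hm i]
  simp only [lintegral_lags_eq hX hs hf, Finset.sum_const, Finset.card_univ, Fintype.card_fin,
    nsmul_eq_mul]
  rw [← mul_assoc]
  exact mul_le_of_le_one_left zero_le (ENNReal.inv_mul_le_one _)

variable {M : ModelClass} {θ θ' : Fin (M.dim p) → ℝ} {F : Measure ℝ}

lemma lintegral_gauge_process_ne_top [IsProbabilityMeasure F] (hθ : θ ∈ M.Θ p)
    (hF : MomentOK M F) (hX : IsStationarySolution P p (fun x e => M.G p x θ e) F X ε) (t : ℤ) :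
    ∫⁻ ω, edist 0 (M.gauge (X t ω)) ∂P ≠ ∞ := by
  have hT := gauge_isGauge M
  obtain ⟨Λ, h⟩ := exists_contracts M hθ hF
  have hm : Measurable fun a => edist 0 (M.gauge (out (fun x e => M.G p x θ e) a)) :=
    measurable_const.edist (hT.measurable.comp (measurable_out h.measurable_map))
  have hp := (measurePreserving_past (F := F) t).comp hX.measurePreserving_innov
  have e : ∫⁻ ω, edist 0 (M.gauge (X t ω)) ∂P =
      ∫⁻ a, edist 0 (M.gauge (out (fun x e => M.G p x θ e) a)) ∂iid ℕ F := by
    rw [← hp.map_eq, lintegral_map hm hp.measurable]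
    refine lintegral_congr_ae ?_
    filter_upwards [hX.ae_eq_out hT h] with ω hω
    rw [hω t]
    rfl
  rw [e]
  exact lintegral_out_ne_top M hθ hF

lemma lintegral_gsize_ne_top [IsProbabilityMeasure F] (hθ : θ ∈ M.Θ p)
    (hF : MomentOK M F) (hX : IsStationarySolution P p (fun x e => M.G p x θ e) F X ε) :
    ∫⁻ ω, gsize M (lags p X 0 ω, X 0 ω) ∂P ≠ ∞ := by
  have hm (t : ℤ) : Measurable fun ω => edist 0 (M.gauge (X t ω)) :=
    measurable_const.edist ((gauge_isGauge M).measurable.comp (hX.measurable_process t))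
  have h := lintegral_gauge_process_ne_top hθ hF hX
  simp only [gsize, lags]
  rw [lintegral_add_left (hm 0), lintegral_finsetSum _ fun i _ => hm _]
  exact ENNReal.add_ne_top.2 ⟨h 0, ENNReal.sum_ne_top.2 fun i _ => h _⟩

lemma measurable_residual (hX : ∀ t, Measurable (X t)) (t : ℤ) :
    Measurable fun ω => M.w p (lags p X t ω) (X t ω) θ' :=
  (measurable_w M θ').comp (measurable_lags_prodMk hX t)

lemma lintegral_gauge_residual_ne_top [IsProbabilityMeasure F] (hθ : θ ∈ M.Θ p)
    (hF : MomentOK M F) (hX : IsStationarySolution P p (fun x e => M.G p x θ e) F X ε)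
    (hθ' : θ' ∈ M.Θ p) :
    ∫⁻ ω, edist 0 (M.gauge (M.w p (lags p X 0 ω) (X 0 ω) θ')) ∂P ≠ ∞ := by
  obtain ⟨C, hC, h⟩ := exists_edist_gauge_w_le M hθ'
  have hm : Measurable fun ω => gsize M (lags p X 0 ω, X 0 ω) :=
    (measurable_gsize M).comp (measurable_lags_prodMk hX.measurable_process 0)
  refine ne_top_of_le_ne_top ?_ (lintegral_mono fun ω => h _ _)
  rw [lintegral_const_mul _ hm]
  exact ENNReal.mul_ne_top hC (lintegral_gsize_ne_top hθ hF hX)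

lemma isProbabilityMeasure_residualLaw (hX : ∀ t, Measurable (X t)) :
    IsProbabilityMeasure (residualLaw p M P X θ') :=
  Measure.isProbabilityMeasure_map (measurable_residual hX 0).aemeasurable

lemma momentOK_residualLaw [IsProbabilityMeasure F] (hθ : θ ∈ M.Θ p)
    (hF : MomentOK M F) (hX : IsStationarySolution P p (fun x e => M.G p x θ e) F X ε)
    (hθ' : θ' ∈ M.Θ p)
    (hunit : M = .arch → ∫ x, x ^ 2 ∂residualLaw p M P X θ' = 1) :
    MomentOK M (residualLaw p M P X θ') := by
  refine ⟨?_, fun h => (lintegral_sq_eq_one (hunit h)).le⟩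
  have hm : Measurable fun x => edist 0 (M.gauge x) :=
    measurable_const.edist (gauge_isGauge M).measurable
  rw [residualLaw, lintegral_map hm (measurable_residual hX.measurable_process 0)]
  exact lintegral_gauge_residual_ne_top hθ hF hX hθ'

/-- Convergence of the empirical distribution of the residuals belonging to a fixed parameter. -/
lemma tendsto_measure_w1_residuals [IsProbabilityMeasure F] (hθ : θ ∈ M.Θ p)
    (hF : MomentOK M F) (hX : IsStationarySolution P p (fun x e => M.G p x θ e) F X ε)
    (hθ' : θ' ∈ M.Θ p) {γ : ℝ≥0∞} (hγ : γ ≠ 0) :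
    Tendsto (fun n : ℕ => P {ω | γ ≤ w1 (empirical fun i => M.gauge (residuals p M X n θ' ω i))
      ((residualLaw p M P X θ').map M.gauge)}) atTop (𝓝 0) := by
  have hT := gauge_isGauge M
  obtain ⟨Λ, h⟩ := exists_contracts M hθ hF
  set g : (Fin p → ℝ) → ℝ → ℝ := fun x e => M.G p x θ e
  have mo := measurable_out_past h.measurable_map
  have hH : Measurable fun a : ℤ → ℝ => M.gauge
      (M.w p (fun i : Fin p => out g (past a (0 - 1 - (i : ℤ)))) (out g (past a 0)) θ') :=
    hT.measurable.comp ((measurable_w M θ').comp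
      ((measurable_pi_iff.2 fun i => mo _).prodMk (mo 0)))
  have := tendsto_measure_w1 hX.measurePreserving_innov
    (Y := fun t ω => M.gauge (M.w p (lags p X t ω) (X t ω) θ')) hH ?_ ?_ hγ
  · rw [residualLaw, Measure.map_map hT.measurable (measurable_residual hX.measurable_process 0)]
    exact this
  · filter_upwards [hX.ae_eq_out hT h] with ω hω t
    have hl : lags p X t ω = fun i : Fin p =>
        out g (past (shift t fun s => ε s ω) (0 - 1 - (i : ℤ))) := by
      ext i
      rw [lags, hω, past_shift]
      congr 2; ring
    rw [hl, past_shift, zero_add, hω t]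
  · simp only [edist_comm _ (0 : ℝ)]
    exact lintegral_gauge_residual_ne_top hθ hF hX hθ'

lemma integrable_of_lintegral_edist {f : Ω → ℝ} (hf : Measurable f)
    (h : ∫⁻ ω, edist 0 (f ω) ∂P ≠ ∞) : Integrable f P := by
  refine ⟨hf.aestronglyMeasurable, ?_⟩
  rw [hasFiniteIntegral_iff_edist]
  simpa only [edist_comm] using h.lt_top

lemma integral_id_map {Ω' : Type*} [MeasurableSpace Ω'] {μ : Measure Ω'} {f : Ω' → ℝ}
    (hf : Measurable f) : ∫ x, x ∂μ.map f = ∫ ω, f ω ∂μ :=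
  integral_map hf.aemeasurable measurable_id.aestronglyMeasurable

lemma integral_residual_ar {θ θ' : Fin p → ℝ} [IsProbabilityMeasure F]
    (hθ : θ ∈ ModelClass.ar.Θ p) (hF : MomentOK .ar F)
    (hX : IsStationarySolution P p (fun x e => ModelClass.ar.G p x θ e) F X ε)
    (h0 : ∫ x, x ∂F = 0) :
    ∫ ω, ModelClass.ar.w p (lags p X 0 ω) (X 0 ω) θ' ∂P = 0 := by
  have hi (t : ℤ) : Integrable (X t) P := integrable_of_lintegral_edist (hX.measurable_process t)
    (lintegral_gauge_process_ne_top (M := .ar) hθ hF hX t)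
  have hE (t : ℤ) : ∫ ω, X t ω ∂P = ∫ ω, X 0 ω ∂P := by
    have := congrArg (Measure.map fun x : ℤ → ℝ => x 0) (hX.stationary t)
    rw [Measure.map_map (by fun_prop) (measurable_pi_iff.2 fun s => hX.measurable_process _),
      Measure.map_map (by fun_prop) (measurable_pi_iff.2 hX.measurable_process)] at this
    have h2 := congrArg (fun μ : Measure ℝ => ∫ x, x ∂μ) this
    simp only [Function.comp_def, zero_add] at h2
    rwa [integral_id_map (hX.measurable_process t), integral_id_map (hX.measurable_process 0)] at h2
  have hw (θ : Fin p → ℝ) : ∫ ω, ModelClass.ar.w p (lags p X 0 ω) (X 0 ω) θ ∂P =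
      (1 - ∑ i, θ i) * ∫ ω, X 0 ω ∂P := by
    change ∫ ω, X 0 ω - ∑ i, θ i * X (0 - 1 - (i : ℤ)) ω ∂P = _
    rw [integral_sub (hi 0) (integrable_finsetSum _ fun i _ => (hi _).const_mul _),
      integral_finsetSum _ fun i _ => (hi _).const_mul _]
    simp only [integral_const_mul, hE (0 - 1 - _)]
    rw [← Finset.sum_mul]; ring
  have hε : ∫ ω, ModelClass.ar.w p (lags p X 0 ω) (X 0 ω) θ ∂P = 0 := by
    rw [← h0, ← hX.law_innov 0, integral_id_map (hX.measurable_innov 0)]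
    refine integral_congr_ae ?_
    filter_upwards [hX.equation 0] with ω hω
    change X 0 ω - ∑ i, θ i * lags p X 0 ω i = ε 0 ω
    rw [hω]
    exact add_sub_cancel_left _ _
  have hne : 1 - ∑ i, θ i ≠ 0 := by
    have := hθ 1 (by simp)
    simp only [one_pow, mul_one] at this
    exact_mod_cast this
  rw [hw] at hε ⊢
  rw [(mul_eq_zero.1 hε).resolve_left hne, mul_zero]

lemma integral_residual_arch {θ θ' : Fin (p + 1) → ℝ} [IsProbabilityMeasure F]
    (hθ : θ ∈ ModelClass.arch.Θ p) (hF : MomentOK .arch F)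
    (hX : IsStationarySolution P p (fun x e => ModelClass.arch.G p x θ e) F X ε)
    (h0 : ∫ x, x ∂F = 0) :
    ∫ ω, ModelClass.arch.w p (lags p X 0 ω) (X 0 ω) θ' ∂P = 0 := by
  have hT := gauge_isGauge .arch
  obtain ⟨Λ, h⟩ := exists_contracts .arch hθ hF
  set g : (Fin p → ℝ) → ℝ → ℝ := fun x e => ModelClass.arch.G p x θ e
  let ratio (x : Fin p → ℝ) : ℝ := ModelClass.archScale x θ / ModelClass.archScale x θ'
  have mr : Measurable ratio := (measurable_archScale θ).div (measurable_archScale θ')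
  have mo := measurable_out_past h.measurable_map
  let A (a : ℤ → ℝ) : ℝ := ratio fun i : Fin p => out g (past a (0 - 1 - (i : ℤ)))
  have mA : Measurable A := mr.comp (measurable_pi_iff.2 fun i => mo _)
  have hA : DependsOn A (Set.Iic (-1)) := fun a b hab => by
    refine congrArg ratio (funext fun i => dependsOn_out_past _ fun j hj => hab j ?_)
    have hj := Set.mem_Iic.1 hj
    exact Set.mem_Iic.2 (by omega)
  have hB : DependsOn (fun a : ℤ → ℝ => a 0) {0} := fun a b hab => hab 0 rfl
  have hind := indepFun_of_dependsOn (F := F) mA (measurable_pi_apply 0) hA hB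
    (Set.disjoint_singleton_right.2 (by simp))
  have hp := hX.measurePreserving_innov
  have m0 : Measurable fun a : ℤ → ℝ => a 0 := measurable_pi_apply 0
  calc ∫ ω, ModelClass.arch.w p (lags p X 0 ω) (X 0 ω) θ' ∂P
      = ∫ ω, A (fun t => ε t ω) * ε 0 ω ∂P := by
        refine integral_congr_ae ?_
        filter_upwards [hX.ae_eq_out hT h, hX.equation 0] with ω hω hω0
        have hl : lags p X 0 ω = fun i : Fin p =>
          out g (past (fun s => ε s ω) (0 - 1 - (i : ℤ))) := funext fun i => hω _
        change X 0 ω / ModelClass.archScale (lags p X 0 ω) θ' = _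
        rw [hω0]
        change ModelClass.archScale (lags p X 0 ω) θ * ε 0 ω / _ = _
        rw [hl, mul_div_right_comm]
    _ = ∫ a, A a * a 0 ∂iid ℤ F := by
        rw [← hp.map_eq, integral_map (f := fun a => A a * a 0) hp.measurable.aemeasurable
          (mA.mul m0).aestronglyMeasurable]
    _ = 0 := by
        rw [hind.integral_fun_mul_eq_mul_integral mA.aestronglyMeasurable m0.aestronglyMeasurable]
        have : ∫ a : ℤ → ℝ, a 0 ∂iid ℤ F = 0 := by
          rw [← integral_id_map m0, (measurePreserving_eval_iid (F := F) (0 : ℤ)).map_eq, h0]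
        rw [this, mul_zero]

lemma integral_residualLaw (hθ : θ ∈ M.Θ p) (hF : M.InnovationMoments F)
    (hX : IsStationarySolution P p (fun x e => M.G p x θ e) F X ε) :
    ∫ x, x ∂residualLaw p M P X θ' = 0 := by
  have := hX.isProbabilityMeasure_law
  have hm := momentOK_of_innovationMoments hF
  rw [residualLaw, integral_id_map (measurable_residual hX.measurable_process 0)]
  cases M
  · exact integral_residual_ar hθ hm hX hF.1
  · exact integral_residual_arch hθ hm hX hF.1

end process

/-! ### Coupling and adjusting the residuals -/

section adjusting

lemma exists_coupling_gauge {T : ℝ → ℝ} (hT : Gauge T) (F' F : Measure ℝ) [IsProbabilityMeasure F']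
    [IsProbabilityMeasure F] : ∃ π : Measure (ℝ × ℝ), IsProbabilityMeasure π ∧
      π.map Prod.fst = F' ∧ π.map Prod.snd = F ∧
      ∫⁻ z, edist (T z.1) (T z.2) ∂π ≤ w1 (F'.map T) (F.map T) := by
  have mT := hT.measurable
  have hE := mT.measurableEmbedding hT.injective
  set S := hE.invFun
  have mS : Measurable S := hE.measurable_invFun
  have hST (x : ℝ) : S (T x) = x := hE.leftInverse_invFun x
  have := Measure.isProbabilityMeasure_map (μ := F) mT.aemeasurable
  have := Measure.isProbabilityMeasure_map (μ := F') mT.aemeasurable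
  obtain ⟨π, h1, h2, h⟩ := exists_coupling_le_w1 (F'.map T) (F.map T)
  have mSS : Measurable fun z : ℝ × ℝ => (S z.1, S z.2) :=
    (mS.comp measurable_fst).prodMk (mS.comp measurable_snd)
  have hback (G : Measure ℝ) : (G.map T).map S = G := by
    rw [Measure.map_map mS mT, show S ∘ T = id from funext hST, Measure.map_id]
  have e1 : (π.map fun z => (S z.1, S z.2)).map Prod.fst = F' := by
    rw [Measure.map_map measurable_fst mSS, ← hback F', ← h1, Measure.map_map mS measurable_fst]
    rfl
  have e2 : (π.map fun z => (S z.1, S z.2)).map Prod.snd = F := by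
    rw [Measure.map_map measurable_snd mSS, ← hback F, ← h2, Measure.map_map mS measurable_snd]
    rfl
  have hae (G : Measure ℝ) : ∀ᵐ x ∂G.map T, T (S x) = x :=
    (ae_map_iff mT.aemeasurable (measurableSet_eq_fun (mT.comp mS) measurable_id)).2
      (ae_of_all _ fun x => congrArg T (hST x))
  have a1 : ∀ᵐ z ∂π, T (S z.1) = z.1 :=
    ae_of_ae_map measurable_fst.aemeasurable (h1 ▸ hae F')
  have a2 : ∀ᵐ z ∂π, T (S z.2) = z.2 :=
    ae_of_ae_map measurable_snd.aemeasurable (h2 ▸ hae F)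
  refine ⟨_, ⟨?_⟩, e1, e2, ?_⟩
  · have := congrArg (fun μ : Measure ℝ => μ Set.univ) e1
    rw [Measure.map_apply measurable_fst MeasurableSet.univ, Set.preimage_univ] at this
    rw [this, measure_univ]
  · have mI : Measurable fun z : ℝ × ℝ => edist (T z.1) (T z.2) :=
      (mT.comp measurable_fst).edist (mT.comp measurable_snd)
    rw [lintegral_map mI mSS]
    refine le_trans (le_of_eq (lintegral_congr_ae ?_)) h
    filter_upwards [a1, a2] with z h1 h2
    simp only [h1, h2]

lemma edist_integral_le_coupling {π : Measure (ℝ × ℝ)} {μ ν : Measure ℝ} (h1 : π.map Prod.fst = μ)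
    (h2 : π.map Prod.snd = ν) {f : ℝ → ℝ} (hf : Measurable f) (hμ : Integrable f μ)
    (hν : Integrable f ν) :
    edist (∫ x, f x ∂μ) (∫ x, f x ∂ν) ≤ ∫⁻ z, edist (f z.1) (f z.2) ∂π := by
  subst h1 h2
  have i1 : Integrable (fun z : ℝ × ℝ => f z.1) π :=
    (integrable_map_measure hf.aestronglyMeasurable measurable_fst.aemeasurable).1 hμ
  have i2 : Integrable (fun z : ℝ × ℝ => f z.2) π :=
    (integrable_map_measure hf.aestronglyMeasurable measurable_snd.aemeasurable).1 hν
  rw [integral_map measurable_fst.aemeasurable hf.aestronglyMeasurable,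
    integral_map measurable_snd.aemeasurable hf.aestronglyMeasurable, edist_eq_enorm_sub,
    ← integral_sub i1 i2]
  refine (enorm_integral_le_lintegral_enorm _).trans_eq ?_
  simp only [edist_eq_enorm_sub]

variable {n : ℕ}

lemma integrable_empirical [NeZero n] (a : Fin n → ℝ) (f : ℝ → ℝ) : Integrable f (empirical a) := by
  refine Integrable.smul_measure (integrable_finsetSum_measure.2 fun i _ => ?_)
    (ENNReal.inv_ne_top.2 (Nat.cast_ne_zero.2 (NeZero.ne n)))
  exact integrable_dirac (by simp)

lemma integral_empirical [NeZero n] (a : Fin n → ℝ) (f : ℝ → ℝ) :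
    ∫ x, f x ∂empirical a = (n : ℝ)⁻¹ * ∑ i, f (a i) := by
  rw [empirical, integral_smul_measure, integral_finsetSum_measure fun i _ =>
    integrable_dirac (by simp)]
  simp

lemma lintegral_ofReal_empirical [NeZero n] (a : Fin n → ℝ) {f : ℝ → ℝ} (hf : ∀ x, 0 ≤ f x) :
    ∫⁻ x, ENNReal.ofReal (f x) ∂empirical a = ENNReal.ofReal ((n : ℝ)⁻¹ * ∑ i, f (a i)) := by
  rw [← integral_empirical, ofReal_integral_eq_lintegral_ofReal (integrable_empirical a f)
    (ae_of_all _ hf)]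

lemma mean_edist_eq [NeZero n] (a b : Fin n → ℝ) : (n : ℝ≥0∞)⁻¹ * ∑ i, edist (a i) (b i) =
    ENNReal.ofReal ((n : ℝ)⁻¹ * ∑ i, |a i - b i|) := by
  have hn : (0 : ℝ) < n := Nat.cast_pos.2 (NeZero.pos n)
  rw [ENNReal.ofReal_mul (by positivity), ENNReal.ofReal_inv_of_pos hn, ENNReal.ofReal_natCast,
    ENNReal.ofReal_sum_of_nonneg fun i _ => abs_nonneg _]
  simp only [edist_dist, Real.dist_eq]

lemma momentOK_empirical_adjust [NeZero n] (M : ModelClass) (a : Fin n → ℝ) :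
    MomentOK M (empirical (M.adjust a)) := by
  cases M
  · refine ⟨?_, fun h => by cases h⟩
    rw [lintegral_empirical]
    exact ENNReal.mul_ne_top (ENNReal.inv_ne_top.2 (Nat.cast_ne_zero.2 (NeZero.ne n)))
      (ENNReal.sum_ne_top.2 fun i _ => edist_ne_top _ _)
  · refine momentOK_arch ?_
    rw [lintegral_ofReal_empirical _ fun x => sq_nonneg x]
    refine ENNReal.ofReal_le_one.2 ?_
    change (n : ℝ)⁻¹ * ∑ i, (center a i / √((n : ℝ)⁻¹ * ∑ s, center a s ^ 2)) ^ 2 ≤ 1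
    have h0 : 0 ≤ (n : ℝ)⁻¹ * ∑ s, center a s ^ 2 :=
      mul_nonneg (by positivity) (Finset.sum_nonneg fun i _ => sq_nonneg _)
    simp only [div_pow, Real.sq_sqrt h0]
    rw [← Finset.sum_div, ← mul_div_assoc]
    exact div_self_le_one _

lemma abs_gauge_arch_sub_le (x y : ℝ) :
    |ModelClass.arch.gauge x - ModelClass.arch.gauge y| ≤ (abs x + abs y) * |x - y| := by
  change |x * abs x - y * abs y| ≤ _
  have e : x * abs x - y * abs y = (x - y) * abs x + y * (abs x - abs y) := by ring
  rw [e]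
  refine (abs_add_le _ _).trans ?_
  rw [abs_mul, abs_mul, abs_abs]
  have := mul_le_mul_of_nonneg_left (abs_abs_sub_abs_le_abs_sub x y) (abs_nonneg y)
  linarith [mul_comm (|x - y|) (abs x)]

lemma mean_sq_center [NeZero n] (a : Fin n → ℝ) : (n : ℝ)⁻¹ * ∑ i, center a i ^ 2 =
    (n : ℝ)⁻¹ * ∑ i, a i ^ 2 - ((n : ℝ)⁻¹ * ∑ i, a i) ^ 2 := by
  have hn : (n : ℝ) ≠ 0 := Nat.cast_ne_zero.2 (NeZero.ne n)
  simp only [center]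
  set m := (n : ℝ)⁻¹ * ∑ i, a i with hm
  have hs : ∑ i, a i = n * m := by rw [hm, mul_inv_cancel_left₀ hn]
  have : ∑ i, (a i - m) ^ 2 = ∑ i, a i ^ 2 - n * m ^ 2 := by
    calc ∑ i, (a i - m) ^ 2 = ∑ i, (a i ^ 2 - 2 * m * a i + m ^ 2) :=
          Finset.sum_congr rfl fun i _ => by ring
      _ = _ := by
          rw [Finset.sum_add_distrib, Finset.sum_sub_distrib, ← Finset.mul_sum, hs]
          simp; ring
  rw [this, mul_sub, inv_mul_cancel_left₀ hn]

lemma mean_abs_gauge_center_le [NeZero n] (a : Fin n → ℝ) {m : ℝ} (hm : (n : ℝ)⁻¹ * ∑ i, a i = m) :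
    (n : ℝ)⁻¹ * ∑ i, |ModelClass.arch.gauge (center a i) - ModelClass.arch.gauge (a i)| ≤
      |m| * ((n : ℝ)⁻¹ * ∑ i, a i ^ 2 + 1) + m ^ 2 := by
  have hn : (n : ℝ) ≠ 0 := Nat.cast_ne_zero.2 (NeZero.ne n)
  have hpt (i : Fin n) : |ModelClass.arch.gauge (center a i) - ModelClass.arch.gauge (a i)| ≤
      |m| * a i ^ 2 + (|m| + m ^ 2) := by
    refine (abs_gauge_arch_sub_le _ _).trans ?_
    have h1 : center a i = a i - m := by rw [center, hm]
    rw [h1, sub_sub_cancel_left, abs_neg]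
    have h2 : |a i - m| ≤ |a i| + |m| := abs_sub _ _
    have h3 : 2 * |a i| ≤ a i ^ 2 + 1 := by
      rw [← sq_abs]; nlinarith [sq_nonneg (|a i| - 1)]
    rw [← sq_abs m]
    nlinarith [abs_nonneg m]
  calc _ ≤ (n : ℝ)⁻¹ * ∑ i, (|m| * a i ^ 2 + (|m| + m ^ 2)) := by
        gcongr with i; exact hpt i
    _ = _ := by
        rw [Finset.sum_add_distrib, ← Finset.mul_sum, mul_add]
        simp only [Finset.sum_const, Finset.card_univ, Fintype.card_fin, nsmul_eq_mul]
        rw [inv_mul_cancel_left₀ hn]; ring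

lemma mean_abs_gauge_rescale [NeZero n] (c : Fin n → ℝ) {v : ℝ}
    (hv : (n : ℝ)⁻¹ * ∑ i, c i ^ 2 = v) (hpos : 0 < v) :
    (n : ℝ)⁻¹ * ∑ i, |ModelClass.arch.gauge (rescale c i) - ModelClass.arch.gauge (c i)| =
      |1 - v| := by
  have hpt (i : Fin n) : |ModelClass.arch.gauge (rescale c i) - ModelClass.arch.gauge (c i)| =
      |v⁻¹ - 1| * c i ^ 2 := by
    rw [← abs_gauge_arch, ← abs_mul]
    congr 1
    change c i / √((n : ℝ)⁻¹ * ∑ s, c s ^ 2) * |c i / √((n : ℝ)⁻¹ * ∑ s, c s ^ 2)| -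
      c i * |c i| = (v⁻¹ - 1) * (c i * |c i|)
    rw [hv, abs_div, abs_of_nonneg (Real.sqrt_nonneg v), div_mul_div_comm,
      Real.mul_self_sqrt hpos.le]
    ring
  simp only [hpt]
  rw [← Finset.mul_sum, mul_left_comm, hv]
  nth_rewrite 2 [← abs_of_pos hpos]
  rw [← abs_mul, sub_mul, inv_mul_cancel₀ hpos.ne', one_mul]

lemma mean_abs_gauge_adjust_arch_le [NeZero n] (a : Fin n → ℝ) {t : ℝ} (ht : t ≤ 1 / 8)
    (hm : |(n : ℝ)⁻¹ * ∑ i, a i| ≤ t) (hq : |(n : ℝ)⁻¹ * ∑ i, a i ^ 2 - 1| ≤ t) :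
    (n : ℝ)⁻¹ * ∑ i, |ModelClass.arch.gauge (ModelClass.arch.adjust a i) -
      ModelClass.arch.gauge (a i)| ≤ 6 * t := by
  have hv := mean_sq_center a
  have hc := mean_abs_gauge_center_le a rfl
  set m := (n : ℝ)⁻¹ * ∑ i, a i
  set q := (n : ℝ)⁻¹ * ∑ i, a i ^ 2
  have hm0 := abs_nonneg m
  have hm2 : m ^ 2 ≤ t * |m| := by rw [← sq_abs, sq]; gcongr
  have hq' := abs_le.1 hq
  have hpos : 0 < q - m ^ 2 := by nlinarith
  have hr := mean_abs_gauge_rescale (center a) hv hpos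
  have habs : |1 - (q - m ^ 2)| ≤ t + m ^ 2 := by
    rw [abs_le]; constructor <;> nlinarith [sq_nonneg m]
  calc _ ≤ (n : ℝ)⁻¹ * ∑ i, (|ModelClass.arch.gauge (rescale (center a) i) -
          ModelClass.arch.gauge (center a i)| +
          |ModelClass.arch.gauge (center a i) - ModelClass.arch.gauge (a i)|) := by
        gcongr with i
        exact abs_sub_le _ _ _
    _ ≤ (t + m ^ 2) + (|m| * (q + 1) + m ^ 2) := by
        rw [Finset.sum_add_distrib, mul_add, hr]
        exact add_le_add habs hc
    _ ≤ 6 * t := by nlinarith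

lemma abs_sub_le_add_gauge_arch (x y : ℝ) {s : ℝ} (hs : 0 < s) :
    |x - y| ≤ s + 2 / s * |ModelClass.arch.gauge x - ModelClass.arch.gauge y| := by
  have h := sq_sub_le_signed_sq x y
  change (x - y) ^ 2 ≤ 2 * |ModelClass.arch.gauge x - ModelClass.arch.gauge y| at h
  generalize |ModelClass.arch.gauge x - ModelClass.arch.gauge y| = u at h ⊢
  have e : s + 2 / s * u = (s ^ 2 + 2 * u) / s := by field_simp
  rw [e, le_div_iff₀ hs]
  rw [← sq_abs] at h
  nlinarith [sq_nonneg (|x - y| - s), sq_nonneg (|x - y|)]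

lemma exists_w1_adjust_arch_lt {F : Measure ℝ} [IsProbabilityMeasure F] (h0 : ∫ x, x ∂F = 0)
    (h1 : ∫ x, x ^ 2 ∂F = 1) {η : ℝ≥0∞} (hη : η ≠ 0) :
    ∃ γ : ℝ≥0∞, γ ≠ 0 ∧ ∀ (n : ℕ) [NeZero n] (a : Fin n → ℝ),
      w1 (empirical fun i => ModelClass.arch.gauge (a i)) (F.map ModelClass.arch.gauge) < γ →
      w1 (empirical fun i => ModelClass.arch.gauge (ModelClass.arch.adjust a i))
        (F.map ModelClass.arch.gauge) < η := by
  have hT := gauge_isGauge .arch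
  have hi2 : Integrable (fun x : ℝ => x ^ 2) F := integrable_of_integral_eq_one h1
  have hi1 : Integrable (fun x : ℝ => x) F := by
    refine (hi2.add (integrable_const (1 : ℝ))).mono' measurable_id.aestronglyMeasurable
      (ae_of_all _ fun x => ?_)
    change |x| ≤ x ^ 2 + 1
    rw [← sq_abs]; nlinarith [sq_nonneg (|x| - 1), abs_nonneg x]
  set u := (min η 1).toReal with hu
  have hfin : min η 1 ≠ ∞ := ne_top_of_le_ne_top ENNReal.one_ne_top (min_le_right _ _)
  have hupos : 0 < u := ENNReal.toReal_pos (by simp [hη]) hfin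
  have hu1 : u ≤ 1 := ENNReal.toReal_le_of_le_ofReal zero_le_one (by simp)
  have huη : ENNReal.ofReal u ≤ η := by rw [hu, ENNReal.ofReal_toReal hfin]; exact min_le_left _ _
  set t := u / 8 with ht
  have htpos : 0 < t := by positivity
  have ht8 : t ≤ 1 / 8 := by rw [ht]; linarith
  refine ⟨ENNReal.ofReal (t ^ 2 / 8), by simp only [ne_eq, ENNReal.ofReal_eq_zero, not_le]; positivity,
    fun n _ a hW => ?_⟩
  rw [← empirical_map hT.measurable] at hW
  obtain ⟨π, hπ, hπ1, hπ2, hle⟩ := exists_coupling_gauge hT (empirical a) F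
  set I := ∫⁻ z, edist (ModelClass.arch.gauge z.1) (ModelClass.arch.gauge z.2) ∂π
  have hI : I ≤ ENNReal.ofReal (t ^ 2 / 8) := hle.trans hW.le
  have mI : Measurable fun z : ℝ × ℝ =>
      edist (ModelClass.arch.gauge z.1) (ModelClass.arch.gauge z.2) :=
    (hT.measurable.comp measurable_fst).edist (hT.measurable.comp measurable_snd)
  have hq : |(n : ℝ)⁻¹ * ∑ i, a i ^ 2 - 1| ≤ t := by
    have := edist_integral_le_coupling hπ1 hπ2 (f := fun x => x ^ 2) (by fun_prop)
      (integrable_empirical a _) hi2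
    rw [integral_empirical, h1, edist_dist, Real.dist_eq] at this
    refine (ENNReal.ofReal_le_ofReal_iff htpos.le).1 (this.trans ((lintegral_mono fun z => ?_).trans
      (hI.trans (ENNReal.ofReal_le_ofReal (by nlinarith)))))
    rw [edist_dist, edist_dist, Real.dist_eq, Real.dist_eq, ← abs_gauge_arch, ← abs_gauge_arch]
    exact ENNReal.ofReal_le_ofReal (abs_abs_sub_abs_le_abs_sub _ _)
  have hm : |(n : ℝ)⁻¹ * ∑ i, a i| ≤ t := by
    have := edist_integral_le_coupling hπ1 hπ2 (f := fun x => x) measurable_id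
      (integrable_empirical a _) hi1
    rw [integral_empirical, h0, edist_dist, Real.dist_eq, sub_zero] at this
    refine (ENNReal.ofReal_le_ofReal_iff htpos.le).1 (this.trans ?_)
    calc _ ≤ ∫⁻ z, (ENNReal.ofReal (t / 2) + ENNReal.ofReal (2 / (t / 2)) *
          edist (ModelClass.arch.gauge z.1) (ModelClass.arch.gauge z.2)) ∂π := by
          refine lintegral_mono fun z => ?_
          rw [edist_dist, edist_dist, Real.dist_eq, Real.dist_eq, ← ENNReal.ofReal_mul (by positivity),
            ← ENNReal.ofReal_add (by positivity) (by positivity)]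
          exact ENNReal.ofReal_le_ofReal (abs_sub_le_add_gauge_arch _ _ (by positivity))
      _ ≤ ENNReal.ofReal (t / 2) + ENNReal.ofReal (2 / (t / 2)) * ENNReal.ofReal (t ^ 2 / 8) := by
          rw [lintegral_add_left measurable_const, lintegral_const, measure_univ, mul_one,
            lintegral_const_mul _ mI]
          gcongr
      _ = ENNReal.ofReal t := by
          rw [← ENNReal.ofReal_mul (by positivity), ← ENNReal.ofReal_add (by positivity)
            (by positivity)]
          congr 1
          field_simp; ring
  rw [empirical_map hT.measurable] at hW
  calc _ ≤ w1 (empirical fun i => ModelClass.arch.gauge (ModelClass.arch.adjust a i))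
          (empirical fun i => ModelClass.arch.gauge (a i)) + w1 _ _ := w1_triangle _ _ _
    _ ≤ ENNReal.ofReal (6 * t) + ENNReal.ofReal (t ^ 2 / 8) := by
        refine add_le_add ((w1_empirical_le _ _).trans ?_) hW.le
        rw [mean_edist_eq]
        exact ENNReal.ofReal_le_ofReal (mean_abs_gauge_adjust_arch_le a ht8 hm hq)
    _ < ENNReal.ofReal u := by
        rw [← ENNReal.ofReal_add (by positivity) (by positivity)]
        exact (ENNReal.ofReal_lt_ofReal_iff hupos).2 (by nlinarith)
    _ ≤ η := huη

lemma exists_w1_adjust_ar_lt {F : Measure ℝ} [IsProbabilityMeasure F] (hF : MomentOK .ar F)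
    (h0 : ∫ x, x ∂F = 0) {η : ℝ≥0∞} (hη : η ≠ 0) :
    ∃ γ : ℝ≥0∞, γ ≠ 0 ∧ ∀ (n : ℕ) [NeZero n] (a : Fin n → ℝ),
      w1 (empirical fun i => ModelClass.ar.gauge (a i)) (F.map ModelClass.ar.gauge) < γ →
      w1 (empirical fun i => ModelClass.ar.gauge (ModelClass.ar.adjust a i))
        (F.map ModelClass.ar.gauge) < η := by
  have hi : Integrable (fun x : ℝ => x) F := integrable_of_lintegral_edist measurable_id hF.1
  refine ⟨η / 2, by simp [hη], fun n _ a hW => ?_⟩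
  obtain ⟨π, hπ, hπ1, hπ2, hle⟩ := exists_coupling_gauge (gauge_isGauge .ar) (empirical a) F
  rw [empirical_map (gauge_isGauge .ar).measurable] at hle
  have hm := (edist_integral_le_coupling hπ1 hπ2 (f := fun x => x) measurable_id
    (integrable_empirical a _) hi).trans hle
  rw [integral_empirical, h0, edist_dist, Real.dist_eq, sub_zero] at hm
  refine (w1_triangle _ (empirical fun i => ModelClass.ar.gauge (a i)) _).trans_lt ?_
  rw [← ENNReal.add_halves η]
  refine ENNReal.add_lt_add (lt_of_le_of_lt ((w1_empirical_le _ _).trans ?_) hW) hW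
  refine le_trans (le_of_eq ?_) hm
  have hn : (n : ℝ) ≠ 0 := Nat.cast_ne_zero.2 (NeZero.ne n)
  rw [mean_edist_eq]
  congr 1
  change (n : ℝ)⁻¹ * ∑ i, |(a i - (n : ℝ)⁻¹ * ∑ s, a s) - a i| = _
  simp only [sub_sub_cancel_left, abs_neg, Finset.sum_const, Finset.card_univ, Fintype.card_fin,
    nsmul_eq_mul]
  rw [inv_mul_cancel_left₀ hn]

/-- Centering and rescaling do not destroy closeness to a standardised law. -/
lemma exists_w1_adjust_lt (M : ModelClass) {F : Measure ℝ} [IsProbabilityMeasure F]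
    (hF : MomentOK M F) (h0 : ∫ x, x ∂F = 0) (h1 : M = .arch → ∫ x, x ^ 2 ∂F = 1) {η : ℝ≥0∞}
    (hη : η ≠ 0) :
    ∃ γ : ℝ≥0∞, γ ≠ 0 ∧ ∀ (n : ℕ) [NeZero n] (a : Fin n → ℝ),
      w1 (empirical fun i => M.gauge (a i)) (F.map M.gauge) < γ →
      w1 (empirical fun i => M.gauge (M.adjust a i)) (F.map M.gauge) < η := by
  cases M
  · exact exists_w1_adjust_ar_lt hF h0 hη
  · exact exists_w1_adjust_arch_lt h0 (h1 rfl) hη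

end adjusting

/-! ### Consistency of the bootstrap -/

section consistency

variable {p : ℕ} {M : ModelClass}

/-- Continuity of the stationary law in the parameter and in the law of the innovations. -/
lemma exists_stationaryLaw_couplingDist_lt {θ : Fin (M.dim p) → ℝ} (hθ : θ ∈ M.Θ p)
    {F : Measure ℝ} [IsProbabilityMeasure F] (hF : MomentOK M F) (k : ℕ) (t : ℤ)
    (N : Seminorm ℝ (Fin (k + 1) → ℝ)) {δ : ℝ≥0∞} (hδ : 0 < δ) :
    ∃ (r : ℝ) (η : ℝ≥0∞), 0 < r ∧ η ≠ 0 ∧ ∀ θ' ∈ M.Θ p, ∀ (F' : Measure ℝ)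
      (_ : IsProbabilityMeasure F'), MomentOK M F' → (∀ i, |θ' i - θ i| < r) →
      w1 (F'.map M.gauge) (F.map M.gauge) < η →
      ∃ Q, IsTheStationaryLaw p (fun x e => M.G p x θ' e) F' Q ∧
        couplingDist N (fdd Q t k) (fdd (solutionLaw (fun x e => M.G p x θ e) F) t k) < δ := by
  have hT := gauge_isGauge M
  obtain ⟨Λ, hc⟩ := exists_contracts M hθ hF
  set L := ENNReal.ofReal (∑ i, |θ i|)
  have hL : 1 + L ≠ ∞ := by simp [L]
  have hL0 : 1 + L ≠ 0 := by simp
  obtain ⟨κ, hκ, h⟩ := hc.exists_couplingDist_lt hT (L := L) (by simp [L]) k t N hδ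
  have hfin : min κ 1 ≠ ∞ := ne_top_of_le_ne_top ENNReal.one_ne_top (min_le_right _ _)
  set u := (min κ 1).toReal with hu
  have hupos : 0 < u := ENNReal.toReal_pos (by simp [hκ]) hfin
  have huκ : ENNReal.ofReal u ≤ κ := by rw [hu, ENNReal.ofReal_toReal hfin]; exact min_le_left _ _
  have hd : (0 : ℝ) < (M.dim p : ℝ) + 1 := by positivity
  refine ⟨u / 2 / ((M.dim p : ℝ) + 1), ENNReal.ofReal (u / 2) / (1 + L), by positivity, ?_,
    fun θ' hθ' F' _ hF' hr hw => ?_⟩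
  · rw [ne_eq, ENNReal.div_eq_zero_iff, not_or]
    exact ⟨by simpa using hupos, hL⟩
  · obtain ⟨Λ', hc'⟩ := exists_contracts M hθ' hF'
    obtain ⟨π, hπ, hπ1, hπ2, hle⟩ := exists_coupling_gauge hT F' F
    refine ⟨_, hc'.isTheStationaryLaw hT, h _ F' inferInstance Λ' hc' π hπ hπ1 hπ2
      ((stepBound_model M hθ' hθ hπ1 hπ2 hF' hF).mono ?_)⟩
    refine le_trans (add_le_add (b := ENNReal.ofReal (u / 2)) (d := ENNReal.ofReal (u / 2))
      (ENNReal.ofReal_le_ofReal ?_) ?_) ?_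
    · calc ∑ i, |θ' i - θ i| ≤ ∑ _i : Fin (M.dim p), u / 2 / ((M.dim p : ℝ) + 1) :=
            Finset.sum_le_sum fun i _ => (hr i).le
        _ = u / 2 * ((M.dim p : ℝ) / ((M.dim p : ℝ) + 1)) := by
            rw [Finset.sum_const, Finset.card_univ, Fintype.card_fin, nsmul_eq_mul]; ring
        _ ≤ u / 2 := mul_le_of_le_one_right (by positivity) ((div_le_one hd).2 (by linarith))
    · refine (mul_le_mul_right (hle.trans hw.le) _).trans_eq ?_
      exact ENNReal.mul_div_cancel hL0 hL
    · rw [← ENNReal.ofReal_add (by positivity) (by positivity), add_halves]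
      exact huκ

variable {Ω : Type*} [MeasurableSpace Ω] {P : Measure Ω} [IsProbabilityMeasure P]
  {X ε : ℤ → Ω → ℝ}

lemma w1_residuals_lt {θ θ' : Fin (M.dim p) → ℝ} {R : (Fin p → ℝ) × ℝ → ℝ≥0∞} {ν : Measure ℝ}
    {γ : ℝ≥0∞} {n : ℕ} [NeZero n] {ω : Ω}
    (hR : ∀ z, edist (M.gauge (M.w p z.1 z.2 θ')) (M.gauge (M.w p z.1 z.2 θ)) ≤ R z)
    (h1 : (n : ℝ≥0∞)⁻¹ * ∑ i : Fin n, R (lags p X ((i : ℤ) + 1) ω, X ((i : ℤ) + 1) ω) < γ / 2)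
    (h2 : w1 (empirical fun i => M.gauge (residuals p M X n θ ω i)) ν < γ / 2) :
    w1 (empirical fun i => M.gauge (residuals p M X n θ' ω i)) ν < γ := by
  refine (w1_triangle _ (empirical fun i => M.gauge (residuals p M X n θ ω i)) _).trans_lt ?_
  rw [← ENNReal.add_halves γ]
  refine ENNReal.add_lt_add (((w1_empirical_le _ _).trans ?_).trans_lt h1) h2
  exact mul_le_mul_right (Finset.sum_le_sum fun i _ => hR (_, _)) _

lemma measure_mean_lags_le (hX : ∀ t, Measurable (X t)) (hs : IsStationary P X)
    {R : (Fin p → ℝ) × ℝ → ℝ≥0∞} (hR : Measurable R) {q c : ℝ≥0∞} (hc : c ≠ 0) (hc' : c ≠ ∞)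
    (h : ∫⁻ z, R z ∂P.map (fun ω => (lags p X 0 ω, X 0 ω)) ≤ c * q) (n : ℕ) :
    P {ω | c ≤ (n : ℝ≥0∞)⁻¹ *
      ∑ i : Fin n, R (lags p X ((i : ℤ) + 1) ω, X ((i : ℤ) + 1) ω)} ≤ q := by
  have hm (i : Fin n) : Measurable fun ω => R (lags p X ((i : ℤ) + 1) ω, X ((i : ℤ) + 1) ω) :=
    hR.comp (measurable_lags_prodMk hX _)
  rw [lintegral_map hR (measurable_lags_prodMk hX 0)] at h
  have hmk := mul_meas_ge_le_lintegral (μ := P)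
    ((Finset.measurable_sum Finset.univ fun i _ => hm i).const_mul (n : ℝ≥0∞)⁻¹) c
  exact (ENNReal.mul_le_mul_iff_right hc hc').1
    (hmk.trans ((lintegral_mean_lags_le hX hs hR n).trans h))

theorem tendsto_bootstrap {θ θbar : Fin (M.dim p) → ℝ} (hθ : θ ∈ M.Θ p) {Fε : Measure ℝ}
    (hFε : M.InnovationMoments Fε)
    (hX : IsStationarySolution P p (fun x e => M.G p x θ e) Fε X ε)
    {est : (n : ℕ) → (Fin (p + n) → ℝ) → Fin (M.dim p) → ℝ} (hθbar : θbar ∈ M.Θ p)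
    (hlim : TendstoInMeasure P (fun n ω => est n (sample p X n ω)) atTop (fun _ => θbar))
    (hestΘ : Tendsto (fun n : ℕ => P {ω | est n (sample p X n ω) ∉ M.Θ p}) atTop (𝓝 0))
    (hunit : M = .arch → ∫ x, x ^ 2 ∂residualLaw p M P X θbar = 1) (k : ℕ) (t : ℤ)
    (N : Seminorm ℝ (Fin (k + 1) → ℝ)) {δ : ℝ≥0∞} (hδ : 0 < δ) :
    Tendsto (fun n : ℕ => P {ω | ¬ ∃ Q, IsBootstrapLaw p M X est n ω Q ∧
      couplingDist N (fdd Q t k) (fdd (solutionLaw (fun x e => M.G p x θbar e)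
        (residualLaw p M P X θbar)) t k) < δ}) atTop (𝓝 0) := by
  have := hX.isProbabilityMeasure_law
  have hm := momentOK_of_innovationMoments hFε
  have hprob := isProbabilityMeasure_residualLaw (M := M) (P := P) (θ' := θbar)
    hX.measurable_process
  have hFe := momentOK_residualLaw hθ hm hX hθbar hunit
  obtain ⟨r, η, hr, hη, hgood⟩ := exists_stationaryLaw_couplingDist_lt hθbar hFe k t N hδ
  obtain ⟨γ₀, hγ₀, hadj⟩ := exists_w1_adjust_lt M hFe (integral_residualLaw hθ hFε hX) hunit hη
  set γ := min γ₀ 1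
  have hγ : γ / 2 ≠ 0 := by simp [γ, hγ₀]
  have hγ' : γ / 2 ≠ ∞ := ENNReal.div_ne_top
    (ne_top_of_le_ne_top ENNReal.one_ne_top (min_le_right _ _)) (by simp)
  refine ENNReal.tendsto_nhds_zero.2 fun ζ hζ => ?_
  have hq : ζ / 4 ≠ 0 := by simpa using hζ.ne'
  obtain ⟨r', R, hr', hR, hRint, hRle⟩ := exists_residual_bound M hθbar
    (μ := P.map fun ω => (lags p X 0 ω, X 0 ω)) (ρ := γ / 2 * (ζ / 4))
    (by
      rw [lintegral_map (measurable_gsize M) (measurable_lags_prodMk hX.measurable_process 0)]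
      exact lintegral_gsize_ne_top hθ hm hX) (mul_ne_zero hγ hq)
  have e1 := ENNReal.tendsto_nhds_zero.1 hestΘ _ (pos_iff_ne_zero.2 hq)
  have e2 := ENNReal.tendsto_nhds_zero.1 (tendstoInMeasure_iff_dist.1 hlim (min r r')
    (lt_min hr hr')) _ (pos_iff_ne_zero.2 hq)
  have e3 := ENNReal.tendsto_nhds_zero.1 (tendsto_measure_w1_residuals hθ hm hX hθbar hγ) _
    (pos_iff_ne_zero.2 hq)
  filter_upwards [e1, e2, e3, eventually_ge_atTop 1] with n h1 h2 h3 hn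
  have : NeZero n := ⟨by omega⟩
  have h4 := measure_mean_lags_le hX.measurable_process hX.stationary hR hγ hγ' hRint n
  calc _ ≤ P ({ω | est n (sample p X n ω) ∉ M.Θ p} ∪
        {ω | min r r' ≤ dist (est n (sample p X n ω)) θbar} ∪
        {ω | γ / 2 ≤ w1 (empirical fun i => M.gauge (residuals p M X n θbar ω i))
          ((residualLaw p M P X θbar).map M.gauge)} ∪
        {ω | γ / 2 ≤ (n : ℝ≥0∞)⁻¹ *
          ∑ i : Fin n, R (lags p X ((i : ℤ) + 1) ω, X ((i : ℤ) + 1) ω)}) := by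
        refine measure_mono fun ω hω => ?_
        by_contra hcon
        simp only [Set.mem_union, Set.mem_ofPred_eq, not_or, not_not, not_le] at hcon hω
        obtain ⟨⟨⟨c1, c2⟩, c3⟩, c4⟩ := hcon
        have hd (i) : |est n (sample p X n ω) i - θbar i| < min r r' :=
          (dist_le_pi_dist (est n (sample p X n ω)) θbar i).trans_lt c2
        refine hω ?_
        refine hgood _ c1 (empirical (M.adjust (residuals p M X n (est n (sample p X n ω)) ω)))
          inferInstance (momentOK_empirical_adjust M _)
          (fun i => (hd i).trans_le (min_le_left _ _)) ?_
        rw [empirical_map (gauge_isGauge M).measurable]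
        exact hadj n _ ((w1_residuals_lt (hRle _ c1 fun i => (hd i).trans_le (min_le_right _ _))
          c4 c3).trans_le (min_le_left _ _))
    _ ≤ ζ / 4 + ζ / 4 + ζ / 4 + ζ / 4 :=
        (measure_union_le _ _).trans (add_le_add ((measure_union_le _ _).trans (add_le_add
          ((measure_union_le _ _).trans (add_le_add h1 h2)) h3)) h4)
    _ = 4 * (ζ / 4) := by ring
    _ = ζ := ENNReal.mul_div_cancel (by simp) (by simp)

end consistency

end MarkovBootstrap

end

theorem corollary4p1 {Ω : Type*} [MeasurableSpace Ω] (P : Measure Ω) [IsProbabilityMeasure P]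
    (p : ℕ) (M : MarkovBootstrap.ModelClass)
    -- the observed stationary process and its innovations, obeying the AR or the ARCH model
    (X ε : ℤ → Ω → ℝ) (θ : Fin (M.dim p) → ℝ) (hθ : θ ∈ M.Θ p)
    (Fε : Measure ℝ) (hFε : M.InnovationMoments Fε)
    (hX : MarkovBootstrap.IsStationarySolution P p (fun x e => M.G p x θ e) Fε X ε)
    -- the estimator, its limit in probability
    (est : (n : ℕ) → (Fin (p + n) → ℝ) → Fin (M.dim p) → ℝ) (hest : ∀ n, Measurable (est n))
    (θbar : Fin (M.dim p) → ℝ) (hθbar : θbar ∈ M.Θ p)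
    (hB1 : TendstoInMeasure P (fun n ω => est n (MarkovBootstrap.sample p X n ω)) atTop
      (fun _ => θbar))
    -- the estimator lies in the parameter set with probability tending to one
    (hestΘ : Tendsto (fun n : ℕ => P {ω | est n (MarkovBootstrap.sample p X n ω) ∉ M.Θ p})
      atTop (𝓝 0))
    -- the law of the residuals at the limiting parameter
    (Fe : Measure ℝ) (hFe : Fe = MarkovBootstrap.residualLaw p M P X θbar)
    (hdens : MarkovBootstrap.HasBoundedDensity Fe)
    -- ARCH case: `F_e` has the normalisation `E e² = 1` of the model (automatic if `θbar = θ`)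
    (hunit : M = MarkovBootstrap.ModelClass.arch → ∫ x, x ^ 2 ∂Fe = 1) :
    ∃ Qbar : Measure (ℤ → ℝ),
      MarkovBootstrap.IsTheStationaryLaw p (fun x e => M.G p x θbar e) Fe Qbar ∧
      ∀ (k : ℕ) (t : ℤ) (N : Seminorm ℝ (Fin (k + 1) → ℝ)), (∀ x, N x = 0 → x = 0) →
        ∀ δ : ℝ≥0∞, 0 < δ →
          Tendsto (fun n : ℕ => P {ω | ¬ ∃ Q : Measure (ℤ → ℝ),
            MarkovBootstrap.IsBootstrapLaw p M X est n ω Q ∧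
            MarkovBootstrap.couplingDist N (MarkovBootstrap.fdd Q t k)
              (MarkovBootstrap.fdd Qbar t k) < δ}) atTop (𝓝 0) := by
  subst hFe
  have := hX.isProbabilityMeasure_law
  have := MarkovBootstrap.isProbabilityMeasure_residualLaw (M := M) (P := P) (θ' := θbar)
    hX.measurable_process
  obtain ⟨Λ, h⟩ := MarkovBootstrap.exists_contracts M hθbar (MarkovBootstrap.momentOK_residualLaw
    hθ (MarkovBootstrap.momentOK_of_innovationMoments hFε) hX hθbar hunit)
  exact ⟨_, h.isTheStationaryLaw (MarkovBootstrap.gauge_isGauge M), fun k t N _ δ hδ =>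
    MarkovBootstrap.tendsto_bootstrap hθ hFε hX hθbar hB1 hestΘ hunit k t N hδ⟩
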